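/- **Setting.** Let $M$ be a non-empty oriented $m$-dimensional $C^\infty$ manifold (Hausdorff, second countable), $\mathfrak TM$ the total space of $p:TM\oplus T^*M\to M$, whose points are triples $(x,y,z)$, $y\in T_xM$, $z\in T^*_xM$. Every chart $(x^i)$ of $M$ induces natural coordinates $(x^i,y^i,z_i)$ on $\mathfrak TM$. Let $\mathcal V=\ker dp$, identified by the vertical lift with $p^{-1}(TM\oplus T^*M)=\mathcal V_1\oplus\mathcal V_2$, where $\mathcal V_1,\mathcal V_2$ have the local bases $\partial/\partial y^i$, $\partial/\partial z_i$, and let $g((\eta,\zeta),(\eta',\zeta'))=\frac12(\zeta_i\eta'^i+\zeta'_i\eta^i)$ on $\mathcal V$. A *double field* over $M$ is a pair $(\mathcal H,\mathfrak g_{\mathcal V})$, where $\mathcal H$ is a smooth subbundle with $T\mathfrak TM=\mathcal H\oplus\mathcal V$, and $\mathfrak g_{\mathcal V}$ is a smooth non degenerate symmetric form on $\mathcal V$ whose restriction to $\mathcal V_2$ is non degenerate and for which the endomorphism $\phi$ with $2g(\phi Z,Z')=\mathfrak g_{\mathcal V}(Z,Z')$ satisfies $\phi^2=\mathrm{Id}$.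 **Components.** Let $k=\mathfrak g_{\mathcal V}|_{\mathcal V_2}$, $\sigma=k^{-1}$ (a metric on $\mathcal V_1$), $l=pr_{\mathcal V_1}\phi|_{\mathcal V_1}$, and let the 2-form $\psi$ on $\mathcal V_1$ be given by $\flat_\psi=-\flat_\sigma\circ l$, where $\flat_\psi Y=\psi(Y,\cdot)$. Let $\mathcal U_\pm$ be the $\pm1$-eigenbundles of $\phi$, $pr_\pm=\frac12(\mathrm{Id}\pm\phi)$, and let $\iota_\pm:\mathcal V_1\to\mathcal U_\pm$, $\iota_\pm Y=(Y,(\flat_\psi\pm\flat_\sigma)Y)$, be the inverse of $pr_{\mathcal V_1}|_{\mathcal U_\pm}$. **Connections** (only derivatives in vertical directions $Z$ are needed). On $\mathcal V_1$ let $D'^0$ be the Levi-Civita connection of $\sigma$ along the leaves of $\mathcal V_1$ for $Z\in\mathcal V_1$, and $D'^0_ZY=pr_{\mathcal V_1}[Z,Y]$ for $Z\in\mathcal V_2$. For a connection $D$ on $\mathcal V_1$ let $D^{met}_ZY=D_ZY+\frac12\sharp_\sigma\big((D_Z\sigma)(Y,\cdot)\big)$. Put $D^0=(D'^0)^{met}$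 and $D^\pm=(D'^\pm)^{met}$ with $D'^\pm_ZY=D^0_ZY\pm\frac12\sharp_\sigma[i(Y)i(pr_{\mathcal V_1}Z)d_{\mathcal V_1}\psi]$. A pair $(D^+,D^-)$ of connections on $\mathcal V_1$ defines the connection on $\mathcal V$ with $\nabla_Z(\iota_\pm Y)=\iota_\pm(D^\pm_ZY)$; let $\mathcal D^0$ be that of $(D^0,D^0)$. For a connection $\nabla$ on $\mathcal V$ and vertical fields put $$\mathfrak g_{\mathcal V}(A,B\wedge_\nabla C)=\tfrac12[\mathfrak g_{\mathcal V}(B,\nabla_AC)-\mathfrak g_{\mathcal V}(C,\nabla_AB)],\qquad [A,B]_{\mathfrak g_{\mathcal V}}=\mathcal D^0_AB-\mathcal D^0_BA-A\wedge_{\mathcal D^0}B,$$ $$[A,B]^\nabla=[A,B]_{\mathfrak g_{\mathcal V}}+A\wedge_\nabla B,\qquad \tau_\nabla(A,B,C)=\mathfrak g_{\mathcal V}(\nabla_AB-\nabla_BA-[A,B]^\nabla,C).$$ Let $\tilde{\mathcal D}$ be the connection on $\mathcal V$ of the pair $\tilde D^\pm_ZY=D^\pm_{pr_\pm Z}Y+pr_{\mathcal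 V_1}pr_\pm[pr_\mp Z,\iota_\pm Y]_{\mathfrak g_{\mathcal V}}$, and let the field-adapted connection be $\bar{\mathcal D}=\tilde{\mathcal D}+\Phi$ with $\mathfrak g_{\mathcal V}(\Phi(A,B),C)=-\frac13\tau_{\tilde{\mathcal D}}(A,B,C)$. **Curvature.** Put $R(A,B)C=\bar{\mathcal D}_A\bar{\mathcal D}_BC-\bar{\mathcal D}_B\bar{\mathcal D}_AC-\bar{\mathcal D}_{[A,B]^{\bar{\mathcal D}}}C$ for vertical fields $A,B,C$ that are constant along the fibres in natural coordinates (vertical lifts); extended linearly over the smooth functions, $R$ is taken as a tensor on $\mathcal V$. Let $(dx^i,\theta^i,\kappa_i)$ be the cobasis in which $\theta^i,\kappa_i$ vanish on $\mathcal H$ and agree with $dy^i,dz_i$ on $\mathcal V$. Put $$Ric(A,B)=\tfrac12\sum_{i=1}^m\Big[\langle\theta^i,R(\tfrac{\partial}{\partial y^i},A)B\rangle+\langle\kappa_i,R(\tfrac{\partial}{\partial z_i},A)B\rangle+\langle\theta^i,R(\tfrac{\partial}{\partial y^i},B)A\rangle+\langle\kappa_i,R(\tfrac{\partial}{\partial z_i},B)A\rangle\Big],$$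 and let the deformed vertical scalar curvature be $\rho=\sum_{q,s=1}^{2m}\mathfrak g_{\mathcal V}^{qs}Ric_{qs}$, with components in any basis of the vertical space. **Proposition.** Let $(\mathcal H,\mathfrak g_{\mathcal V})$ be a double field over $M$ with density $\varphi\in C^\infty(\mathfrak TM)$. 1. The value of $\rho$ at a point of $\mathfrak TM$ depends neither on the chart of $M$ nor on the basis of the vertical space used to compute it. 2. The form $d(vol)=|\det\sigma|^{1/2}dx^1\wedge\dots\wedge dx^m\wedge\theta^1\wedge\dots\wedge\theta^m\wedge\kappa_1\wedge\dots\wedge\kappa_m$ does not depend on the positive chart $(x^i)$ and has no zeros. 3. $\mathfrak TM$ decomposes into countably many disjoint Borel pieces, each in the domain of the natural coordinates of a positive chart. If $$\mathcal A(\mathfrak g_{\mathcal V},\mathcal H)=\int_{\mathfrak TM}e^{-2\varphi}\rho\,d(vol),$$ computed as the sum of the coordinate integrals over the pieces of one such decomposition, is finite (converges absolutely), then it is finite for every such decomposition, with the same value. 4. The action is invariant: if $f:M\to M$ is an orientation preserving diffeomorphism, $(x,y,z)\mapsto(f(x),f_*y,(f^{-1})^*z)$ its lift to $\mathfrak TM$,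 and $(\mathcal H,\mathfrak g_{\mathcal V},\varphi)$ is the pullback by the lift of $(\mathcal H',\mathfrak g'_{\mathcal V},\varphi')$, where $(\mathcal H',\mathfrak g'_{\mathcal V})$ is a double field, and if the action of the first is finite, then so is that of the second, and the two are equal. -/

import Mathlib

open scoped Manifold ContDiff Bundle
open Bundle MeasureTheory

noncomputable section

namespace BigTangent

/-! ### Calculus on one fibre

`Fin m ⊕ Fin m` indexes the fibre coordinates: `inl i` is `y^i`, `inr i` is `z_i`. On a fixed fibre a
vertical vector field is a map `VVec m → VVec m`, a section of `V₁` is a map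
`VVec m → (Fin m → ℝ)`, and a vertical metric is a matrix function `G`. -/

/-- Index set of the fibre coordinates `(y^i, z_i)`. -/
abbrev VIdx (m : ℕ) := Fin m ⊕ Fin m

/-- Fibre coordinates; also components of a vertical vector in `(∂/∂y^i, ∂/∂z_i)`. -/
abbrev VVec (m : ℕ) := VIdx m → ℝ

/-- Vertical vector fields along a fibre. -/
abbrev VField (m : ℕ) := VVec m → VVec m

/-- Sections of `V₁` along a fibre, in components with respect to `∂/∂y^i`. -/
abbrev V1Field (m : ℕ) := VVec m → (Fin m → ℝ)

/-- Vertical metrics along a fibre, in components with respect to `(∂/∂y^i, ∂/∂z_i)`. -/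
abbrev VMetric (m : ℕ) := VVec m → Matrix (VIdx m) (VIdx m) ℝ

section Fibre

variable {m : ℕ}

/-- The coordinate vector `∂/∂y^i` (for `q = inl i`) or `∂/∂z_i` (for `q = inr i`). -/
def unitVec (q : VIdx m) : VVec m := Pi.single q 1

/-- The `V₁`-component of a vertical vector. -/
def prOne (v : VVec m) : Fin m → ℝ := fun i => v (Sum.inl i)

/-- Partial derivative of a function along the fibre. -/
def pd (q : VIdx m) (f : VVec m → ℝ) : VVec m → ℝ := fun u => fderiv ℝ f u (unitVec q)

/-- `σ = k⁻¹`, where `k^{ij} = g_V(∂/∂z_i, ∂/∂z_j)`. -/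
def sigma (G : VMetric m) (u : VVec m) : Matrix (Fin m) (Fin m) ℝ := ((G u).toBlocks₂₂)⁻¹

/-- `l^i_j = g_V(∂/∂z_i, ∂/∂y^j)`, the `V₁`-part of `φ` on `V₁`. -/
def ell (G : VMetric m) (u : VVec m) : Matrix (Fin m) (Fin m) ℝ := (G u).toBlocks₂₁

/-- `ψ_{ij} = ψ(∂/∂y^i, ∂/∂y^j)`, where `♭_ψ = -♭_σ ∘ l` and `♭_ψ Y = ψ(Y, ·)`. -/
def psi (G : VMetric m) (u : VVec m) : Matrix (Fin m) (Fin m) ℝ :=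
  -((ell G u).transpose * sigma G u)

/-- The product structure `φ` on `V`, given by `2 g(φ Z, Z') = g_V(Z, Z')` with
`2 g((η, ζ), (η', ζ')) = ζ_i η'^i + ζ'_i η^i`. -/
def phi (G : VMetric m) (u : VVec m) : Matrix (VIdx m) (VIdx m) ℝ :=
  Matrix.fromBlocks 0 1 1 0 * G u

/-- The projection of `V` onto the `ε`-eigenbundle `U_ε` of `φ`, for `ε = ±1`. -/
def prU (G : VMetric m) (ε : ℝ) (Z : VField m) : VField m := fun u =>
  (1 / 2 : ℝ) • (Z u + ε • (phi G u).mulVec (Z u))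

/-- `ι_ε Y = (Y, (♭_ψ + ε ♭_σ) Y)`, the inverse of `pr_{V₁} : U_ε → V₁`, for `ε = ±1`. -/
def iota (G : VMetric m) (ε : ℝ) (Y : V1Field m) : VField m := fun u =>
  Sum.elim (Y u) ((psi G u).transpose.mulVec (Y u) + ε • (sigma G u).mulVec (Y u))

/-- A covariant derivative on `V₁` along the fibre, as an operator on fields. -/
abbrev Conn1 (m : ℕ) := VField m → V1Field m → V1Field m

/-- A covariant derivative on `V` along the fibre, as an operator on fields. -/
abbrev ConnV (m : ℕ) := VField m → VField m → VField m

/-- Christoffel symbols `Γ^i_{jk}` of the Levi-Civita connection of `σ` along the leaves of `V₁`. -/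
def christoffel (G : VMetric m) (i j k : Fin m) (u : VVec m) : ℝ :=
  (1 / 2 : ℝ) * ∑ h, (sigma G u)⁻¹ i h *
    (pd (Sum.inl j) (fun v => sigma G v h k) u + pd (Sum.inl k) (fun v => sigma G v h j) u
      - pd (Sum.inl h) (fun v => sigma G v j k) u)

/-- `D'⁰`: the Levi-Civita connection of `σ` in the directions of `V₁`, and
`pr_{V₁}[Z, Y]` (the flat derivative) in the directions `Z` of `V₂`. -/
def connBase (G : VMetric m) : Conn1 m := fun Z Y u i =>
  fderiv ℝ Y u (Z u) i + ∑ j, ∑ k, christoffel G i j k u * prOne (Z u) j * Y u k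

/-- `(D_Z σ)(Y, Y')`. -/
def covSigma (G : VMetric m) (D : Conn1 m) (Z : VField m) (Y Y' : V1Field m) (u : VVec m) : ℝ :=
  fderiv ℝ (fun v => Y v ⬝ᵥ (sigma G v).mulVec (Y' v)) u (Z u)
    - D Z Y u ⬝ᵥ (sigma G u).mulVec (Y' u) - Y u ⬝ᵥ (sigma G u).mulVec (D Z Y' u)

/-- The transformation `D_Z Y ↦ D_Z Y + ½ ♯_σ ((D_Z σ)(Y, ·))` into a `σ`-metric connection. -/
def metrize (G : VMetric m) (D : Conn1 m) : Conn1 m := fun Z Y u =>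
  D Z Y u + (1 / 2 : ℝ) • ((sigma G u)⁻¹).mulVec
    (fun j => covSigma G D Z Y (fun _ => Pi.single j 1) u)

/-- `D⁰`. -/
def connZero (G : VMetric m) : Conn1 m := metrize G (connBase G)

/-- Components of `d_{V₁} ψ`, the exterior derivative along the leaves of `V₁`. -/
def dPsi (G : VMetric m) (u : VVec m) (i j k : Fin m) : ℝ :=
  pd (Sum.inl i) (fun v => psi G v j k) u + pd (Sum.inl j) (fun v => psi G v k i) u
    + pd (Sum.inl k) (fun v => psi G v i j) u

/-- `D'^ε`: `D⁰_Z Y + (ε/2) ♯_σ (i(Y) i(pr_{V₁} Z) d_{V₁} ψ)`, for `ε = ±1`. -/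
def connPsi (G : VMetric m) (ε : ℝ) : Conn1 m := fun Z Y u =>
  connZero G Z Y u + (ε / 2) • ((sigma G u)⁻¹).mulVec
    (fun k => ∑ i, ∑ j, dPsi G u i j k * prOne (Z u) i * Y u j)

/-- `D^ε`, for `ε = ±1`. -/
def connEps (G : VMetric m) (ε : ℝ) : Conn1 m := metrize G (connPsi G ε)

/-- The connection on `V = U₊ ⊕ U₋` with `∇_Z (ι_± Y) = ι_± (D^±_Z Y)`. -/
def doubleConn (G : VMetric m) (Dp Dm : Conn1 m) : ConnV m := fun Z W u =>
  iota G 1 (Dp Z (fun v => prOne (prU G 1 W v))) u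
    + iota G (-1) (Dm Z (fun v => prOne (prU G (-1) W v))) u

/-- `𝒟⁰`, the double metric connection of the pair `(D⁰, D⁰)`. -/
def connVZero (G : VMetric m) : ConnV m := doubleConn G (connZero G) (connZero G)

/-- `Y' ∧_∇ Y''`, given by
`g_V(Y, Y' ∧_∇ Y'') = ½ (g_V(Y', ∇_Y Y'') - g_V(Y'', ∇_Y Y'))`. -/
def wedge (G : VMetric m) (D : ConnV m) (A B : VField m) : VField m := fun u =>
  ((G u)⁻¹).mulVec (fun q => (1 / 2 : ℝ) *
    (A u ⬝ᵥ (G u).mulVec (D (fun _ => unitVec q) B u)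
      - B u ⬝ᵥ (G u).mulVec (D (fun _ => unitVec q) A u)))

/-- The metric bracket `𝒟⁰_A B - 𝒟⁰_B A - A ∧_{𝒟⁰} B`. -/
def metricBracket (G : VMetric m) (A B : VField m) : VField m := fun u =>
  connVZero G A B u - connVZero G B A u - wedge G (connVZero G) A B u

/-- `D̃^ε_Z Y = D^ε_{pr_ε Z} Y + pr_{V₁} pr_ε [pr_{-ε} Z, ι_ε Y]`, where `pr_{±ε}` projects onto
`U_{±ε}` and the bracket is the metric bracket. -/
def connTilde (G : VMetric m) (ε : ℝ) : Conn1 m := fun Z Y u =>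
  connEps G ε (prU G ε Z) Y u
    + prOne (prU G ε (metricBracket G (prU G (-ε) Z) (iota G ε Y)) u)

/-- `𝒟̃`, the double metric connection of the pair `(D̃⁺, D̃⁻)`. -/
def connVTilde (G : VMetric m) : ConnV m := doubleConn G (connTilde G 1) (connTilde G (-1))

/-- The deformed Lie bracket of a connection. -/
def deformedBracket (G : VMetric m) (D : ConnV m) (A B : VField m) : VField m := fun u =>
  metricBracket G A B u + wedge G D A B u

/-- The deformed torsion of a connection. -/
def deformedTorsion (G : VMetric m) (D : ConnV m) (A B : VField m) : VField m := fun u =>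
  D A B u - D B A u - deformedBracket G D A B u

/-- The Gualtieri torsion of a connection. -/
def gualtieriTorsion (G : VMetric m) (D : ConnV m) (A B C : VField m) (u : VVec m) : ℝ :=
  deformedTorsion G D A B u ⬝ᵥ (G u).mulVec (C u)

/-- The field-adapted connection `𝒟̄ = 𝒟̃ + Φ`, where `g_V(Φ(A, B), C) = -⅓ τ_{𝒟̃}(A, B, C)`. -/
def fieldAdapted (G : VMetric m) : ConnV m := fun A B u =>
  connVTilde G A B u + ((G u)⁻¹).mulVec
    (fun q => -(1 / 3 : ℝ) * gualtieriTorsion G (connVTilde G) A B (fun _ => unitVec q) u)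

/-- The deformed curvature `𝒟̄_A 𝒟̄_B C - 𝒟̄_B 𝒟̄_A C - 𝒟̄_{[A,B]} C`, with the deformed Lie bracket
of `𝒟̄`. -/
def deformedCurvature (G : VMetric m) (A B C : VField m) : VField m := fun u =>
  fieldAdapted G A (fieldAdapted G B C) u - fieldAdapted G B (fieldAdapted G A C) u
    - fieldAdapted G (deformedBracket G (fieldAdapted G) A B) C u

/-- The deformed Ricci curvature of two vertical vectors, which are extended to the fibre as vector
fields with constant components (vertical lifts). The sum over `q` collects the contractions of
`∂/∂y^i` with `θ^i` and of `∂/∂z_i` with `κ_i`. -/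
def deformedRicci (G : VMetric m) (v w : VVec m) (u : VVec m) : ℝ :=
  (1 / 2 : ℝ) * ∑ q : VIdx m,
    (deformedCurvature G (fun _ => unitVec q) (fun _ => v) (fun _ => w) u q
      + deformedCurvature G (fun _ => unitVec q) (fun _ => w) (fun _ => v) u q)

/-- The deformed scalar curvature `g_V^{qs} Ric_{qs}`, with components taken in the basis `b`. -/
def deformedScalar (G : VMetric m) (b : VIdx m → VVec m) (u : VVec m) : ℝ :=
  ∑ q, ∑ s, (Matrix.of fun i j => b i ⬝ᵥ (G u).mulVec (b j))⁻¹ q s * deformedRicci G (b q) (b s) u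

end Fibre

/-! ### The big tangent manifold -/

section Manifold

variable (m : ℕ) (M : Type*) [TopologicalSpace M] [ChartedSpace (Fin m → ℝ) M]
  [IsManifold 𝓘(ℝ, Fin m → ℝ) ∞ M]

variable {M} in
/-- `T_x M ⊕ T_x^* M`, which is also the vertical space at each point over `x`. -/
abbrev BigFiber (x : M) : Type :=
  TangentSpace 𝓘(ℝ, Fin m → ℝ) x × (TangentSpace 𝓘(ℝ, Fin m → ℝ) x →L[ℝ] ℝ)

/-- The model fibre of `TM ⊕ T^*M`. -/
abbrev ModelFiber : Type := (Fin m → ℝ) × ((Fin m → ℝ) →L[ℝ] ℝ)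

/-- The total space of `TM ⊕ T^*M`; its points are triples `(x, y, z)`. -/
abbrev BigTan : Type _ :=
  TotalSpace (ModelFiber m)
    ((TangentSpace 𝓘(ℝ, Fin m → ℝ) : M → Type _) ×ᵇ
      fun x : M => TangentSpace 𝓘(ℝ, Fin m → ℝ) x →L[ℝ] Bundle.Trivial M ℝ x)

/-- The model with corners of the big tangent manifold. -/
abbrev BigModel := (𝓘(ℝ, Fin m → ℝ)).prod 𝓘(ℝ, ModelFiber m)

variable {m : ℕ} {M : Type*} [TopologicalSpace M] [ChartedSpace (Fin m → ℝ) M]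
  [IsManifold 𝓘(ℝ, Fin m → ℝ) ∞ M]

/-- The smooth charts of `M`. -/
abbrev smoothCharts (m : ℕ) (M : Type*) [TopologicalSpace M] [ChartedSpace (Fin m → ℝ) M] :
    Set (OpenPartialHomeomorph M (Fin m → ℝ)) :=
  IsManifold.maximalAtlas 𝓘(ℝ, Fin m → ℝ) ∞ M

/-- The differential at `x` of a chart. -/
def chartDiff (c : OpenPartialHomeomorph M (Fin m → ℝ)) (x : M) :
    TangentSpace 𝓘(ℝ, Fin m → ℝ) x →L[ℝ] (Fin m → ℝ) :=
  mfderiv 𝓘(ℝ, Fin m → ℝ) 𝓘(ℝ, Fin m → ℝ) c x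

/-- The components `(η^i, ζ_i)` of an element of `T_x M ⊕ T_x^* M` in a chart. -/
def fibreCoord (c : OpenPartialHomeomorph M (Fin m → ℝ)) (x : M) (Z : BigFiber (m := m) x) :
    VVec m :=
  Sum.elim (chartDiff c x Z.1) (fun i => Z.2 ((chartDiff c x).inverse (Pi.single i 1)))

/-- The element `η^i ∂/∂x^i + ζ_i dx^i` of `T_x M ⊕ T_x^* M` with given components in a chart. -/
def fibreVec (c : OpenPartialHomeomorph M (Fin m → ℝ)) (x : M) (w : VVec m) :
    BigFiber (m := m) x :=
  ((chartDiff c x).inverse (fun i => w (Sum.inl i)),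
    (∑ i, w (Sum.inr i) • ContinuousLinearMap.proj (R := ℝ) (φ := fun _ : Fin m => ℝ) i).comp
      (chartDiff c x))

/-- The natural coordinates `(x^i; y^i, z_i)` of the big tangent manifold induced by a chart. -/
def natChart (c : OpenPartialHomeomorph M (Fin m → ℝ)) (p : BigTan m M) :
    (Fin m → ℝ) × VVec m :=
  (c p.proj, fibreCoord c p.proj p.snd)

/-- The inverse of `natChart`: the point with given natural coordinates. -/
def natParam (c : OpenPartialHomeomorph M (Fin m → ℝ)) (a : (Fin m → ℝ) × VVec m) :
    BigTan m M :=
  ⟨c.symm a.1, fibreVec c (c.symm a.1) a.2⟩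

/-- The natural coordinate vector fields `∂/∂x^i`, `∂/∂y^i`, `∂/∂z_i`, at the point with natural
coordinates `a`. -/
def natFrame (c : OpenPartialHomeomorph M (Fin m → ℝ)) (a : (Fin m → ℝ) × VVec m) :
    Fin m ⊕ VIdx m → TangentSpace (BigModel m) (natParam c a) :=
  Sum.elim
    (fun i => mfderiv 𝓘(ℝ, (Fin m → ℝ) × VVec m) (BigModel m) (natParam c) a (Pi.single i 1, 0))
    (fun q => mfderiv 𝓘(ℝ, (Fin m → ℝ) × VVec m) (BigModel m) (natParam c) a (0, unitVec q))

/-- The differential at `p` of the natural coordinates. -/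
def natDiff (c : OpenPartialHomeomorph M (Fin m → ℝ)) (p : BigTan m M) :
    TangentSpace (BigModel m) p →L[ℝ] (Fin m → ℝ) × VVec m :=
  mfderiv (BigModel m) 𝓘(ℝ, (Fin m → ℝ) × VVec m) (natChart c) p

/-- The vertical space, the kernel of the differential of the projection onto `M`. -/
def vertical (p : BigTan m M) : Submodule ℝ (TangentSpace (BigModel m) p) :=
  (mfderiv (BigModel m) 𝓘(ℝ, Fin m → ℝ) (fun q : BigTan m M => q.proj) p).ker

/-- The para-Hermitian metric `g((X, α), (Y, μ)) = ½ (α(Y) + μ(X))`. -/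
def paraMetric (x : M) (Z W : BigFiber (m := m) x) : ℝ := (1 / 2 : ℝ) * (Z.2 W.1 + W.2 Z.1)

/-- Components of a form on the bundle `V ≈ p⁻¹(TM ⊕ T^*M)` in the basis `(∂/∂y^i, ∂/∂z_i)` of a
chart, along the fibre over `x`. -/
def comps (g : ∀ p : BigTan m M, LinearMap.BilinForm ℝ (BigFiber (m := m) p.proj))
    (c : OpenPartialHomeomorph M (Fin m → ℝ)) (x : M) : VMetric m := fun u =>
  Matrix.of fun q s => g ⟨x, fibreVec c x u⟩ (fibreVec c x (unitVec q)) (fibreVec c x (unitVec s))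

/-- A double field: a smooth horizontal bundle `hor` and a smooth, strongly non degenerate,
compatible vertical metric `metric`. The vertical space at `p` is identified with
`T_x M ⊕ T_x^* M` by the vertical lift. -/
structure DoubleField (m : ℕ) (M : Type*) [TopologicalSpace M] [ChartedSpace (Fin m → ℝ) M]
    [IsManifold 𝓘(ℝ, Fin m → ℝ) ∞ M] where
  /-- the horizontal bundle -/
  hor : ∀ p : BigTan m M, Submodule ℝ (TangentSpace (BigModel m) p)
  isCompl : ∀ p, IsCompl (vertical p) (hor p)
  /-- the coefficients `t^i_j`, `τ_{ij}` of the horizontal bundle are smooth: these are the vertical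
  components of the projections of `∂/∂x^j` onto the vertical bundle along `hor` -/
  smooth_hor : ∀ c ∈ smoothCharts m M, ∀ j : Fin m, ContDiffOn ℝ ∞
    (fun a => (natDiff c (natParam c a) (Submodule.projectionOnto _ _
      (isCompl (natParam c a)) (natFrame c a (Sum.inl j)) : TangentSpace (BigModel m) _)).2)
    (c.target ×ˢ Set.univ)
  /-- the vertical metric -/
  metric : ∀ p : BigTan m M, LinearMap.BilinForm ℝ (BigFiber (m := m) p.proj)
  symm : ∀ p Z W, metric p Z W = metric p W Z
  nondegenerate : ∀ p, (metric p).Nondegenerate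
  /-- non degeneracy on `V₂` -/
  strong : ∀ p, ∀ α : TangentSpace 𝓘(ℝ, Fin m → ℝ) p.proj →L[ℝ] ℝ,
    (∀ β : TangentSpace 𝓘(ℝ, Fin m → ℝ) p.proj →L[ℝ] ℝ, metric p (0, α) (0, β) = 0) → α = 0
  /-- the endomorphism `φ` with `2 g(φ Z, W) = g_V(Z, W)` satisfies `φ² = Id` -/
  compatible : ∀ p, ∃ φ : Module.End ℝ (BigFiber (m := m) p.proj),
    (∀ Z W, 2 * paraMetric p.proj (φ Z) W = metric p Z W) ∧ ∀ Z, φ (φ Z) = Z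
  smooth_metric : ∀ c ∈ smoothCharts m M, ∀ q s : VIdx m, ContDiffOn ℝ ∞
    (fun a : (Fin m → ℝ) × VVec m => comps metric c (c.symm a.1) a.2 q s) (c.target ×ˢ Set.univ)

namespace DoubleField

variable (F : DoubleField m M)

/-- The deformed, vertical, scalar curvature at `p`, computed in the natural coordinates of the chart
`c`, with contraction in a basis `b` of the vertical space at `p`. -/
def scalar (c : OpenPartialHomeomorph M (Fin m → ℝ)) (p : BigTan m M)
    (b : VIdx m → BigFiber (m := m) p.proj) : ℝ :=
  deformedScalar (comps F.metric c p.proj) (fun q => fibreCoord c p.proj (b q))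
    (fibreCoord c p.proj p.snd)

/-- The scalar curvature with contraction in the natural basis `(∂/∂y^i, ∂/∂z_i)` of the chart. -/
def natScalar (c : OpenPartialHomeomorph M (Fin m → ℝ)) (p : BigTan m M) : ℝ :=
  F.scalar c p (fun q => fibreVec c p.proj (unitVec q))

/-- `det (σ_{ij})` in a chart. -/
def detSigma (c : OpenPartialHomeomorph M (Fin m → ℝ)) (p : BigTan m M) : ℝ :=
  (sigma (comps F.metric c p.proj) (fibreCoord c p.proj p.snd)).det

/-- The cobasis `(dx^i, θ^i, κ_i)` of a chart: `θ^i`, `κ_i` are the forms that vanish on the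
horizontal bundle and agree with `dy^i`, `dz_i` on the vertical bundle. -/
def cobasis (c : OpenPartialHomeomorph M (Fin m → ℝ)) (p : BigTan m M) :
    TangentSpace (BigModel m) p →ₗ[ℝ] (Fin m ⊕ VIdx m → ℝ) :=
  LinearMap.pi (Sum.elim
    (fun i => LinearMap.proj i ∘ₗ LinearMap.fst ℝ (Fin m → ℝ) (VVec m) ∘ₗ (natDiff c p).toLinearMap)
    (fun q => LinearMap.proj q ∘ₗ LinearMap.snd ℝ (Fin m → ℝ) (VVec m) ∘ₗ
      (natDiff c p).toLinearMap ∘ₗ (vertical p).subtype ∘ₗ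
        Submodule.projectionOnto _ _ (F.isCompl p)))

/-- The form `|det σ|^{1/2} dx¹ ∧ … ∧ dx^m ∧ θ¹ ∧ … ∧ θ^m ∧ κ₁ ∧ … ∧ κ_m` of a chart. -/
def volForm (c : OpenPartialHomeomorph M (Fin m → ℝ)) (p : BigTan m M) :
    TangentSpace (BigModel m) p [⋀^(Fin m ⊕ VIdx m)]→ₗ[ℝ] ℝ :=
  Real.sqrt |F.detSigma c p| • Matrix.detRowAlternating.compLinearMap (F.cobasis c p)

/-- The form `e^{-2φ} ρ d(vol)` in the natural coordinates of a chart, as the function that stands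
before `dx¹ ∧ … ∧ dx^m ∧ dy¹ ∧ … ∧ dy^m ∧ dz₁ ∧ … ∧ dz_m`. -/
def integrand (φ : BigTan m M → ℝ) (c : OpenPartialHomeomorph M (Fin m → ℝ))
    (a : (Fin m → ℝ) × VVec m) : ℝ :=
  Real.exp (-2 * φ (natParam c a)) * F.natScalar c (natParam c a)
    * F.volForm c (natParam c a) (natFrame c a)

end DoubleField

/-- An orientation of `M`: a maximal family of smooth charts that cover `M` and have positive
Jacobians with one another. -/
structure Orientation (m : ℕ) (M : Type*) [TopologicalSpace M] [ChartedSpace (Fin m → ℝ) M]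
    [IsManifold 𝓘(ℝ, Fin m → ℝ) ∞ M] where
  /-- the positive charts -/
  charts : Set (OpenPartialHomeomorph M (Fin m → ℝ))
  subset : charts ⊆ smoothCharts m M
  cover : ∀ x : M, ∃ c ∈ charts, x ∈ c.source
  jacobian_pos : ∀ c ∈ charts, ∀ c' ∈ charts, ∀ x ∈ c.source ∩ c'.source,
    0 < (fderiv ℝ (c' ∘ c.symm) (c x)).det
  maximal : ∀ c ∈ smoothCharts m M, (∀ c' ∈ charts, ∀ x ∈ c.source ∩ c'.source,
    0 < (fderiv ℝ (c' ∘ c.symm) (c x)).det) → c ∈ charts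

/-- A decomposition of the big tangent manifold into countably many disjoint Borel pieces, each in the
domain of the natural coordinates of a positive chart. -/
structure Decomposition (O : Orientation m M) where
  /-- the positive charts -/
  chart : ℕ → OpenPartialHomeomorph M (Fin m → ℝ)
  chart_mem : ∀ n, chart n ∈ O.charts
  /-- the pieces -/
  piece : ℕ → Set (BigTan m M)
  measurable : ∀ n, MeasurableSet[borel (BigTan m M)] (piece n)
  piece_subset : ∀ n, ∀ p ∈ piece n, p.proj ∈ (chart n).source
  disjoint : Pairwise fun n k => Disjoint (piece n) (piece k)
  iUnion : ⋃ n, piece n = Set.univ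

namespace DoubleField

variable {O : Orientation m M}

/-- The integral of `e^{-2φ} ρ d(vol)` over the big tangent manifold is finite: it converges
absolutely, when computed through the decomposition `d`. -/
def FiniteAction (F : DoubleField m M) (φ : BigTan m M → ℝ) (d : Decomposition O) : Prop :=
  (∀ n, IntegrableOn (F.integrand φ (d.chart n)) (natChart (d.chart n) '' d.piece n)) ∧
    Summable fun n => ∫ a in natChart (d.chart n) '' d.piece n, |F.integrand φ (d.chart n) a|

/-- The integral of `e^{-2φ} ρ d(vol)` over the big tangent manifold, computed through the
decomposition `d`. -/
def action (F : DoubleField m M) (φ : BigTan m M → ℝ) (d : Decomposition O) : ℝ :=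
  ∑' n, ∫ a in natChart (d.chart n) '' d.piece n, F.integrand φ (d.chart n) a

end DoubleField

section Lift

variable {N : Type*} [TopologicalSpace N] [ChartedSpace (Fin m → ℝ) N]
  [IsManifold 𝓘(ℝ, Fin m → ℝ) ∞ N]

/-- The isomorphism `T_x M ⊕ T_x^* M → T_{f x} N ⊕ T_{f x}^* N` induced by a diffeomorphism. -/
def liftFibre (f : M ≃ₘ^∞⟮𝓘(ℝ, Fin m → ℝ), 𝓘(ℝ, Fin m → ℝ)⟯ N) (x : M)
    (Z : BigFiber (m := m) x) : BigFiber (m := m) (f x) :=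
  (mfderiv 𝓘(ℝ, Fin m → ℝ) 𝓘(ℝ, Fin m → ℝ) f x Z.1,
    Z.2.comp (mfderiv 𝓘(ℝ, Fin m → ℝ) 𝓘(ℝ, Fin m → ℝ) f x).inverse)

/-- The map `(x, y, z) ↦ (f x, f_* y, (f⁻¹)^* z)` of big tangent manifolds. -/
def lift (f : M ≃ₘ^∞⟮𝓘(ℝ, Fin m → ℝ), 𝓘(ℝ, Fin m → ℝ)⟯ N) (p : BigTan m M) : BigTan m N :=
  ⟨f p.proj, liftFibre f p.proj p.snd⟩

/-- `F` is the pullback of the double field `F'` by a diffeomorphism. -/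
structure IsPullback (f : M ≃ₘ^∞⟮𝓘(ℝ, Fin m → ℝ), 𝓘(ℝ, Fin m → ℝ)⟯ N)
    (F : DoubleField m M) (F' : DoubleField m N) : Prop where
  hor : ∀ p, F.hor p = (F'.hor (lift f p)).comap
    (mfderiv (BigModel m) (BigModel m) (lift f) p).toLinearMap
  metric : ∀ p Z W, F.metric p Z W =
    F'.metric (lift f p) (liftFibre f p.proj Z) (liftFibre f p.proj W)

/-- The diffeomorphism `f` is compatible with the orientations. -/
def PreservesOrientation (f : M ≃ₘ^∞⟮𝓘(ℝ, Fin m → ℝ), 𝓘(ℝ, Fin m → ℝ)⟯ N)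
    (O : Orientation m M) (O' : Orientation m N) : Prop :=
  ∀ c ∈ O'.charts, f.toHomeomorph.toOpenPartialHomeomorph.trans c ∈ O.charts

end Lift

end Manifold

end BigTangent

end

/-! Over a fixed point `x` of `M`, two systems of natural fibre coordinates differ by a linear map
`T = diag(J, K)`, where `J` is the Jacobian of the change of charts and `K` its inverse transpose.
`T` depends on `x` but is constant along the fibre. Since the curvature involves only derivatives
along the fibre, it belongs to calculus on one vector space, in which `T` is a linear change of
variables. Flat derivatives then correspond (`FieldRel.fderiv_eq`), constant fields go to constant
fields, so that vertical lifts make sense without a chart, and raising an index commutes with `T`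
(`FormRel.sharp_eq`, `transpose_mulVec_form`). Every stage of the construction is therefore natural,
up to `FrameChange.deformedCurvature_eq`.

The Ricci form is a symmetrized trace, hence unchanged by conjugation with `T`. It is bilinear in
the vertical lifts, so its contraction with the inverse metric is the same in all bases
(`sum_inv_gram_mul`). These two facts give the invariance of the scalar curvature.

For the volume form, `det T = 1`, so `dx ∧ θ ∧ κ` is multiplied by `det J`, while `σ = Jᵀ σ' J`
makes `√|det σ|` vary by `|det J|` in the opposite sense; the factors cancel for positive charts. In
coordinates, the transition map of the total space is block triangular with diagonal blocks `J` and
`T`. Its determinant is again `det J`, which is what the change of variables formula requires of the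
integrand. Two decompositions are then compared on the intersections of their pieces, where an
absolutely convergent double series may be summed in either order.

A diffeomorphism `f` turns a chart `c` into `c ∘ f`. In these charts the lift of `f` is the
identity, so the two actions have the same coordinate integrals; independence of the decomposition
does the rest.

The proof carries smoothness and `ℝ`-linearity of every operator on fields alongside its naturality:
smoothness justifies each chain rule, and linearity makes values on basis vectors transform as
components of a covector. -/

noncomputable section

namespace BigTangent

set_option linter.unusedSectionVars false

/-! ### Charts, their Jacobians, and natural coordinates on the big tangent manifold. -/

section Charts

variable {m : ℕ} {M : Type*} [TopologicalSpace M] [ChartedSpace (Fin m → ℝ) M]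
  [IsManifold 𝓘(ℝ, Fin m → ℝ) ∞ M]
  {c c' : OpenPartialHomeomorph M (Fin m → ℝ)} {x : M}

theorem mdifferentiable_of_mem_smoothCharts (hc : c ∈ smoothCharts m M) :
    c.MDifferentiable 𝓘(ℝ, Fin m → ℝ) 𝓘(ℝ, Fin m → ℝ) :=
  ⟨(contMDiffOn_of_mem_maximalAtlas hc).mdifferentiableOn (by simp),
    (contMDiffOn_symm_of_mem_maximalAtlas hc).mdifferentiableOn (by simp)⟩

theorem chartDiff_isInvertible (hc : c ∈ smoothCharts m M) (hx : x ∈ c.source) :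
    (chartDiff c x).IsInvertible :=
  ⟨(mdifferentiable_of_mem_smoothCharts hc).mfderiv hx, rfl⟩

theorem inverse_chartDiff (hc : c ∈ smoothCharts m M) (hx : x ∈ c.source) :
    (chartDiff c x).inverse = mfderiv 𝓘(ℝ, Fin m → ℝ) 𝓘(ℝ, Fin m → ℝ) c.symm (c x) := by
  have h := mdifferentiable_of_mem_smoothCharts hc
  refine ContinuousLinearMap.inverse_eq ?_ (h.symm_comp_deriv hx)
  have := h.comp_symm_deriv (c.map_source hx)
  rw [c.left_inv hx] at this
  exact this

/-- The Jacobian at `x` of the change of charts from `c` to `c'`. -/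
def jac (c c' : OpenPartialHomeomorph M (Fin m → ℝ)) (x : M) :
    (Fin m → ℝ) →L[ℝ] (Fin m → ℝ) :=
  (chartDiff c' x).comp (chartDiff c x).inverse

theorem jac_eq_fderiv (hc : c ∈ smoothCharts m M) (hc' : c' ∈ smoothCharts m M)
    (hx : x ∈ c.source) (hx' : x ∈ c'.source) :
    jac c c' x = fderiv ℝ (c' ∘ c.symm) (c x) := by
  rw [jac, inverse_chartDiff hc hx, ← mfderiv_eq_fderiv]
  have h1 := (mdifferentiable_of_mem_smoothCharts hc).mdifferentiableAt_symm (c.map_source hx)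
  have h2 := (mdifferentiable_of_mem_smoothCharts hc').mdifferentiableAt hx'
  -- The points `c.symm (c x)` and `x` are only propositionally equal, so their tangent spaces are
  -- different types; a free point `y` allows substitution.
  have h3 : ∀ y, y = x → (mfderiv 𝓘(ℝ, Fin m → ℝ) 𝓘(ℝ, Fin m → ℝ) c' y :
      (Fin m → ℝ) →L[ℝ] (Fin m → ℝ)) = chartDiff c' x := by
    rintro _ rfl
    rfl
  rw [mfderiv_comp_of_eq h2 h1 (c.left_inv hx)]
  exact congrArg (fun L : (Fin m → ℝ) →L[ℝ] (Fin m → ℝ) => L.comp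
    (mfderiv 𝓘(ℝ, Fin m → ℝ) 𝓘(ℝ, Fin m → ℝ) c.symm (c x) : (Fin m → ℝ) →L[ℝ] (Fin m → ℝ)))
    (h3 _ (c.left_inv hx)).symm

/-- Near `x` the Jacobian is the ordinary derivative of the smooth map `c' ∘ c.symm`, evaluated at
`c y`. -/
theorem contMDiffAt_jac (hc : c ∈ smoothCharts m M) (hc' : c' ∈ smoothCharts m M)
    (hx : x ∈ c.source) (hx' : x ∈ c'.source) :
    ContMDiffAt 𝓘(ℝ, Fin m → ℝ) 𝓘(ℝ, (Fin m → ℝ) →L[ℝ] (Fin m → ℝ)) ∞ (jac c c') x := by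
  have h : ContDiffAt ℝ ∞ (c' ∘ c.symm) (c x) := by
    rw [← contMDiffAt_iff_contDiffAt]
    exact ContMDiffAt.comp_of_eq (contMDiffAt_of_mem_maximalAtlas hc' hx')
      (contMDiffAt_symm_of_mem_maximalAtlas hc (c.map_source hx)) (c.left_inv hx)
  have h' : ContMDiffAt 𝓘(ℝ, Fin m → ℝ) 𝓘(ℝ, (Fin m → ℝ) →L[ℝ] (Fin m → ℝ)) ∞
      (fun y => fderiv ℝ (c' ∘ c.symm) (c y)) x :=
    ContMDiffAt.comp (I' := 𝓘(ℝ, Fin m → ℝ)) x (h.fderiv_right (m := ∞) (by simp)).contMDiffAt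
      (contMDiffAt_of_mem_maximalAtlas hc hx)
  refine h'.congr_of_eventuallyEq ?_
  filter_upwards [c.open_source.mem_nhds hx, c'.open_source.mem_nhds hx'] with y hy hy'
  exact jac_eq_fderiv hc hc' hy hy'

theorem jac_comp_chartDiff (hc : c ∈ smoothCharts m M) (hx : x ∈ c.source) :
    (jac c c' x).comp (chartDiff c x) = chartDiff c' x := by
  rw [jac, ContinuousLinearMap.comp_assoc, (chartDiff_isInvertible hc hx).inverse_comp_self]
  rfl

theorem jac_comp_jac (hc : c ∈ smoothCharts m M) (hc' : c' ∈ smoothCharts m M)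
    (hx : x ∈ c.source) (hx' : x ∈ c'.source) :
    (jac c c' x).comp (jac c' c x) = ContinuousLinearMap.id ℝ _ := by
  conv_lhs => rw [jac.eq_1 c' c]
  rw [← ContinuousLinearMap.comp_assoc, jac_comp_chartDiff hc hx,
    (chartDiff_isInvertible hc' hx').self_comp_inverse]

theorem inverse_chartDiff_comp_jac (hc' : c' ∈ smoothCharts m M) (hx' : x ∈ c'.source) :
    (chartDiff c' x).inverse.comp (jac c c' x) = (chartDiff c x).inverse := by
  rw [jac, ← ContinuousLinearMap.comp_assoc, (chartDiff_isInvertible hc' hx').inverse_comp_self]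
  rfl

/-! ### Smoothness of the natural coordinates -/

theorem fibreCoord_fibreVec (hc : c ∈ smoothCharts m M) (hx : x ∈ c.source) (w : VVec m) :
    fibreCoord c x (fibreVec c x w) = w := by
  have h := chartDiff_isInvertible hc hx
  ext (i | i)
  · simp [fibreCoord, fibreVec, h.self_apply_inverse]
  · simp [fibreCoord, fibreVec, h.self_apply_inverse, Pi.single_apply]

theorem fibreVec_fibreCoord (hc : c ∈ smoothCharts m M) (hx : x ∈ c.source)
    (Z : BigFiber (m := m) x) :
    fibreVec c x (fibreCoord c x Z) = Z := by
  have h := chartDiff_isInvertible hc hx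
  refine Prod.ext ?_ ?_
  · simp [fibreCoord, fibreVec, h.inverse_apply_self]
  · refine ContinuousLinearMap.ext fun y => ?_
    simp only [fibreVec, fibreCoord, ContinuousLinearMap.comp_apply, _root_.sum_apply,
      _root_.smul_apply, ContinuousLinearMap.proj_apply, Sum.elim_inr, smul_eq_mul]
    obtain ⟨w, rfl⟩ := h.inverse.surjective y
    rw [h.self_apply_inverse]
    conv_rhs => rw [pi_eq_sum_univ' w]
    simp [map_sum, mul_comm]

/-- The chart of the preferred atlas around a point. -/
abbrev baseChart (m : ℕ) {M : Type*} [TopologicalSpace M] [ChartedSpace (Fin m → ℝ) M] (x : M) :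
    OpenPartialHomeomorph M (Fin m → ℝ) := chartAt (Fin m → ℝ) x

/-- The smooth structure of the total space is defined by these trivializations. In terms of
`chartDiff` they are the fibre part of the natural coordinates of a preferred chart, with the
covector not yet split into components. -/
theorem trivializationAt_bigTan (x₀ : M) (p : BigTan m M)
    (hp : p.proj ∈ (baseChart m x₀).source) :
    (trivializationAt (ModelFiber m) ((TangentSpace 𝓘(ℝ, Fin m → ℝ) : M → Type _) ×ᵇ
      fun x : M => TangentSpace 𝓘(ℝ, Fin m → ℝ) x →L[ℝ] Bundle.Trivial M ℝ x) x₀ p).2 =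
      (chartDiff (baseChart m x₀) p.proj p.snd.1,
        ContinuousLinearMap.comp p.snd.2 (chartDiff (baseChart m x₀) p.proj).inverse) := by
  have hb : p.proj ∈ (trivializationAt (Fin m → ℝ) (TangentSpace 𝓘(ℝ, Fin m → ℝ)) x₀).baseSet := hp
  refine Prod.ext ?_ ?_
  · have h1 := TangentBundle.continuousLinearMapAt_trivializationAt (I := 𝓘(ℝ, Fin m → ℝ)) hp
    exact (Bundle.Trivialization.continuousLinearMapAt_apply_of_mem (R := ℝ) _ hb p.snd.1).symm.trans
      (congrArg (fun L => L p.snd.1) h1)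
  · have h2 := TangentBundle.symmL_trivializationAt (I := 𝓘(ℝ, Fin m → ℝ)) hp
    rw [inverse_chartDiff (IsManifold.chart_mem_maximalAtlas x₀) hp]
    refine ContinuousLinearMap.ext fun v => ?_
    have h3 := congrArg (fun L => L v) h2
    rw [modelWithCornersSelf_coe, Set.range_id, mfderivWithin_univ] at h3
    refine Eq.trans ?_ (congrArg p.snd.2 h3)
    -- On covectors the trivialization also composes with that of the trivial line bundle, which is
    -- the identity.
    change (Bundle.Trivialization.continuousLinearMapAt ℝ (Bundle.Trivial.trivialization M ℝ) p.proj)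
      (p.snd.2 _) = _
    rw [Bundle.Trivial.continuousLinearMapAt_trivialization]
    rfl

/-- The trivialization gives smooth fibre coordinates for the preferred chart `κ`; those of `c`
arise from them through the Jacobians between `κ` and `c`, which are smooth in the base point. -/
theorem contMDiffAt_natChart (hc : c ∈ smoothCharts m M) {p : BigTan m M}
    (hp : p.proj ∈ c.source) :
    ContMDiffAt (BigModel m) 𝓘(ℝ, (Fin m → ℝ) × VVec m) ∞ (natChart c) p := by
  set κ := baseChart m p.proj with hκdef
  have hκ : κ ∈ smoothCharts m M := IsManifold.chart_mem_maximalAtlas p.proj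
  have hpκ : p.proj ∈ κ.source := mem_chart_source _ _
  obtain ⟨h1, h2⟩ := contMDiffAt_totalSpace.1 (contMDiffAt_id (I := BigModel m) (n := ∞) (x := p))
  set T := fun q : BigTan m M => (trivializationAt (ModelFiber m)
    ((TangentSpace 𝓘(ℝ, Fin m → ℝ) : M → Type _) ×ᵇ
      fun x : M => TangentSpace 𝓘(ℝ, Fin m → ℝ) x →L[ℝ] Bundle.Trivial M ℝ x) p.proj q).2
  have hT : ContMDiffAt (BigModel m) 𝓘(ℝ, ModelFiber m) ∞ T p := h2
  have hT1 : ContMDiffAt (BigModel m) 𝓘(ℝ, Fin m → ℝ) ∞ (fun q => (T q).1) p :=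
    contDiff_fst.contMDiff.contMDiffAt.comp p hT
  have hT2 : ContMDiffAt (BigModel m) 𝓘(ℝ, (Fin m → ℝ) →L[ℝ] ℝ) ∞ (fun q => (T q).2) p :=
    contDiff_snd.contMDiff.contMDiffAt.comp p hT
  have hproj : ContMDiffAt (BigModel m) 𝓘(ℝ, Fin m → ℝ) ∞ (fun q : BigTan m M => q.proj) p := h1
  have hJ := (contMDiffAt_jac hκ hc hpκ hp).comp p hproj
  have hJ' := (contMDiffAt_jac hc hκ hp hpκ).comp p hproj
  have main : ContMDiffAt (BigModel m) 𝓘(ℝ, (Fin m → ℝ) × VVec m) ∞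
      (fun q : BigTan m M => (c q.proj, (Sum.elim (jac κ c q.proj (T q).1)
        (fun i => (T q).2 (jac c κ q.proj (Pi.single i 1))) : VVec m))) p := by
    refine ((contMDiffAt_of_mem_maximalAtlas hc hp).comp p hproj).prodMk_space
      (contMDiffAt_pi_space.2 ?_)
    rintro (i | i)
    · exact contMDiffAt_pi_space.1 (hJ.clm_apply hT1) i
    · exact hT2.clm_apply (hJ'.clm_apply contMDiffAt_const)
  refine main.congr_of_eventuallyEq ?_
  filter_upwards [hproj.continuousAt.preimage_mem_nhds (c.open_source.mem_nhds hp),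
    hproj.continuousAt.preimage_mem_nhds (κ.open_source.mem_nhds hpκ)] with q hq hqκ
  have hTq : T q = _ := trivializationAt_bigTan p.proj q hqκ
  rw [hTq]
  refine Prod.ext rfl ?_
  funext i
  rcases i with i | i
  · exact congrFun (congrArg (fun L => L q.snd.1) (jac_comp_chartDiff (c' := c) hκ hqκ)).symm i
  · exact congrArg q.snd.2 (congrArg (fun L => L (Pi.single i 1))
      (inverse_chartDiff_comp_jac (c := c) hκ hqκ)).symm

theorem contMDiffAt_natParam (hc : c ∈ smoothCharts m M) {a : (Fin m → ℝ) × VVec m}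
    (ha : a.1 ∈ c.target) :
    ContMDiffAt 𝓘(ℝ, (Fin m → ℝ) × VVec m) (BigModel m) ∞ (natParam c) a := by
  set x₀ := c.symm a.1 with hx₀
  have hx₀c : x₀ ∈ c.source := c.map_target ha
  set κ := baseChart m x₀ with hκdef
  have hκ : κ ∈ smoothCharts m M := IsManifold.chart_mem_maximalAtlas x₀
  have hxκ : x₀ ∈ κ.source := mem_chart_source _ _
  have hs : ContMDiffAt 𝓘(ℝ, (Fin m → ℝ) × VVec m) 𝓘(ℝ, Fin m → ℝ) ∞
      (fun b : (Fin m → ℝ) × VVec m => c.symm b.1) a :=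
    (contMDiffAt_symm_of_mem_maximalAtlas hc ha).comp a contDiff_fst.contMDiff.contMDiffAt
  have hJ := (contMDiffAt_jac hκ hc hxκ hx₀c).comp a hs
  have hJ' := (contMDiffAt_jac hc hκ hx₀c hxκ).comp a hs
  have hcoord (q : VIdx m) : ContMDiffAt 𝓘(ℝ, (Fin m → ℝ) × VVec m) 𝓘(ℝ, ℝ) ∞
      (fun b : (Fin m → ℝ) × VVec m => b.2 q) a :=
    ((contDiff_apply ℝ ℝ q).comp contDiff_snd).contMDiff.contMDiffAt
  refine contMDiffAt_totalSpace.2 ⟨hs, ?_⟩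
  have main : ContMDiffAt 𝓘(ℝ, (Fin m → ℝ) × VVec m) 𝓘(ℝ, ModelFiber m) ∞
      (fun b : (Fin m → ℝ) × VVec m =>
        ((jac c κ (c.symm b.1) (fun i => b.2 (Sum.inl i)),
          (∑ i, b.2 (Sum.inr i) • ContinuousLinearMap.proj (R := ℝ) (φ := fun _ : Fin m => ℝ) i).comp
            (jac κ c (c.symm b.1))) : ModelFiber m)) a := by
    refine (hJ'.clm_apply (contMDiffAt_pi_space.2 fun i => hcoord (Sum.inl i))).prodMk_space
      (ContMDiffAt.clm_comp ?_ hJ)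
    exact contMDiffAt_finsetSum fun i _ => (hcoord (Sum.inr i)).smul contMDiffAt_const
  refine main.congr_of_eventuallyEq ?_
  filter_upwards [hs.continuousAt.preimage_mem_nhds (κ.open_source.mem_nhds hxκ),
    hs.continuousAt.preimage_mem_nhds (c.open_source.mem_nhds hx₀c)] with b hb hb'
  refine (trivializationAt_bigTan x₀ (natParam c b) hb).trans ?_
  exact Prod.ext rfl rfl

theorem natChart_natParam (hc : c ∈ smoothCharts m M) {a : (Fin m → ℝ) × VVec m}
    (ha : a.1 ∈ c.target) : natChart c (natParam c a) = a :=
  Prod.ext (c.right_inv ha) (fibreCoord_fibreVec hc (c.map_target ha) a.2)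

theorem natParam_natChart (hc : c ∈ smoothCharts m M) {p : BigTan m M} (hp : p.proj ∈ c.source) :
    natParam c (natChart c p) = p := by
  obtain ⟨x, Z⟩ := p
  have h : ∀ y, y = x → (⟨y, fibreVec c y (fibreCoord c x Z)⟩ : BigTan m M) = ⟨x, Z⟩ := by
    rintro _ rfl
    exact congrArg (TotalSpace.mk _) (fibreVec_fibreCoord hc hp Z)
  exact h _ (c.left_inv hp)

theorem mdifferentiableAt_natChart (hc : c ∈ smoothCharts m M) {p : BigTan m M}
    (hp : p.proj ∈ c.source) :
    MDifferentiableAt (BigModel m) 𝓘(ℝ, (Fin m → ℝ) × VVec m) (natChart c) p :=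
  (contMDiffAt_natChart hc hp).mdifferentiableAt (by simp)

theorem mdifferentiableAt_natParam (hc : c ∈ smoothCharts m M) {a : (Fin m → ℝ) × VVec m}
    (ha : a.1 ∈ c.target) :
    MDifferentiableAt 𝓘(ℝ, (Fin m → ℝ) × VVec m) (BigModel m) (natParam c) a :=
  (contMDiffAt_natParam hc ha).mdifferentiableAt (by simp)

theorem continuous_proj : Continuous (fun p : BigTan m M => p.proj) :=
  FiberBundle.continuous_proj _ _

theorem isOpen_proj_preimage {s : Set M} (hs : IsOpen s) :
    IsOpen {p : BigTan m M | p.proj ∈ s} := hs.preimage continuous_proj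

end Charts

section FibreCalculus

/-! ### Linear operators on smooth fields -/

/-- An operator on fields that maps smooth fields to smooth fields and is `ℝ`-linear on them. -/
structure IsSmoothLin {X E H : Type*} [NormedAddCommGroup X] [NormedSpace ℝ X]
    [NormedAddCommGroup E] [NormedSpace ℝ E] [NormedAddCommGroup H] [NormedSpace ℝ H]
    (P : (X → E) → X → H) : Prop where
  smooth : ∀ {A}, ContDiff ℝ ∞ A → ContDiff ℝ ∞ (P A)
  add : ∀ {A B}, ContDiff ℝ ∞ A → ContDiff ℝ ∞ B → ∀ u, P (A + B) u = P A u + P B u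
  smul : ∀ (r : ℝ) {A}, ContDiff ℝ ∞ A → ∀ u, P (r • A) u = r • P A u

/-- An operator on pairs of fields that maps smooth fields to smooth fields and is `ℝ`-bilinear. -/
structure IsSmoothBilin {X E F H : Type*} [NormedAddCommGroup X] [NormedSpace ℝ X]
    [NormedAddCommGroup E] [NormedSpace ℝ E] [NormedAddCommGroup F] [NormedSpace ℝ F]
    [NormedAddCommGroup H] [NormedSpace ℝ H]
    (D : (X → E) → (X → F) → X → H) : Prop where
  right : ∀ {A}, ContDiff ℝ ∞ A → IsSmoothLin (D A)
  left : ∀ {B}, ContDiff ℝ ∞ B → IsSmoothLin fun A => D A B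

namespace IsSmoothLin

variable {X E F H : Type*} [NormedAddCommGroup X] [NormedSpace ℝ X]
    [NormedAddCommGroup E] [NormedSpace ℝ E] [NormedAddCommGroup F] [NormedSpace ℝ F]
    [NormedAddCommGroup H] [NormedSpace ℝ H]
    {ι κ : Type*} [Fintype ι] [Fintype κ]
    {P Q : (X → E) → X → H}

theorem id : IsSmoothLin fun A : X → E => A :=
  ⟨fun h => h, fun _ _ _ => rfl, fun _ _ _ _ => rfl⟩

theorem add' (hP : IsSmoothLin P) (hQ : IsSmoothLin Q) : IsSmoothLin fun A u => P A u + Q A u where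
  smooth h := (hP.smooth h).add (hQ.smooth h)
  add hA hB u := by rw [hP.add hA hB, hQ.add hA hB]; abel
  smul r _ hA u := by rw [hP.smul r hA, hQ.smul r hA, smul_add]

theorem const_smul (hP : IsSmoothLin P) (r : ℝ) : IsSmoothLin fun A u => r • P A u where
  smooth h := (hP.smooth h).const_smul r
  add hA hB u := by rw [hP.add hA hB, smul_add]
  smul s _ hA u := by rw [hP.smul s hA, smul_comm]

theorem neg (hP : IsSmoothLin P) : IsSmoothLin fun A u => -P A u := by
  simpa using hP.const_smul (-1)

theorem sub (hP : IsSmoothLin P) (hQ : IsSmoothLin Q) : IsSmoothLin fun A u => P A u - Q A u := by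
  simpa [sub_eq_add_neg] using hP.add' hQ.neg

theorem comp {R : (X → H) → X → F} (hR : IsSmoothLin R) (hP : IsSmoothLin P) :
    IsSmoothLin fun A => R (P A) where
  smooth h := hR.smooth (hP.smooth h)
  add hA hB u := by
    rw [show P _ = _ from funext (hP.add hA hB)]
    exact hR.add (hP.smooth hA) (hP.smooth hB) u
  smul r A hA u := by
    rw [show P _ = _ from funext (hP.smul r hA)]
    exact hR.smul r (hP.smooth hA) u

theorem clm (L : X → H →L[ℝ] F) (hL : ∀ {A : X → H}, ContDiff ℝ ∞ A → ContDiff ℝ ∞ fun u => L u (A u))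
    (hP : IsSmoothLin P) : IsSmoothLin fun A u => L u (P A u) where
  smooth h := hL (hP.smooth h)
  add hA hB u := by rw [hP.add hA hB, map_add]
  smul r A hA u := by rw [hP.smul r hA, map_smul]

theorem pi {P : (X → E) → X → ι → ℝ} (h : ∀ i, IsSmoothLin fun A u => P A u i) : IsSmoothLin P where
  smooth hA := contDiff_pi.2 fun i => (h i).smooth hA
  add hA hB u := funext fun i => (h i).add hA hB u
  smul r _ hA u := funext fun i => (h i).smul r hA u

theorem apply {P : (X → E) → X → ι → ℝ} (h : IsSmoothLin P) (i : ι) :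
    IsSmoothLin fun A u => P A u i where
  smooth hA := contDiff_pi.1 (h.smooth hA) i
  add hA hB u := congrFun (h.add hA hB u) i
  smul r _ hA u := congrFun (h.smul r hA u) i

theorem sum {P : ι → (X → E) → X → H} (h : ∀ i, IsSmoothLin (P i)) :
    IsSmoothLin fun A u => ∑ i, P i A u where
  smooth hA := ContDiff.sum fun i _ => (h i).smooth hA
  add hA hB u := by simp only [(h _).add hA hB, Finset.sum_add_distrib]
  smul r A hA u := by simp only [(h _).smul r hA, Finset.smul_sum]

theorem mul_left {P : (X → E) → X → ℝ} (h : IsSmoothLin P) {f : X → ℝ} (hf : ContDiff ℝ ∞ f) :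
    IsSmoothLin fun A u => f u * P A u where
  smooth hA := hf.mul (h.smooth hA)
  add hA hB u := by rw [h.add hA hB, mul_add]
  smul r A hA u := by rw [h.smul r hA, smul_eq_mul, smul_eq_mul]; ring

theorem mul_right {P : (X → E) → X → ℝ} (h : IsSmoothLin P) {f : X → ℝ} (hf : ContDiff ℝ ∞ f) :
    IsSmoothLin fun A u => P A u * f u := by
  simpa only [mul_comm] using h.mul_left hf

theorem mulVec {P : (X → E) → X → ι → ℝ} (h : IsSmoothLin P) {N : X → Matrix κ ι ℝ}
    (hN : ∀ i j, ContDiff ℝ ∞ fun u => N u i j) :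
    IsSmoothLin fun A u => (N u).mulVec (P A u) :=
  pi fun i => sum fun j => (h.apply j).mul_left (hN i j)

theorem dotProduct_left {P : (X → E) → X → ι → ℝ} (h : IsSmoothLin P) {B : X → ι → ℝ}
    (hB : ContDiff ℝ ∞ B) : IsSmoothLin fun A u => P A u ⬝ᵥ B u :=
  sum fun j => (h.apply j).mul_right (contDiff_pi.1 hB j)

theorem dotProduct_right {P : (X → E) → X → ι → ℝ} (h : IsSmoothLin P) {B : X → ι → ℝ}
    (hB : ContDiff ℝ ∞ B) : IsSmoothLin fun A u => B u ⬝ᵥ P A u :=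
  sum fun j => (h.apply j).mul_left (contDiff_pi.1 hB j)

theorem fderiv_apply (hP : IsSmoothLin P) {Z : X → X} (hZ : ContDiff ℝ ∞ Z) :
    IsSmoothLin fun A u => fderiv ℝ (P A) u (Z u) where
  smooth hA := ((hP.smooth hA).fderiv_right (m := ∞) (by simp)).clm_apply hZ
  add {A B} hA hB u := by
    rw [show P (A + B) = P A + P B from funext (hP.add hA hB),
      fderiv_add ((hP.smooth hA).differentiable (by simp) u)
        ((hP.smooth hB).differentiable (by simp) u)]
    rfl
  smul r A hA u := by
    rw [show P (r • A) = r • P A from funext (hP.smul r hA),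
      fderiv_const_smul ((hP.smooth hA).differentiable (by simp) u)]
    rfl

theorem fderiv_direction {P : (X → E) → X → X} (hP : IsSmoothLin P) {Y : X → H}
    (hY : ContDiff ℝ ∞ Y) : IsSmoothLin fun A u => fderiv ℝ Y u (P A u) :=
  hP.clm (fun u => fderiv ℝ Y u)
    fun hA => (hY.fderiv_right (m := ∞) (by simp)).clm_apply hA

/-- Vertical lifts are constant fields, so `ℝ`-linearity on fields already gives linearity in a
vector at a point; linearity over functions is not needed. -/
theorem isLinearMap_const (hP : IsSmoothLin P) (u : X) : IsLinearMap ℝ fun w => P (fun _ => w) u where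
  map_add _ _ := hP.add contDiff_const contDiff_const u
  map_smul r _ := hP.smul r contDiff_const u

end IsSmoothLin

/-! ### Smoothness and linearity of the operators built from a regular metric. -/

section Regularity

variable {m : ℕ} {G : VMetric m}

/-- A vertical metric along a fibre that is smooth, non degenerate, and non degenerate on `V₂`. -/
structure IsRegular (G : VMetric m) : Prop where
  smooth : ∀ q s, ContDiff ℝ ∞ fun u => G u q s
  det_ne : ∀ u, (G u).det ≠ 0
  det_block_ne : ∀ u, (G u).toBlocks₂₂.det ≠ 0

theorem contDiff_matrix_mul {X ι κ μ : Type*} [NormedAddCommGroup X] [NormedSpace ℝ X] [Fintype κ]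
    {A : X → Matrix ι κ ℝ} {B : X → Matrix κ μ ℝ} (hA : ∀ i j, ContDiff ℝ ∞ fun u => A u i j)
    (hB : ∀ i j, ContDiff ℝ ∞ fun u => B u i j) (i : ι) (j : μ) :
    ContDiff ℝ ∞ fun u => (A u * B u) i j := by
  simp only [Matrix.mul_apply]
  exact ContDiff.sum fun k _ => (hA i k).mul (hB k j)

theorem contDiff_matrix_det {X ι : Type*} [NormedAddCommGroup X] [NormedSpace ℝ X] [Fintype ι]
    [DecidableEq ι] {A : X → Matrix ι ι ℝ} (hA : ∀ i j, ContDiff ℝ ∞ fun u => A u i j) :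
    ContDiff ℝ ∞ fun u => (A u).det := by
  simp only [Matrix.det_apply]
  exact ContDiff.sum fun σ _ => (contDiff_prod fun i _ => hA _ _).const_smul _

/-- Cramer's rule: the entries of the inverse are quotients of determinants. -/
theorem contDiff_matrix_inv {X ι : Type*} [NormedAddCommGroup X] [NormedSpace ℝ X] [Fintype ι]
    [DecidableEq ι] {A : X → Matrix ι ι ℝ} (hA : ∀ i j, ContDiff ℝ ∞ fun u => A u i j)
    (h : ∀ u, (A u).det ≠ 0) (i j : ι) : ContDiff ℝ ∞ fun u => (A u)⁻¹ i j := by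
  simp only [Matrix.inv_def, Matrix.smul_apply, Ring.inverse_eq_inv', smul_eq_mul]
  refine ((contDiff_matrix_det hA).inv h).mul ?_
  simp only [Matrix.adjugate_apply]
  refine contDiff_matrix_det fun a b => ?_
  -- The adjugate entry is the determinant of `A` with row `j` replaced by a constant basis vector.
  by_cases hab : a = j
  · subst hab
    simpa using contDiff_const
  · simpa [Matrix.updateRow_ne hab] using hA a b

namespace IsRegular

theorem smooth_sigma (hG : IsRegular G) (i j : Fin m) : ContDiff ℝ ∞ fun u => sigma G u i j :=
  contDiff_matrix_inv (A := fun u => (G u).toBlocks₂₂) (fun a b => hG.smooth (Sum.inr a) (Sum.inr b))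
    hG.det_block_ne i j

theorem det_sigma_ne (hG : IsRegular G) (u : VVec m) : (sigma G u).det ≠ 0 := by
  rw [sigma, Matrix.det_nonsing_inv, Ring.inverse_eq_inv']
  exact inv_ne_zero (hG.det_block_ne u)

theorem smooth_sigma_inv (hG : IsRegular G) (i j : Fin m) :
    ContDiff ℝ ∞ fun u => (sigma G u)⁻¹ i j :=
  contDiff_matrix_inv hG.smooth_sigma hG.det_sigma_ne i j

theorem smooth_inv (hG : IsRegular G) (i j : VIdx m) : ContDiff ℝ ∞ fun u => (G u)⁻¹ i j :=
  contDiff_matrix_inv hG.smooth hG.det_ne i j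

theorem smooth_psi (hG : IsRegular G) (i j : Fin m) : ContDiff ℝ ∞ fun u => psi G u i j :=
  (contDiff_matrix_mul (A := fun u => (ell G u).transpose)
    (fun a b => hG.smooth (Sum.inr b) (Sum.inl a)) hG.smooth_sigma i j).neg

theorem smooth_phi (hG : IsRegular G) (i j : VIdx m) : ContDiff ℝ ∞ fun u => phi G u i j :=
  contDiff_matrix_mul (A := fun _ => Matrix.fromBlocks 0 1 1 0) (fun _ _ => contDiff_const)
    hG.smooth i j

theorem contDiff_pd {f : VVec m → ℝ} (hf : ContDiff ℝ ∞ f) (q : VIdx m) : ContDiff ℝ ∞ (pd q f) :=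
  (hf.fderiv_right (m := ∞) (by simp)).clm_apply contDiff_const

theorem smooth_christoffel (hG : IsRegular G) (i j k : Fin m) :
    ContDiff ℝ ∞ (christoffel G i j k) := by
  unfold christoffel
  refine contDiff_const.mul (ContDiff.sum fun h _ => (hG.smooth_sigma_inv i h).mul ?_)
  exact ((contDiff_pd (hG.smooth_sigma _ _) _).add (contDiff_pd (hG.smooth_sigma _ _) _)).sub
    (contDiff_pd (hG.smooth_sigma _ _) _)

theorem smooth_dPsi (hG : IsRegular G) (i j k : Fin m) : ContDiff ℝ ∞ fun u => dPsi G u i j k :=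
  ((contDiff_pd (hG.smooth_psi _ _) _).add (contDiff_pd (hG.smooth_psi _ _) _)).add
    (contDiff_pd (hG.smooth_psi _ _) _)

end IsRegular

variable {E : Type*} [NormedAddCommGroup E] [NormedSpace ℝ E]

theorem IsSmoothLin.prOne {P : (VVec m → E) → VField m} (hP : IsSmoothLin P) :
    IsSmoothLin fun A u => prOne (P A u) := pi fun i => hP.apply (Sum.inl i)

theorem IsRegular.prU (hG : IsRegular G) (ε : ℝ) : IsSmoothLin (prU G ε) :=
  (IsSmoothLin.id.add' ((IsSmoothLin.id.mulVec hG.smooth_phi).const_smul ε)).const_smul (1 / 2)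

theorem IsRegular.iota (hG : IsRegular G) (ε : ℝ) : IsSmoothLin (iota G ε) := by
  refine IsSmoothLin.pi ?_
  rintro (i | i)
  · exact IsSmoothLin.id.apply i
  · exact ((IsSmoothLin.id.mulVec (N := fun u => (psi G u).transpose)
      fun a b => hG.smooth_psi b a).add'
      ((IsSmoothLin.id.mulVec hG.smooth_sigma).const_smul ε)).apply i

namespace IsSmoothBilin

variable {X E F H : Type*} [NormedAddCommGroup X] [NormedSpace ℝ X]
    [NormedAddCommGroup E] [NormedSpace ℝ E] [NormedAddCommGroup F] [NormedSpace ℝ F]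
    [NormedAddCommGroup H] [NormedSpace ℝ H]
    {ι κ : Type*} [Fintype ι] [Fintype κ]
    {D D' : (X → E) → (X → F) → X → H}

theorem smooth (h : IsSmoothBilin D) {A : X → E} {B : X → F} (hA : ContDiff ℝ ∞ A)
    (hB : ContDiff ℝ ∞ B) : ContDiff ℝ ∞ (D A B) := (h.right hA).smooth hB

theorem add (h : IsSmoothBilin D) (h' : IsSmoothBilin D') :
    IsSmoothBilin fun A B u => D A B u + D' A B u :=
  ⟨fun hA => (h.right hA).add' (h'.right hA), fun hB => (h.left hB).add' (h'.left hB)⟩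

theorem sub (h : IsSmoothBilin D) (h' : IsSmoothBilin D') :
    IsSmoothBilin fun A B u => D A B u - D' A B u :=
  ⟨fun hA => (h.right hA).sub (h'.right hA), fun hB => (h.left hB).sub (h'.left hB)⟩

theorem const_smul (h : IsSmoothBilin D) (r : ℝ) : IsSmoothBilin fun A B u => r • D A B u :=
  ⟨fun hA => (h.right hA).const_smul r, fun hB => (h.left hB).const_smul r⟩

theorem flip (h : IsSmoothBilin D) : IsSmoothBilin fun B A => D A B := ⟨h.left, h.right⟩

theorem post {R : (X → H) → X → κ → ℝ} (hR : IsSmoothLin R) (h : IsSmoothBilin D) :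
    IsSmoothBilin fun A B => R (D A B) :=
  ⟨fun hA => hR.comp (h.right hA), fun hB => hR.comp (h.left hB)⟩

theorem comp_left {X' : Type*} [NormedAddCommGroup X'] [NormedSpace ℝ X'] {P : (X → X') → X → E}
    (hP : IsSmoothLin P) (h : IsSmoothBilin D) : IsSmoothBilin fun A B => D (P A) B :=
  ⟨fun hA => h.right (hP.smooth hA), fun hB => (h.left hB).comp hP⟩

theorem comp_right {X' : Type*} [NormedAddCommGroup X'] [NormedSpace ℝ X'] {P : (X → X') → X → F}
    (hP : IsSmoothLin P) (h : IsSmoothBilin D) : IsSmoothBilin fun A B => D A (P B) :=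
  ⟨fun hA => (h.right hA).comp hP, fun hB => h.left (hP.smooth hB)⟩

theorem pi {D : (X → E) → (X → F) → X → ι → ℝ} (h : ∀ i, IsSmoothBilin fun A B u => D A B u i) :
    IsSmoothBilin D :=
  ⟨fun hA => IsSmoothLin.pi fun i => (h i).right hA, fun hB => IsSmoothLin.pi fun i => (h i).left hB⟩

theorem mulVec {D : (X → E) → (X → F) → X → ι → ℝ} (h : IsSmoothBilin D) {N : X → Matrix κ ι ℝ}
    (hN : ∀ i j, ContDiff ℝ ∞ fun u => N u i j) :
    IsSmoothBilin fun A B u => (N u).mulVec (D A B u) :=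
  ⟨fun hA => (h.right hA).mulVec hN, fun hB => (h.left hB).mulVec hN⟩

theorem dotProduct {P : (X → E) → X → ι → ℝ} {Q : (X → F) → X → ι → ℝ} (hP : IsSmoothLin P)
    (hQ : IsSmoothLin Q) : IsSmoothBilin fun A B u => P A u ⬝ᵥ Q B u :=
  ⟨fun hA => hQ.dotProduct_right (hP.smooth hA), fun hB => hP.dotProduct_left (hQ.smooth hB)⟩

theorem fderiv {P : (X → E) → X → X} {Q : (X → F) → X → H} (hP : IsSmoothLin P)
    (hQ : IsSmoothLin Q) : IsSmoothBilin fun A B u => fderiv ℝ (Q B) u (P A u) :=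
  ⟨fun hA => hQ.fderiv_apply (hP.smooth hA), fun hB => hP.fderiv_direction (hQ.smooth hB)⟩

theorem sum {D : ι → (X → E) → (X → F) → X → H} (h : ∀ i, IsSmoothBilin (D i)) :
    IsSmoothBilin fun A B u => ∑ i, D i A B u :=
  ⟨fun hA => IsSmoothLin.sum fun i => (h i).right hA, fun hB => IsSmoothLin.sum fun i => (h i).left hB⟩

theorem coeff {f : X → ℝ} (hf : ContDiff ℝ ∞ f) {P : (X → E) → X → ℝ} {Q : (X → F) → X → ℝ}
    (hP : IsSmoothLin P) (hQ : IsSmoothLin Q) : IsSmoothBilin fun A B u => f u * P A u * Q B u :=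
  ⟨fun hA => hQ.mul_left (hf.mul (hP.smooth hA)),
    fun hB => (hP.mul_left hf).mul_right (hQ.smooth hB)⟩

end IsSmoothBilin

/-! ### The connections, brackets and torsions are smooth and bilinear. -/

open IsSmoothBilin

namespace IsRegular

theorem connBase (hG : IsRegular G) : IsSmoothBilin (connBase G) := by
  refine IsSmoothBilin.pi fun i => ?_
  refine IsSmoothBilin.add (D := fun (Z : VField m) (Y : V1Field m) u => _root_.fderiv ℝ Y u (Z u) i) ?_ ?_
  · have := IsSmoothBilin.fderiv (X := VVec m) (IsSmoothLin.id (E := VVec m))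
      (IsSmoothLin.id (E := Fin m → ℝ))
    exact ⟨fun hA => (this.right hA).apply i, fun hB => (this.left hB).apply i⟩
  · refine IsSmoothBilin.sum fun j => IsSmoothBilin.sum fun k => ?_
    exact coeff (hG.smooth_christoffel i j k) (IsSmoothLin.id.prOne.apply j) (IsSmoothLin.id.apply k)

theorem covSigma (hG : IsRegular G) {D : Conn1 m} (hD : IsSmoothBilin D) {Y' : V1Field m}
    (hY' : ContDiff ℝ ∞ Y') : IsSmoothBilin fun Z Y => covSigma G D Z Y Y' := by
  have h1 : ContDiff ℝ ∞ fun v => (sigma G v).mulVec (Y' v) :=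
    (IsSmoothLin.id.mulVec hG.smooth_sigma).smooth hY'
  refine (IsSmoothBilin.sub ?_ ?_).sub ?_
  · exact IsSmoothBilin.fderiv (P := fun Z => Z) IsSmoothLin.id (IsSmoothLin.id.dotProduct_left h1)
  · exact ⟨fun hA => (hD.right hA).dotProduct_left h1, fun hB => (hD.left hB).dotProduct_left h1⟩
  · exact (IsSmoothBilin.dotProduct IsSmoothLin.id
      ((hD.left hY').mulVec hG.smooth_sigma)).flip

/-- This concerns the slot that `metrize` fills with basis vectors before it raises the index;
linearity there makes those values the components of a covector. -/
theorem covSigma_const (hG : IsRegular G) {D : Conn1 m} (hD : IsSmoothBilin D) {Z : VField m}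
    (hZ : ContDiff ℝ ∞ Z) {Y : V1Field m} (hY : ContDiff ℝ ∞ Y) (u : VVec m) :
    IsLinearMap ℝ fun w => BigTangent.covSigma G D Z Y (fun _ => w) u := by
  have : IsSmoothLin fun Y' => BigTangent.covSigma G D Z Y Y' := by
    refine (IsSmoothLin.sub ?_ ?_).sub ?_
    · exact ((IsSmoothLin.id.mulVec hG.smooth_sigma).dotProduct_right hY).fderiv_apply hZ
    · exact (IsSmoothLin.id.mulVec hG.smooth_sigma).dotProduct_right (hD.smooth hZ hY)
    · exact ((hD.right hZ).mulVec hG.smooth_sigma).dotProduct_right hY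
  exact this.isLinearMap_const u

theorem metrize (hG : IsRegular G) {D : Conn1 m} (hD : IsSmoothBilin D) :
    IsSmoothBilin (metrize G D) :=
  hD.add ((IsSmoothBilin.mulVec (IsSmoothBilin.pi fun _ => hG.covSigma hD contDiff_const)
    hG.smooth_sigma_inv).const_smul _)

theorem connZero (hG : IsRegular G) : IsSmoothBilin (connZero G) := hG.metrize hG.connBase

theorem connPsi (hG : IsRegular G) (ε : ℝ) : IsSmoothBilin (connPsi G ε) := by
  refine hG.connZero.add ((IsSmoothBilin.mulVec (IsSmoothBilin.pi fun k => ?_)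
    hG.smooth_sigma_inv).const_smul _)
  refine IsSmoothBilin.sum fun i => IsSmoothBilin.sum fun j => ?_
  exact coeff (hG.smooth_dPsi i j k) (IsSmoothLin.id.prOne.apply i) (IsSmoothLin.id.apply j)

theorem connEps (hG : IsRegular G) (ε : ℝ) : IsSmoothBilin (connEps G ε) :=
  hG.metrize (hG.connPsi ε)

theorem doubleConn (hG : IsRegular G) {Dp Dm : Conn1 m} (hp : IsSmoothBilin Dp)
    (hm : IsSmoothBilin Dm) : IsSmoothBilin (doubleConn G Dp Dm) :=
  IsSmoothBilin.add (post (hG.iota 1) (comp_right (hG.prU 1).prOne hp))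
    (post (hG.iota (-1)) (comp_right (hG.prU (-1)).prOne hm))

theorem connVZero (hG : IsRegular G) : IsSmoothBilin (connVZero G) :=
  hG.doubleConn hG.connZero hG.connZero

theorem wedge_form (hG : IsRegular G) {D : ConnV m} (hD : IsSmoothBilin D) {C : VField m}
    (hC : ContDiff ℝ ∞ C) : IsSmoothBilin fun A B u => (1 / 2 : ℝ) *
      (A u ⬝ᵥ (G u).mulVec (D C B u) - B u ⬝ᵥ (G u).mulVec (D C A u)) := by
  have h := IsSmoothBilin.dotProduct (IsSmoothLin.id (E := VVec m))
    ((hD.right hC).mulVec hG.smooth)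
  exact (h.sub h.flip).const_smul _

/-- The counterpart of `covSigma_const` for `wedge`: here the raised index is the direction of
differentiation. -/
theorem wedge_const (hG : IsRegular G) {D : ConnV m} (hD : IsSmoothBilin D) {A B : VField m}
    (hA : ContDiff ℝ ∞ A) (hB : ContDiff ℝ ∞ B) (u : VVec m) :
    IsLinearMap ℝ fun w => (1 / 2 : ℝ) * (A u ⬝ᵥ (G u).mulVec (D (fun _ => w) B u)
      - B u ⬝ᵥ (G u).mulVec (D (fun _ => w) A u)) := by
  have := ((((hD.left hB).mulVec hG.smooth).dotProduct_right hA).sub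
    (((hD.left hA).mulVec hG.smooth).dotProduct_right hB)).const_smul (1 / 2)
  exact this.isLinearMap_const u

theorem wedge (hG : IsRegular G) {D : ConnV m} (hD : IsSmoothBilin D) :
    IsSmoothBilin (wedge G D) :=
  IsSmoothBilin.mulVec (IsSmoothBilin.pi fun _ => hG.wedge_form hD contDiff_const) hG.smooth_inv

theorem metricBracket (hG : IsRegular G) : IsSmoothBilin (metricBracket G) :=
  (hG.connVZero.sub hG.connVZero.flip).sub (hG.wedge hG.connVZero)

theorem connTilde (hG : IsRegular G) (ε : ℝ) : IsSmoothBilin (connTilde G ε) :=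
  (comp_left (hG.prU ε) (hG.connEps ε)).add (post (hG.prU ε).prOne
    (comp_left (hG.prU (-ε)) (comp_right (hG.iota ε) hG.metricBracket)))

theorem connVTilde (hG : IsRegular G) : IsSmoothBilin (connVTilde G) :=
  hG.doubleConn (hG.connTilde 1) (hG.connTilde (-1))

theorem deformedBracket (hG : IsRegular G) {D : ConnV m} (hD : IsSmoothBilin D) :
    IsSmoothBilin (deformedBracket G D) := hG.metricBracket.add (hG.wedge hD)

theorem deformedTorsion (hG : IsRegular G) {D : ConnV m} (hD : IsSmoothBilin D) :
    IsSmoothBilin (deformedTorsion G D) := (hD.sub hD.flip).sub (hG.deformedBracket hD)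

theorem gualtieriTorsion (hG : IsRegular G) {D : ConnV m} (hD : IsSmoothBilin D) {C : VField m}
    (hC : ContDiff ℝ ∞ C) : IsSmoothBilin fun A B => gualtieriTorsion G D A B C := by
  have hC' : ContDiff ℝ ∞ fun v => (G v).mulVec (C v) :=
    (IsSmoothLin.id.mulVec hG.smooth).smooth hC
  exact ⟨fun hA => ((hG.deformedTorsion hD).right hA).dotProduct_left hC',
    fun hB => ((hG.deformedTorsion hD).left hB).dotProduct_left hC'⟩

theorem fieldAdapted (hG : IsRegular G) : IsSmoothBilin (fieldAdapted G) :=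
  hG.connVTilde.add (IsSmoothBilin.mulVec (IsSmoothBilin.pi fun _ =>
    (hG.gualtieriTorsion hG.connVTilde contDiff_const).const_smul (-(1 / 3))) hG.smooth_inv)

/-- The deformed curvature is linear in its first argument. -/
theorem deformedCurvature_first (hG : IsRegular G) {B C : VField m} (hB : ContDiff ℝ ∞ B)
    (hC : ContDiff ℝ ∞ C) : IsSmoothLin fun A => deformedCurvature G A B C := by
  have hF := hG.fieldAdapted
  exact ((hF.left (hF.smooth hB hC)).sub ((hF.right hB).comp (hF.left hC))).sub
    ((hF.left hC).comp ((hG.deformedBracket hF).left hB))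

/-- The two vectors of the Ricci form occupy these slots, in both orders. -/
theorem deformedCurvature_last (hG : IsRegular G) {A : VField m} (hA : ContDiff ℝ ∞ A) :
    IsSmoothBilin fun B C => deformedCurvature G A B C := by
  have hF := hG.fieldAdapted
  -- Each of the three terms of the curvature is treated twice, as an operator on `C` with `B` fixed
  -- and as an operator on `B` with `C` fixed.
  refine (IsSmoothBilin.sub ⟨fun hB => ?_, fun hC => ?_⟩ ⟨fun hB => ?_, fun hC => ?_⟩).sub
    ⟨fun hB => ?_, fun hC => ?_⟩
  · exact (hF.right hA).comp (hF.right hB)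
  · exact (hF.right hA).comp (hF.left hC)
  · exact (hF.right hB).comp (hF.right hA)
  · exact hF.left (hF.smooth hA hC)
  · exact hF.right ((hG.deformedBracket hF).smooth hA hB)
  · exact (hF.left hC).comp ((hG.deformedBracket hF).right hA)

end IsRegular

end Regularity

end FibreCalculus

section Equivariance

variable {m : ℕ}

/-! ### Behaviour of the fibre calculus under a linear change of the natural fibre coordinates -/

/-- The image of a basis vector is a column of `T`, and linearity of `f'` expands its value there in
the numbers `f' (Pi.single s 1)`. With `FormRel.sharp_eq` this handles every index that the
construction raises. -/
theorem transpose_mulVec_form {ι : Type*} [Fintype ι] [DecidableEq ι] {T : Matrix ι ι ℝ}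
    {f f' : (ι → ℝ) → ℝ} (hf' : IsLinearMap ℝ f') (h : ∀ v, f' (T.mulVec v) = f v) :
    T.transpose.mulVec (fun q => f' (Pi.single q 1)) = fun q => f (Pi.single q 1) := by
  funext q
  rw [← h, Matrix.mulVec_single_one]
  have h1 : T.col q = ∑ s, T s q • (Pi.single s 1 : ι → ℝ) := by
    simpa using pi_eq_sum_univ' (T.col q)
  rw [h1]
  have h2 := map_sum hf'.mk' (fun s => T s q • (Pi.single s 1 : ι → ℝ)) Finset.univ
  simp only [map_smul, IsLinearMap.mk'_apply, smul_eq_mul] at h2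
  rw [h2]
  rfl

/-- The fields `A` and `A'` are smooth and correspond to each other under the linear changes of
coordinates `T` of the fibre and `S` of the values. -/
structure FieldRel {ι κ : Type*} [Fintype ι] [Fintype κ] (T : Matrix κ κ ℝ) (S : Matrix ι ι ℝ)
    (A A' : (κ → ℝ) → ι → ℝ) : Prop where
  smooth : ContDiff ℝ ∞ A
  smooth' : ContDiff ℝ ∞ A'
  eq : ∀ u, A' (T.mulVec u) = S.mulVec (A u)

/-- Differentiate `A' ∘ T = S ∘ A`. As `T` and `S` are constant along the fibre, no derivative of
them appears, and the flat derivative is natural. -/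
theorem FieldRel.fderiv_eq {ι κ : Type*} [Fintype ι] [Fintype κ] {T : Matrix κ κ ℝ}
    {S : Matrix ι ι ℝ} {A A' : (κ → ℝ) → ι → ℝ} (h : FieldRel T S A A') (u v : κ → ℝ) :
    fderiv ℝ A' (T.mulVec u) (T.mulVec v) = S.mulVec (fderiv ℝ A u v) := by
  have h1 := (h.smooth'.differentiable (by simp) (T.mulVec u)).hasFDerivAt.comp u
    (T.mulVecLin.toContinuousLinearMap.hasFDerivAt (x := u))
  have h2 := (S.mulVecLin.toContinuousLinearMap.hasFDerivAt (x := A u)).comp u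
    (h.smooth.differentiable (by simp) u).hasFDerivAt
  have h3 : A' ∘ T.mulVec = S.mulVecLin.toContinuousLinearMap ∘ A := funext h.eq
  rw [h3] at h1
  exact congrArg (fun L => L v) (h1.unique h2)

theorem fderiv_eq_of_comp {κ : Type*} [Fintype κ] {T : Matrix κ κ ℝ} {f f' : (κ → ℝ) → ℝ}
    (hf' : ContDiff ℝ ∞ f') (h : ∀ u, f' (T.mulVec u) = f u) (u v : κ → ℝ) :
    fderiv ℝ f' (T.mulVec u) (T.mulVec v) = fderiv ℝ f u v := by
  have h1 := (hf'.differentiable (by simp) (T.mulVec u)).hasFDerivAt.comp u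
    (T.mulVecLin.toContinuousLinearMap.hasFDerivAt (x := u))
  have h3 : f' ∘ T.mulVec = f := funext h
  rw [h3] at h1
  exact congrArg (fun L => L v) h1.fderiv.symm

/-- The matrix of the change of the natural fibre coordinates `(y, z)`, where `J` acts on `y` and
`K` acts on `z`. -/
def fibreMatrix (J K : Matrix (Fin m) (Fin m) ℝ) : Matrix (VIdx m) (VIdx m) ℝ :=
  Matrix.fromBlocks J 0 0 K

/-- `G` and `G'` are the components of one vertical metric in the natural fibre coordinates of two
charts with Jacobian `J`. -/
structure FrameChange (G G' : VMetric m) (J K : Matrix (Fin m) (Fin m) ℝ) : Prop where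
  regular : IsRegular G
  regular' : IsRegular G'
  transpose_mul : K.transpose * J = 1
  metric_eq : ∀ u, G u =
    (fibreMatrix J K).transpose * G' ((fibreMatrix J K).mulVec u) * fibreMatrix J K

/-- `N` and `N'` are the components of one field of bilinear forms. -/
def FormRel {ι κ : Type*} [Fintype ι] [Fintype κ] (T : Matrix κ κ ℝ) (S : Matrix ι ι ℝ)
    (N N' : (κ → ℝ) → Matrix ι ι ℝ) : Prop :=
  ∀ u, N u = S.transpose * N' (T.mulVec u) * S

theorem FormRel.dotProduct_eq {ι κ : Type*} [Fintype ι] [Fintype κ] {T : Matrix κ κ ℝ}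
    {S : Matrix ι ι ℝ} {N N' : (κ → ℝ) → Matrix ι ι ℝ} (h : FormRel T S N N') (u : κ → ℝ)
    (x y : ι → ℝ) : S.mulVec x ⬝ᵥ (N' (T.mulVec u)).mulVec (S.mulVec y) = x ⬝ᵥ (N u).mulVec y := by
  rw [h u, ← Matrix.mulVec_mulVec, ← Matrix.mulVec_mulVec, Matrix.dotProduct_mulVec x,
    Matrix.vecMul_transpose]

theorem FormRel.inv_eq {ι κ : Type*} [Fintype ι] [DecidableEq ι] [Fintype κ] {T : Matrix κ κ ℝ}
    {S : Matrix ι ι ℝ} {N N' : (κ → ℝ) → Matrix ι ι ℝ} (h : FormRel T S N N')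
    (hS : IsUnit S.det) (u : κ → ℝ) :
    (N' (T.mulVec u))⁻¹ = S * (N u)⁻¹ * S.transpose := by
  have hS' : IsUnit S.transpose.det := by rwa [Matrix.det_transpose]
  rw [h u, Matrix.mul_inv_rev, Matrix.mul_inv_rev]
  simp only [← Matrix.mul_assoc]
  rw [Matrix.mul_nonsing_inv _ hS, Matrix.one_mul, Matrix.mul_assoc, Matrix.nonsing_inv_mul _ hS',
    Matrix.mul_one]

/-- The inverse matrix transforms by `S` on both sides, and one of these factors is absorbed by the
covector, which is pulled back by `Sᵀ`. -/
theorem FormRel.sharp_eq {ι κ : Type*} [Fintype ι] [DecidableEq ι] [Fintype κ] {T : Matrix κ κ ℝ}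
    {S : Matrix ι ι ℝ} {N N' : (κ → ℝ) → Matrix ι ι ℝ} (h : FormRel T S N N')
    (hS : IsUnit S.det) (u : κ → ℝ) {a a' : ι → ℝ} (ha : S.transpose.mulVec a' = a) :
    (N' (T.mulVec u))⁻¹.mulVec a' = S.mulVec ((N u)⁻¹.mulVec a) := by
  rw [h.inv_eq hS, ← ha, ← Matrix.mulVec_mulVec, ← Matrix.mulVec_mulVec]

/-- The derivative in a direction of `V₁` of the bilinear form with matrix `N`, for constant
arguments. -/
def formDeriv (N : VVec m → Matrix (Fin m) (Fin m) ℝ) (u : VVec m) (z x y : Fin m → ℝ) : ℝ :=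
  ∑ j, ∑ h, ∑ k, z j * (x h * (y k * pd (Sum.inl j) (fun v => N v h k) u))

/-- A directional derivative in place of a sum of partial derivatives reduces naturality to the
chain rule, without computation with indices. -/
theorem formDeriv_eq {N : VVec m → Matrix (Fin m) (Fin m) ℝ}
    (hN : ∀ i j, ContDiff ℝ ∞ fun u => N u i j) (u : VVec m) (z x y : Fin m → ℝ) :
    formDeriv N u z x y = fderiv ℝ (fun v => x ⬝ᵥ (N v).mulVec y) u (Sum.elim z 0) := by
  have h1 : HasFDerivAt (fun v => x ⬝ᵥ (N v).mulVec y)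
      (∑ h, x h • ∑ k, y k • fderiv ℝ (fun v => N v h k) u) u := by
    have h0 (h : Fin m) : HasFDerivAt (fun v => ∑ k, N v h k * y k)
        (∑ k, y k • fderiv ℝ (fun v => N v h k) u) u :=
      HasFDerivAt.fun_sum fun k _ =>
        ((hN h k).differentiable (by simp) u).hasFDerivAt.mul_const _
    exact HasFDerivAt.fun_sum (A := fun h v => x h * ∑ k, N v h k * y k)
      fun h _ => (h0 h).const_mul (x h)
  have h2 : (Sum.elim z 0 : VVec m) = ∑ j, z j • unitVec (Sum.inl j) := by
    funext q
    rcases q with q | q <;> simp [unitVec, Pi.single_apply]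
  rw [h1.fderiv, h2, map_sum]
  refine Finset.sum_congr rfl fun j _ => ?_
  simp only [map_smul, _root_.sum_apply, _root_.smul_apply, smul_eq_mul, Finset.mul_sum, pd]

theorem fibreMatrix_mulVec_inl (J K : Matrix (Fin m) (Fin m) ℝ) (z : Fin m → ℝ) :
    (fibreMatrix J K).mulVec (Sum.elim z 0) = Sum.elim (J.mulVec z) 0 := by
  simp [fibreMatrix, Matrix.fromBlocks_mulVec]

theorem prOne_fibreMatrix (J K : Matrix (Fin m) (Fin m) ℝ) (w : VVec m) :
    prOne ((fibreMatrix J K).mulVec w) = J.mulVec (prOne w) := by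
  funext i
  simp [prOne, fibreMatrix, Matrix.fromBlocks_mulVec, Function.comp_def]
  rfl

theorem FormRel.formDeriv_eq {J K : Matrix (Fin m) (Fin m) ℝ}
    {N N' : VVec m → Matrix (Fin m) (Fin m) ℝ} (h : FormRel (fibreMatrix J K) J N N')
    (hN : ∀ i j, ContDiff ℝ ∞ fun u => N u i j) (hN' : ∀ i j, ContDiff ℝ ∞ fun u => N' u i j)
    (u : VVec m) (z x y : Fin m → ℝ) :
    formDeriv N' ((fibreMatrix J K).mulVec u) (J.mulVec z) (J.mulVec x) (J.mulVec y) =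
      formDeriv N u z x y := by
  rw [BigTangent.formDeriv_eq hN, BigTangent.formDeriv_eq hN', ← fibreMatrix_mulVec_inl]
  refine fderiv_eq_of_comp ?_ (fun v => h.dotProduct_eq v x y) _ _
  exact (((IsSmoothLin.id (X := VVec m)).mulVec hN').dotProduct_right
    (contDiff_const (c := J.mulVec x))).smooth (contDiff_const (c := J.mulVec y))

theorem formDeriv_linear_left (N : VVec m → Matrix (Fin m) (Fin m) ℝ) (u : VVec m)
    (x y : Fin m → ℝ) : IsLinearMap ℝ fun w => formDeriv N u w x y where
  map_add a b := by simp [formDeriv, add_mul, Finset.sum_add_distrib]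
  map_smul r a := by simp [formDeriv, Finset.mul_sum, mul_assoc]

theorem formDeriv_linear_mid (N : VVec m → Matrix (Fin m) (Fin m) ℝ) (u : VVec m)
    (z y : Fin m → ℝ) : IsLinearMap ℝ fun w => formDeriv N u z w y where
  map_add a b := by simp [formDeriv, add_mul, mul_add, Finset.sum_add_distrib]
  map_smul r a := by simp [formDeriv, Finset.mul_sum, mul_assoc, mul_left_comm]

theorem formDeriv_linear_right (N : VVec m → Matrix (Fin m) (Fin m) ℝ) (u : VVec m)
    (z x : Fin m → ℝ) : IsLinearMap ℝ fun w => formDeriv N u z x w where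
  map_add a b := by simp [formDeriv, add_mul, mul_add, Finset.sum_add_distrib]
  map_smul r a := by simp [formDeriv, Finset.mul_sum, mul_assoc, mul_left_comm]

/-- The covector `½ (D_Z σ(X, Y) + D_Y σ(X, Z) - D_X σ(Z, Y))` of the Levi-Civita connection. -/
def leviCivitaForm (N : VVec m → Matrix (Fin m) (Fin m) ℝ) (u : VVec m) (z y x : Fin m → ℝ) : ℝ :=
  (1 / 2 : ℝ) * (formDeriv N u z x y + formDeriv N u y x z - formDeriv N u x z y)

/-- The covector `dN(Z, Y, X)` of the exterior derivative of a 2-form. -/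
def extDerivForm (N : VVec m → Matrix (Fin m) (Fin m) ℝ) (u : VVec m) (z y x : Fin m → ℝ) : ℝ :=
  formDeriv N u z y x + formDeriv N u y x z + formDeriv N u x z y

/-- The Christoffel term is `♯_σ` of the Koszul covector, which is a combination of values of
`formDeriv`; in this form its naturality can be read off. -/
theorem connBase_eq (G : VMetric m) (Z : VField m) (Y : V1Field m) (u : VVec m) :
    connBase G Z Y u = fderiv ℝ Y u (Z u) + (sigma G u)⁻¹.mulVec
      (fun h => leviCivitaForm (sigma G) u (prOne (Z u)) (Y u) (Pi.single h 1)) := by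
  funext i
  have key (h : Fin m) : leviCivitaForm (sigma G) u (prOne (Z u)) (Y u) (Pi.single h 1) =
      ∑ j, ∑ k, (1 / 2 : ℝ) * (pd (Sum.inl j) (fun v => sigma G v h k) u
        + pd (Sum.inl k) (fun v => sigma G v h j) u
        - pd (Sum.inl h) (fun v => sigma G v j k) u) * prOne (Z u) j * Y u k := by
    -- Contraction with a basis vector collapses one of the three sums; each term is then arranged
    -- with the index of `Z` outside and that of `Y` inside.
    have h1 : formDeriv (sigma G) u (prOne (Z u)) (Pi.single h 1) (Y u) =
        ∑ j, ∑ k, pd (Sum.inl j) (fun v => sigma G v h k) u * prOne (Z u) j * Y u k := by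
      refine Finset.sum_congr rfl fun j _ => ?_
      rw [Finset.sum_eq_single h (by simp +contextual) (by simp)]
      refine Finset.sum_congr rfl fun k _ => ?_
      simp; ring
    have h2 : formDeriv (sigma G) u (Y u) (Pi.single h 1) (prOne (Z u)) =
        ∑ j, ∑ k, pd (Sum.inl k) (fun v => sigma G v h j) u * prOne (Z u) j * Y u k := by
      rw [Finset.sum_comm]
      refine Finset.sum_congr rfl fun j _ => ?_
      rw [Finset.sum_eq_single h (by simp +contextual) (by simp)]
      refine Finset.sum_congr rfl fun k _ => ?_
      simp; ring
    have h3 : formDeriv (sigma G) u (Pi.single h 1) (prOne (Z u)) (Y u) =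
        ∑ j, ∑ k, pd (Sum.inl h) (fun v => sigma G v j k) u * prOne (Z u) j * Y u k := by
      rw [formDeriv, Finset.sum_eq_single h (by simp +contextual) (by simp)]
      refine Finset.sum_congr rfl fun j _ => Finset.sum_congr rfl fun k _ => ?_
      simp; ring
    rw [leviCivitaForm, h1, h2, h3, ← Finset.sum_add_distrib, ← Finset.sum_sub_distrib,
      Finset.mul_sum]
    refine Finset.sum_congr rfl fun j _ => ?_
    rw [← Finset.sum_add_distrib, ← Finset.sum_sub_distrib, Finset.mul_sum]
    refine Finset.sum_congr rfl fun k _ => ?_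
    ring
  simp only [connBase, Pi.add_apply, Matrix.mulVec, dotProduct, key, christoffel]
  congr 1
  simp only [Finset.mul_sum, Finset.sum_mul]
  conv_rhs => rw [Finset.sum_comm]
  refine Finset.sum_congr rfl fun j _ => ?_
  conv_rhs => rw [Finset.sum_comm]
  refine Finset.sum_congr rfl fun k _ => Finset.sum_congr rfl fun h _ => ?_
  ring

/-- As in `connBase_eq`, the correction is written as `♯_σ` of a covector, here the contraction of
the exterior derivative of `ψ`. -/
theorem connPsi_eq (G : VMetric m) (ε : ℝ) (Z : VField m) (Y : V1Field m) (u : VVec m) :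
    connPsi G ε Z Y u = connZero G Z Y u + (ε / 2) • (sigma G u)⁻¹.mulVec
      (fun h => extDerivForm (psi G) u (prOne (Z u)) (Y u) (Pi.single h 1)) := by
  have key (h : Fin m) : extDerivForm (psi G) u (prOne (Z u)) (Y u) (Pi.single h 1) =
      ∑ i, ∑ j, dPsi G u i j h * prOne (Z u) i * Y u j := by
    have h1 : formDeriv (psi G) u (prOne (Z u)) (Y u) (Pi.single h 1) =
        ∑ i, ∑ j, pd (Sum.inl i) (fun v => psi G v j h) u * prOne (Z u) i * Y u j := by
      refine Finset.sum_congr rfl fun j _ => Finset.sum_congr rfl fun k _ => ?_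
      rw [Finset.sum_eq_single h (by simp +contextual) (by simp)]
      simp; ring
    have h2 : formDeriv (psi G) u (Y u) (Pi.single h 1) (prOne (Z u)) =
        ∑ i, ∑ j, pd (Sum.inl j) (fun v => psi G v h i) u * prOne (Z u) i * Y u j := by
      rw [Finset.sum_comm]
      refine Finset.sum_congr rfl fun j _ => ?_
      rw [Finset.sum_eq_single h (by simp +contextual) (by simp)]
      refine Finset.sum_congr rfl fun k _ => ?_
      simp; ring
    have h3 : formDeriv (psi G) u (Pi.single h 1) (prOne (Z u)) (Y u) =
        ∑ i, ∑ j, pd (Sum.inl h) (fun v => psi G v i j) u * prOne (Z u) i * Y u j := by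
      rw [formDeriv, Finset.sum_eq_single h (by simp +contextual) (by simp)]
      refine Finset.sum_congr rfl fun j _ => Finset.sum_congr rfl fun k _ => ?_
      simp; ring
    rw [extDerivForm, h1, h2, h3, ← Finset.sum_add_distrib, ← Finset.sum_add_distrib]
    refine Finset.sum_congr rfl fun j _ => ?_
    rw [← Finset.sum_add_distrib, ← Finset.sum_add_distrib]
    refine Finset.sum_congr rfl fun k _ => ?_
    rw [dPsi]
    ring
  simp only [connPsi, key]

end Equivariance

/-! ### Naturality of the construction, from the metric to the scalar curvature. -/

section Invariance

variable {m : ℕ} {G G' : VMetric m} {J K : Matrix (Fin m) (Fin m) ℝ}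

theorem FieldRel.const {ι κ : Type*} [Fintype ι] [Fintype κ] (T : Matrix κ κ ℝ) (S : Matrix ι ι ℝ)
    (w : ι → ℝ) : FieldRel T S (fun _ => w) (fun _ => S.mulVec w) :=
  ⟨contDiff_const, contDiff_const, fun _ => rfl⟩

/-- The operators `P` and `P'` are linear and correspond to each other under linear changes of
coordinates. -/
structure LinRel {ι κ μ : Type*} [Fintype ι] [Fintype κ] [Fintype μ] (T : Matrix κ κ ℝ)
    (S : Matrix ι ι ℝ) (R : Matrix μ μ ℝ)
    (P P' : ((κ → ℝ) → ι → ℝ) → (κ → ℝ) → μ → ℝ) : Prop where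
  lin : IsSmoothLin P
  lin' : IsSmoothLin P'
  eq : ∀ {A A'}, FieldRel T S A A' → ∀ u, P' A' (T.mulVec u) = R.mulVec (P A u)

theorem LinRel.rel {ι κ μ : Type*} [Fintype ι] [Fintype κ] [Fintype μ] {T : Matrix κ κ ℝ}
    {S : Matrix ι ι ℝ} {R : Matrix μ μ ℝ} {P P' : ((κ → ℝ) → ι → ℝ) → (κ → ℝ) → μ → ℝ}
    (h : LinRel T S R P P') {A A' : (κ → ℝ) → ι → ℝ} (hA : FieldRel T S A A') :
    FieldRel T R (P A) (P' A') :=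
  ⟨h.lin.smooth hA.smooth, h.lin'.smooth hA.smooth', h.eq hA⟩

/-- The operators `D` and `D'` are bilinear and correspond to each other under linear changes of
coordinates. -/
structure BilinRel {ι κ μ ν : Type*} [Fintype ι] [Fintype κ] [Fintype μ] [Fintype ν]
    (T : Matrix κ κ ℝ) (S : Matrix ι ι ℝ) (S' : Matrix ν ν ℝ) (R : Matrix μ μ ℝ)
    (D D' : ((κ → ℝ) → ι → ℝ) → ((κ → ℝ) → ν → ℝ) → (κ → ℝ) → μ → ℝ) : Prop where
  bilin : IsSmoothBilin D
  bilin' : IsSmoothBilin D'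
  eq : ∀ {A A' B B'}, FieldRel T S A A' → FieldRel T S' B B' →
    ∀ u, D' A' B' (T.mulVec u) = R.mulVec (D A B u)

theorem BilinRel.rel {ι κ μ ν : Type*} [Fintype ι] [Fintype κ] [Fintype μ] [Fintype ν]
    {T : Matrix κ κ ℝ} {S : Matrix ι ι ℝ} {S' : Matrix ν ν ℝ} {R : Matrix μ μ ℝ}
    {D D' : ((κ → ℝ) → ι → ℝ) → ((κ → ℝ) → ν → ℝ) → (κ → ℝ) → μ → ℝ}
    (h : BilinRel T S S' R D D') {A A' : (κ → ℝ) → ι → ℝ} {B B' : (κ → ℝ) → ν → ℝ}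
    (hA : FieldRel T S A A') (hB : FieldRel T S' B B') : FieldRel T R (D A B) (D' A' B') :=
  ⟨h.bilin.smooth hA.smooth hB.smooth, h.bilin'.smooth hA.smooth' hB.smooth', h.eq hA hB⟩

namespace FrameChange

theorem mul_transpose (h : FrameChange G G' J K) : J * K.transpose = 1 :=
  mul_eq_one_comm.1 h.transpose_mul

theorem transpose_mul' (h : FrameChange G G' J K) : J.transpose * K = 1 := by
  simpa using congrArg Matrix.transpose h.transpose_mul

theorem mul_transpose' (h : FrameChange G G' J K) : K * J.transpose = 1 :=
  mul_eq_one_comm.1 h.transpose_mul'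

theorem isUnit_det (h : FrameChange G G' J K) : IsUnit J.det :=
  (Matrix.isUnit_iff_isUnit_det _).1 (IsUnit.of_mul_eq_one _ h.mul_transpose)

theorem fibreMatrix_mul (h : FrameChange G G' J K) :
    fibreMatrix J K * fibreMatrix K.transpose J.transpose = 1 := by
  simp [fibreMatrix, Matrix.fromBlocks_multiply, h.mul_transpose, h.mul_transpose']

theorem isUnit_det_fibreMatrix (h : FrameChange G G' J K) : IsUnit (fibreMatrix J K).det :=
  (Matrix.isUnit_iff_isUnit_det _).1 (IsUnit.of_mul_eq_one _ h.fibreMatrix_mul)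

theorem metric_rel (h : FrameChange G G' J K) :
    FormRel (fibreMatrix J K) (fibreMatrix J K) G G' := h.metric_eq

theorem blocks_eq (h : FrameChange G G' J K) (u : VVec m) :
    (G u).toBlocks₂₁ = K.transpose * (G' ((fibreMatrix J K).mulVec u)).toBlocks₂₁ * J ∧
    (G u).toBlocks₂₂ = K.transpose * (G' ((fibreMatrix J K).mulVec u)).toBlocks₂₂ * K := by
  have h1 := h.metric_eq u
  rw [← Matrix.fromBlocks_toBlocks (G' ((fibreMatrix J K).mulVec u))] at h1
  simp only [fibreMatrix, Matrix.fromBlocks_transpose, Matrix.fromBlocks_multiply,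
    Matrix.transpose_zero, Matrix.zero_mul, Matrix.mul_zero, add_zero, zero_add] at h1
  rw [h1]
  exact ⟨rfl, rfl⟩

/-- The block of `G` on `V₂` transforms by `K`, so its inverse transforms by the inverse transpose
of `K`, which is `J`. -/
theorem sigma_rel (h : FrameChange G G' J K) :
    FormRel (fibreMatrix J K) J (sigma G) (sigma G') := by
  intro u
  have hK : K⁻¹ = J.transpose := Matrix.inv_eq_left_inv h.transpose_mul'
  have hK' : K.transpose⁻¹ = J := Matrix.inv_eq_left_inv h.mul_transpose
  rw [sigma, (h.blocks_eq u).2, Matrix.mul_inv_rev, Matrix.mul_inv_rev, hK, hK', sigma,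
    Matrix.mul_assoc]

/-- In the product of `lᵀ` with `σ` the adjacent factors `K` and `Jᵀ` cancel. -/
theorem psi_rel (h : FrameChange G G' J K) : FormRel (fibreMatrix J K) J (psi G) (psi G') := by
  intro u
  rw [psi, ell, (h.blocks_eq u).1, h.sigma_rel u, psi, ell]
  simp only [Matrix.transpose_mul, Matrix.transpose_transpose, Matrix.mul_neg, Matrix.neg_mul,
    Matrix.mul_assoc]
  rw [← Matrix.mul_assoc K, h.mul_transpose', Matrix.one_mul]

/-- Because `K` is the inverse transpose of `J`, the pairing of `V₁` with `V₂` is preserved: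
conjugating the swap matrix by `T`, as `T * Ω * Tᵀ`, returns it. Hence the endomorphism `Ω * G` is
conjugated by `T`. -/
theorem phi_mulVec (h : FrameChange G G' J K) (u w : VVec m) :
    (phi G' ((fibreMatrix J K).mulVec u)).mulVec ((fibreMatrix J K).mulVec w) =
      (fibreMatrix J K).mulVec ((phi G u).mulVec w) := by
  have h1 : fibreMatrix J K * Matrix.fromBlocks 0 1 1 0 * (fibreMatrix J K).transpose =
      Matrix.fromBlocks 0 1 1 0 := by
    simp [fibreMatrix, Matrix.fromBlocks_transpose, Matrix.fromBlocks_multiply, h.mul_transpose,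
      h.mul_transpose']
  rw [Matrix.mulVec_mulVec, Matrix.mulVec_mulVec, phi, phi, h.metric_eq u]
  congr 1
  conv_lhs => rw [← h1]
  simp only [Matrix.mul_assoc]

theorem prU_rel (h : FrameChange G G' J K) (ε : ℝ) :
    LinRel (fibreMatrix J K) (fibreMatrix J K) (fibreMatrix J K) (prU G ε) (prU G' ε) where
  lin := h.regular.prU ε
  lin' := h.regular'.prU ε
  eq hA u := by
    simp only [prU, hA.eq, h.phi_mulVec, Matrix.mulVec_smul, Matrix.mulVec_add]

theorem prOne_prU_rel (h : FrameChange G G' J K) (ε : ℝ) :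
    LinRel (fibreMatrix J K) (fibreMatrix J K) J (fun Z u => prOne (prU G ε Z u))
      (fun Z u => prOne (prU G' ε Z u)) where
  lin := (h.regular.prU ε).prOne
  lin' := (h.regular'.prU ε).prOne
  eq hA u := by rw [(h.prU_rel ε).eq hA, prOne_fibreMatrix]

/-- The second component is a form applied to a vector, hence a covector, and `K * Jᵀ = 1` makes it
transform by `K`. -/
theorem iota_rel (h : FrameChange G G' J K) (ε : ℝ) :
    LinRel (fibreMatrix J K) J (fibreMatrix J K) (iota G ε) (iota G' ε) where
  lin := h.regular.iota ε
  lin' := h.regular'.iota ε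
  eq {A A'} hA u := by
    have h1 : (psi G' ((fibreMatrix J K).mulVec u)).transpose.mulVec (J.mulVec (A u)) =
        K.mulVec ((psi G u).transpose.mulVec (A u)) := by
      rw [Matrix.mulVec_mulVec, Matrix.mulVec_mulVec, h.psi_rel u]
      simp only [Matrix.transpose_mul, Matrix.transpose_transpose]
      rw [← Matrix.mul_assoc, h.mul_transpose', Matrix.one_mul]
    have h2 : (sigma G' ((fibreMatrix J K).mulVec u)).mulVec (J.mulVec (A u)) =
        K.mulVec ((sigma G u).mulVec (A u)) := by
      rw [Matrix.mulVec_mulVec, Matrix.mulVec_mulVec, h.sigma_rel u]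
      simp only [← Matrix.mul_assoc]
      rw [h.mul_transpose', Matrix.one_mul]
    rw [iota, hA.eq, h1, h2, iota, fibreMatrix, Matrix.fromBlocks_mulVec]
    simp only [Sum.elim_comp_inl, Sum.elim_comp_inr, Matrix.zero_mulVec, smul_zero, add_zero,
      zero_add, Matrix.mulVec_add, Matrix.mulVec_smul]

theorem leviCivitaForm_eq (h : FrameChange G G' J K) (u : VVec m) (z y x : Fin m → ℝ) :
    leviCivitaForm (sigma G') ((fibreMatrix J K).mulVec u) (J.mulVec z) (J.mulVec y) (J.mulVec x) =
      leviCivitaForm (sigma G) u z y x := by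
  simp only [leviCivitaForm,
    h.sigma_rel.formDeriv_eq h.regular.smooth_sigma h.regular'.smooth_sigma]

theorem extDerivForm_eq (h : FrameChange G G' J K) (u : VVec m) (z y x : Fin m → ℝ) :
    extDerivForm (psi G') ((fibreMatrix J K).mulVec u) (J.mulVec z) (J.mulVec y) (J.mulVec x) =
      extDerivForm (psi G) u z y x := by
  simp only [extDerivForm,
    h.psi_rel.formDeriv_eq h.regular.smooth_psi h.regular'.smooth_psi]

theorem leviCivitaForm_linear (N : VVec m → Matrix (Fin m) (Fin m) ℝ) (u : VVec m)
    (z y : Fin m → ℝ) : IsLinearMap ℝ (leviCivitaForm N u z y) where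
  map_add a b := by
    simp only [leviCivitaForm, (formDeriv_linear_mid N u _ _).map_add,
      (formDeriv_linear_left N u _ _).map_add]
    ring
  map_smul r a := by
    simp only [leviCivitaForm, (formDeriv_linear_mid N u _ _).map_smul,
      (formDeriv_linear_left N u _ _).map_smul, smul_eq_mul]
    ring

theorem extDerivForm_linear (N : VVec m → Matrix (Fin m) (Fin m) ℝ) (u : VVec m)
    (z y : Fin m → ℝ) : IsLinearMap ℝ (extDerivForm N u z y) where
  map_add a b := by
    simp only [extDerivForm, (formDeriv_linear_mid N u _ _).map_add,
      (formDeriv_linear_left N u _ _).map_add, (formDeriv_linear_right N u _ _).map_add]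
    ring
  map_smul r a := by
    simp only [extDerivForm, (formDeriv_linear_mid N u _ _).map_smul,
      (formDeriv_linear_left N u _ _).map_smul, (formDeriv_linear_right N u _ _).map_smul,
      smul_eq_mul]
    ring

/-- Connections on `V₁` that correspond to each other. -/
abbrev ConnOneRel (J K : Matrix (Fin m) (Fin m) ℝ) (D D' : Conn1 m) : Prop :=
  BilinRel (fibreMatrix J K) (fibreMatrix J K) J J D D'

/-- Connections on `V` that correspond to each other. -/
abbrev ConnVRel (J K : Matrix (Fin m) (Fin m) ℝ) (D D' : ConnV m) : Prop :=
  BilinRel (fibreMatrix J K) (fibreMatrix J K) (fibreMatrix J K) (fibreMatrix J K) D D'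

theorem connBase_rel (h : FrameChange G G' J K) : ConnOneRel J K (connBase G) (connBase G') where
  bilin := h.regular.connBase
  bilin' := h.regular'.connBase
  eq {Z Z' Y Y'} hZ hY u := by
    rw [connBase_eq, connBase_eq, hZ.eq, hY.eq, hY.fderiv_eq, prOne_fibreMatrix, Matrix.mulVec_add,
      -- The flat term is already matched by the chain rule; it remains to compare the Koszul
      -- covectors.
      h.sigma_rel.sharp_eq h.isUnit_det]
    exact transpose_mulVec_form (leviCivitaForm_linear _ _ _ _)
      fun v => h.leviCivitaForm_eq u _ _ v

theorem covSigma_eq (h : FrameChange G G' J K) {D D' : Conn1 m} (hD : ConnOneRel J K D D')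
    {Z Z' : VField m} {Y Y' W W' : V1Field m}
    (hZ : FieldRel (fibreMatrix J K) (fibreMatrix J K) Z Z')
    (hY : FieldRel (fibreMatrix J K) J Y Y') (hW : FieldRel (fibreMatrix J K) J W W')
    (u : VVec m) :
    covSigma G' D' Z' Y' W' ((fibreMatrix J K).mulVec u) = covSigma G D Z Y W u := by
  have h1 : ContDiff ℝ ∞ fun v => Y' v ⬝ᵥ (sigma G' v).mulVec (W' v) :=
    ((IsSmoothLin.id.mulVec h.regular'.smooth_sigma).dotProduct_right hY.smooth').smooth hW.smooth'
  rw [covSigma, covSigma, hD.eq hZ hY, hD.eq hZ hW, hY.eq, hW.eq, hZ.eq,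
    h.sigma_rel.dotProduct_eq, h.sigma_rel.dotProduct_eq]
  congr 2
  refine fderiv_eq_of_comp h1 (fun v => ?_) u (Z u)
  rw [hY.eq, hW.eq, h.sigma_rel.dotProduct_eq]

theorem metrize_rel (h : FrameChange G G' J K) {D D' : Conn1 m} (hD : ConnOneRel J K D D') :
    ConnOneRel J K (metrize G D) (metrize G' D') where
  bilin := h.regular.metrize hD.bilin
  bilin' := h.regular'.metrize hD.bilin'
  eq {Z Z' Y Y'} hZ hY u := by
    rw [metrize, metrize, hD.eq hZ hY, Matrix.mulVec_add, Matrix.mulVec_smul,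
      h.sigma_rel.sharp_eq h.isUnit_det]
    exact transpose_mulVec_form (f' := fun w => covSigma G' D' Z' Y' (fun _ => w) _)
      (f := fun w => covSigma G D Z Y (fun _ => w) u)
      (h.regular'.covSigma_const hD.bilin' hZ.smooth' hY.smooth' _)
      fun v => h.covSigma_eq hD hZ hY (FieldRel.const _ _ v) u

theorem connZero_rel (h : FrameChange G G' J K) : ConnOneRel J K (connZero G) (connZero G') :=
  h.metrize_rel h.connBase_rel

theorem connPsi_rel (h : FrameChange G G' J K) (ε : ℝ) :
    ConnOneRel J K (connPsi G ε) (connPsi G' ε) where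
  bilin := h.regular.connPsi ε
  bilin' := h.regular'.connPsi ε
  eq {Z Z' Y Y'} hZ hY u := by
    rw [connPsi_eq, connPsi_eq, h.connZero_rel.eq hZ hY, hZ.eq, hY.eq, prOne_fibreMatrix,
      Matrix.mulVec_add, Matrix.mulVec_smul, h.sigma_rel.sharp_eq h.isUnit_det]
    exact transpose_mulVec_form (extDerivForm_linear _ _ _ _)
      fun v => h.extDerivForm_eq u _ _ v

theorem connEps_rel (h : FrameChange G G' J K) (ε : ℝ) :
    ConnOneRel J K (connEps G ε) (connEps G' ε) := h.metrize_rel (h.connPsi_rel ε)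

theorem doubleConn_rel (h : FrameChange G G' J K) {Dp Dp' Dm Dm' : Conn1 m}
    (hp : ConnOneRel J K Dp Dp') (hm : ConnOneRel J K Dm Dm') :
    ConnVRel J K (doubleConn G Dp Dm) (doubleConn G' Dp' Dm') where
  bilin := h.regular.doubleConn hp.bilin hm.bilin
  bilin' := h.regular'.doubleConn hp.bilin' hm.bilin'
  eq hZ hW u := by
    rw [doubleConn, doubleConn, Matrix.mulVec_add,
      (h.iota_rel 1).eq (hp.rel hZ ((h.prOne_prU_rel 1).rel hW)),
      (h.iota_rel (-1)).eq (hm.rel hZ ((h.prOne_prU_rel (-1)).rel hW))]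

theorem connVZero_rel (h : FrameChange G G' J K) : ConnVRel J K (connVZero G) (connVZero G') :=
  h.doubleConn_rel h.connZero_rel h.connZero_rel

theorem wedge_rel (h : FrameChange G G' J K) {D D' : ConnV m} (hD : ConnVRel J K D D') :
    ConnVRel J K (wedge G D) (wedge G' D') where
  bilin := h.regular.wedge hD.bilin
  bilin' := h.regular'.wedge hD.bilin'
  eq {A A' B B'} hA hB u := by
    rw [wedge, wedge, h.metric_rel.sharp_eq h.isUnit_det_fibreMatrix]
    refine transpose_mulVec_form (h.regular'.wedge_const hD.bilin' hA.smooth' hB.smooth' _)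
      (f := fun w => (1 / 2 : ℝ) * (A u ⬝ᵥ (G u).mulVec (D (fun _ => w) B u)
      - B u ⬝ᵥ (G u).mulVec (D (fun _ => w) A u))) fun v => ?_
    rw [hD.eq (FieldRel.const _ _ v) hB, hD.eq (FieldRel.const _ _ v) hA, hA.eq, hB.eq,
      h.metric_rel.dotProduct_eq, h.metric_rel.dotProduct_eq]

theorem metricBracket_rel (h : FrameChange G G' J K) :
    ConnVRel J K (metricBracket G) (metricBracket G') where
  bilin := h.regular.metricBracket
  bilin' := h.regular'.metricBracket
  eq hA hB u := by
    rw [metricBracket, metricBracket, h.connVZero_rel.eq hA hB, h.connVZero_rel.eq hB hA,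
      (h.wedge_rel h.connVZero_rel).eq hA hB, Matrix.mulVec_sub, Matrix.mulVec_sub]

theorem connTilde_rel (h : FrameChange G G' J K) (ε : ℝ) :
    ConnOneRel J K (connTilde G ε) (connTilde G' ε) where
  bilin := h.regular.connTilde ε
  bilin' := h.regular'.connTilde ε
  eq hZ hY u := by
    rw [connTilde, connTilde, (h.connEps_rel ε).eq ((h.prU_rel ε).rel hZ) hY, Matrix.mulVec_add,
      (h.prOne_prU_rel ε).eq (h.metricBracket_rel.rel ((h.prU_rel (-ε)).rel hZ)
        ((h.iota_rel ε).rel hY))]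

theorem connVTilde_rel (h : FrameChange G G' J K) : ConnVRel J K (connVTilde G) (connVTilde G') :=
  h.doubleConn_rel (h.connTilde_rel 1) (h.connTilde_rel (-1))

theorem deformedBracket_rel (h : FrameChange G G' J K) {D D' : ConnV m}
    (hD : ConnVRel J K D D') : ConnVRel J K (deformedBracket G D) (deformedBracket G' D') where
  bilin := h.regular.deformedBracket hD.bilin
  bilin' := h.regular'.deformedBracket hD.bilin'
  eq hA hB u := by
    rw [deformedBracket, deformedBracket, h.metricBracket_rel.eq hA hB,
      (h.wedge_rel hD).eq hA hB, Matrix.mulVec_add]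

theorem deformedTorsion_rel (h : FrameChange G G' J K) {D D' : ConnV m}
    (hD : ConnVRel J K D D') : ConnVRel J K (deformedTorsion G D) (deformedTorsion G' D') where
  bilin := h.regular.deformedTorsion hD.bilin
  bilin' := h.regular'.deformedTorsion hD.bilin'
  eq hA hB u := by
    rw [deformedTorsion, deformedTorsion, hD.eq hA hB, hD.eq hB hA,
      (h.deformedBracket_rel hD).eq hA hB, Matrix.mulVec_sub, Matrix.mulVec_sub]

theorem fieldAdapted_rel (h : FrameChange G G' J K) :
    ConnVRel J K (fieldAdapted G) (fieldAdapted G') where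
  bilin := h.regular.fieldAdapted
  bilin' := h.regular'.fieldAdapted
  eq {A A' B B'} hA hB u := by
    rw [fieldAdapted, fieldAdapted, h.connVTilde_rel.eq hA hB, Matrix.mulVec_add,
      h.metric_rel.sharp_eq h.isUnit_det_fibreMatrix]
    refine transpose_mulVec_form
      (f' := fun w => -(1 / 3 : ℝ) * gualtieriTorsion G' (connVTilde G') A' B' (fun _ => w) _)
      (f := fun w => -(1 / 3 : ℝ) * gualtieriTorsion G (connVTilde G) A B (fun _ => w) u)
      ?_ fun v => ?_
    · have hT := (h.regular'.deformedTorsion h.regular'.connVTilde).smooth hA.smooth' hB.smooth'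
      exact (((IsSmoothLin.id.mulVec h.regular'.smooth).dotProduct_right hT).const_smul
        (-(1 / 3))).isLinearMap_const _
    · rw [gualtieriTorsion, gualtieriTorsion,
        (h.deformedTorsion_rel h.connVTilde_rel).eq hA hB, h.metric_rel.dotProduct_eq]

/-- `BilinRel.rel` relates whole fields and keeps their smoothness, so its output can be
differentiated again; this covers the iterated covariant derivatives. -/
theorem deformedCurvature_eq (h : FrameChange G G' J K) {A A' B B' C C' : VField m}
    (hA : FieldRel (fibreMatrix J K) (fibreMatrix J K) A A')
    (hB : FieldRel (fibreMatrix J K) (fibreMatrix J K) B B')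
    (hC : FieldRel (fibreMatrix J K) (fibreMatrix J K) C C') (u : VVec m) :
    deformedCurvature G' A' B' C' ((fibreMatrix J K).mulVec u) =
      (fibreMatrix J K).mulVec (deformedCurvature G A B C u) := by
  have hF := h.fieldAdapted_rel
  rw [deformedCurvature, deformedCurvature, hF.eq hA (hF.rel hB hC), hF.eq hB (hF.rel hA hC),
    hF.eq ((h.deformedBracket_rel hF).rel hA hB) hC, Matrix.mulVec_sub, Matrix.mulVec_sub]

end FrameChange

/-! ### Traces and contractions: the Ricci form and the scalar curvature. -/

theorem sum_apply_single_eq_trace {ι : Type*} [Fintype ι] [DecidableEq ι]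
    (L : (ι → ℝ) →ₗ[ℝ] (ι → ℝ)) : ∑ q, L (Pi.single q 1) q = LinearMap.trace ℝ _ L := by
  rw [LinearMap.trace_eq_matrix_trace ℝ (Pi.basisFun ℝ ι), LinearMap.toMatrix_eq_toMatrix']
  rfl

/-- Both sums are traces, and `L'` is the conjugate of `L` by `T`. -/
theorem sum_apply_single_congr {ι : Type*} [Fintype ι] [DecidableEq ι] {T T' : Matrix ι ι ℝ}
    (hT : T * T' = 1) {L L' : (ι → ℝ) → ι → ℝ} (hL : IsLinearMap ℝ L) (hL' : IsLinearMap ℝ L')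
    (h : ∀ x, L' (T.mulVec x) = T.mulVec (L x)) :
    ∑ q, L' (Pi.single q 1) q = ∑ q, L (Pi.single q 1) q := by
  have h1 := sum_apply_single_eq_trace hL.mk'
  have h2 := sum_apply_single_eq_trace hL'.mk'
  simp only [IsLinearMap.mk'_apply] at h1 h2
  rw [h1, h2]
  have h3 : hL'.mk' = T.mulVecLin ∘ₗ hL.mk' ∘ₗ T'.mulVecLin := by
    refine LinearMap.ext fun x => ?_
    simp [← h, Matrix.mulVec_mulVec, hT]
  rw [h3, LinearMap.trace_comp_comm', LinearMap.comp_assoc, ← Matrix.mulVecLin_mul,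
    mul_eq_one_comm.1 hT, Matrix.mulVecLin_one, LinearMap.comp_id]

/-- `T` sends vertical lifts to vertical lifts, so the naturality of the curvature applies to the
constant fields in the definition; the sum over `q` is a trace in the first argument. -/
theorem FrameChange.deformedRicci_eq (h : FrameChange G G' J K) (v w u : VVec m) :
    deformedRicci G' ((fibreMatrix J K).mulVec v) ((fibreMatrix J K).mulVec w)
      ((fibreMatrix J K).mulVec u) = deformedRicci G v w u := by
  have key (v w : VVec m) :
      ∑ q, deformedCurvature G' (fun _ => unitVec q) (fun _ => (fibreMatrix J K).mulVec v)
        (fun _ => (fibreMatrix J K).mulVec w) ((fibreMatrix J K).mulVec u) q =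
      ∑ q, deformedCurvature G (fun _ => unitVec q) (fun _ => v) (fun _ => w) u q :=
    sum_apply_single_congr h.fibreMatrix_mul
      ((h.regular.deformedCurvature_first contDiff_const contDiff_const).isLinearMap_const u)
      ((h.regular'.deformedCurvature_first contDiff_const contDiff_const).isLinearMap_const _)
      fun x => h.deformedCurvature_eq (FieldRel.const _ _ x) (FieldRel.const _ _ v)
        (FieldRel.const _ _ w) u
  rw [deformedRicci, deformedRicci, Finset.sum_add_distrib, Finset.sum_add_distrib, key, key]

theorem FrameChange.deformedScalar_eq (h : FrameChange G G' J K) (b : VIdx m → VVec m)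
    (u : VVec m) :
    deformedScalar G' (fun q => (fibreMatrix J K).mulVec (b q)) ((fibreMatrix J K).mulVec u) =
      deformedScalar G b u := by
  simp only [deformedScalar, h.metric_rel.dotProduct_eq, h.deformedRicci_eq]

theorem IsRegular.deformedRicci_linear_left (hG : IsRegular G) (w u : VVec m) :
    IsLinearMap ℝ fun v => deformedRicci G v w u := by
  have h (q : VIdx m) := hG.deformedCurvature_last (contDiff_const (c := (unitVec q : VVec m)))
  exact ((IsSmoothLin.sum fun q => (((h q).left contDiff_const).apply q).add'
    (((h q).right contDiff_const).apply q)).const_smul (1 / 2)).isLinearMap_const u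

theorem IsRegular.deformedRicci_linear_right (hG : IsRegular G) (v u : VVec m) :
    IsLinearMap ℝ fun w => deformedRicci G v w u := by
  have h (q : VIdx m) := hG.deformedCurvature_last (contDiff_const (c := (unitVec q : VVec m)))
  exact ((IsSmoothLin.sum fun q => (((h q).right contDiff_const).apply q).add'
    (((h q).left contDiff_const).apply q)).const_smul (1 / 2)).isLinearMap_const u

/-- The contraction of two bilinear forms does not depend on the basis. -/
theorem sum_inv_gram_mul {ι : Type*} [Fintype ι] [DecidableEq ι] (N : Matrix ι ι ℝ)
    {R : (ι → ℝ) → (ι → ℝ) → ℝ} (h1 : ∀ w, IsLinearMap ℝ fun v => R v w)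
    (h2 : ∀ v, IsLinearMap ℝ (R v)) {B : Matrix ι ι ℝ} (hB : IsUnit B.det) :
    ∑ q, ∑ s, (Matrix.of fun i j => B i ⬝ᵥ N.mulVec (B j))⁻¹ q s * R (B q) (B s) =
      ∑ q, ∑ s, N⁻¹ q s * R (Pi.single q 1) (Pi.single s 1) := by
  set C : Matrix ι ι ℝ := Matrix.of fun q s => R (Pi.single q 1) (Pi.single s 1) with hC
  -- With the basis as the rows of `B`, the Gram matrix is `B * N * Bᵀ` and the form `R` has matrix
  -- `B * C * Bᵀ`. As a trace of a product, the double contraction loses `B` by cyclicity.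
  have htr (A D : Matrix ι ι ℝ) : ∑ q, ∑ s, A q s * D q s = (A * D.transpose).trace := by
    simp [Matrix.trace, Matrix.mul_apply]
  have hgram : (Matrix.of fun i j => B i ⬝ᵥ N.mulVec (B j)) = B * N * B.transpose := by
    ext i j
    rw [Matrix.of_apply, Matrix.mul_assoc, Matrix.mul_apply']
    congr 1
  have hexp (v : ι → ℝ) : v = ∑ q, v q • (Pi.single q 1 : ι → ℝ) := by
    simpa using pi_eq_sum_univ' v
  have hR : (Matrix.of fun q s => R (B q) (B s)) = B * C * B.transpose := by
    ext i j
    have e1 : R (B i) (B j) = ∑ q, ∑ s, B i q * (B j s * C q s) := by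
      have a1 := map_sum (h1 (B j)).mk' (fun q => B i q • (Pi.single q 1 : ι → ℝ)) Finset.univ
      rw [← hexp (B i)] at a1
      simp only [map_smul, IsLinearMap.mk'_apply, smul_eq_mul] at a1
      rw [a1]
      refine Finset.sum_congr rfl fun q _ => ?_
      have a2 := map_sum (h2 (Pi.single q 1)).mk' (fun s => B j s • (Pi.single s 1 : ι → ℝ))
        Finset.univ
      rw [← hexp (B j)] at a2
      simp only [map_smul, IsLinearMap.mk'_apply, smul_eq_mul] at a2
      rw [a2, Finset.mul_sum]
      rfl
    rw [Matrix.of_apply, e1, Matrix.mul_assoc, Matrix.mul_apply]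
    refine Finset.sum_congr rfl fun q _ => ?_
    rw [Matrix.mul_apply, Finset.mul_sum]
    refine Finset.sum_congr rfl fun s _ => ?_
    rw [Matrix.transpose_apply]
    ring
  have hB' : IsUnit B.transpose.det := by rwa [Matrix.det_transpose]
  calc _ = ((B * N * B.transpose)⁻¹ * (B * C * B.transpose).transpose).trace := by
        rw [← htr, ← hR, ← hgram]; rfl
    _ = (B.transpose⁻¹ * (N⁻¹ * C.transpose) * B.transpose).trace := by
        rw [Matrix.mul_inv_rev, Matrix.mul_inv_rev]
        simp only [Matrix.transpose_mul, Matrix.transpose_transpose, Matrix.mul_assoc]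
        rw [← Matrix.mul_assoc B⁻¹, Matrix.nonsing_inv_mul _ hB, Matrix.one_mul]
    _ = (N⁻¹ * C.transpose).trace := by
        rw [Matrix.trace_mul_comm, ← Matrix.mul_assoc, Matrix.mul_nonsing_inv _ hB', Matrix.one_mul]
    _ = _ := (htr _ _).symm

theorem IsRegular.deformedScalar_eq_basis (hG : IsRegular G) (u : VVec m) {b : VIdx m → VVec m}
    (hb : IsUnit (Matrix.of b).det) : deformedScalar G b u = deformedScalar G unitVec u := by
  have h1 := sum_inv_gram_mul (G u) (fun w => hG.deformedRicci_linear_left w u)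
    (fun v => hG.deformedRicci_linear_right v u) hb
  have h2 := sum_inv_gram_mul (G u) (fun w => hG.deformedRicci_linear_left w u)
    (fun v => hG.deformedRicci_linear_right v u) (B := Matrix.of unitVec) ?_
  · exact h1.trans h2.symm
  · have : (Matrix.of unitVec : Matrix (VIdx m) (VIdx m) ℝ) = 1 := by
      ext i j
      simp [unitVec, Matrix.one_apply, Pi.single_apply, eq_comm]
    rw [this]
    simp

end Invariance

section Components

variable {m : ℕ} {M : Type*} [TopologicalSpace M] [ChartedSpace (Fin m → ℝ) M]
  [IsManifold 𝓘(ℝ, Fin m → ℝ) ∞ M]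
  {c c' : OpenPartialHomeomorph M (Fin m → ℝ)} {x : M}

/-! ### The vertical metric in natural coordinates -/

/-- The Jacobian matrix of the change of charts from `c` to `c'`. -/
def jacMatrix (c c' : OpenPartialHomeomorph M (Fin m → ℝ)) (x : M) : Matrix (Fin m) (Fin m) ℝ :=
  LinearMap.toMatrix' (jac c c' x).toLinearMap

theorem jacMatrix_mulVec (c c' : OpenPartialHomeomorph M (Fin m → ℝ)) (x : M) (v : Fin m → ℝ) :
    (jacMatrix c c' x).mulVec v = jac c c' x v := LinearMap.toMatrix'_mulVec _ v

theorem det_jacMatrix (c c' : OpenPartialHomeomorph M (Fin m → ℝ)) (x : M) :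
    (jacMatrix c c' x).det = (jac c c' x).det := LinearMap.det_toMatrix' _

theorem jacMatrix_mul (hc : c ∈ smoothCharts m M) (hc' : c' ∈ smoothCharts m M)
    (hx : x ∈ c.source) (hx' : x ∈ c'.source) : jacMatrix c c' x * jacMatrix c' c x = 1 := by
  rw [jacMatrix, jacMatrix, ← LinearMap.toMatrix'_mul, ← LinearMap.toMatrix'_one]
  exact congrArg (fun L : (Fin m → ℝ) →L[ℝ] (Fin m → ℝ) => LinearMap.toMatrix' L.toLinearMap)
    (jac_comp_jac hc hc' hx hx')

/-- The matrix of the change of the fibre coordinates over `x`, from those of `c` to those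
of `c'`. -/
abbrev fibreJac (c c' : OpenPartialHomeomorph M (Fin m → ℝ)) (x : M) :
    Matrix (VIdx m) (VIdx m) ℝ :=
  fibreMatrix (jacMatrix c c' x) (jacMatrix c' c x).transpose

/-- The determinants of the tangent and cotangent blocks are inverse to each other. -/
theorem det_fibreJac (hc : c ∈ smoothCharts m M) (hc' : c' ∈ smoothCharts m M)
    (hx : x ∈ c.source) (hx' : x ∈ c'.source) : (fibreJac c c' x).det = 1 := by
  rw [fibreJac, fibreMatrix, Matrix.det_fromBlocks_zero₂₁, Matrix.det_transpose, ← Matrix.det_mul,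
    jacMatrix_mul hc hc' hx hx', Matrix.det_one]

theorem fibreCoord_change (hc : c ∈ smoothCharts m M) (hx : x ∈ c.source)
    (Z : BigFiber (m := m) x) :
    fibreCoord c' x Z = (fibreJac c c' x).mulVec (fibreCoord c x Z) := by
  funext q
  rcases q with i | i
  · have h1 : chartDiff c' x Z.1 = jac c c' x (chartDiff c x Z.1) :=
      congrArg (fun L => L Z.1) (jac_comp_chartDiff (c' := c') hc hx).symm
    have h2 := congrFun (prOne_fibreMatrix (jacMatrix c c' x) (jacMatrix c' c x).transpose
      (fibreCoord c x Z)) i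
    refine Eq.trans ?_ h2.symm
    rw [jacMatrix_mulVec]
    exact congrFun h1 i
  · have h1 : (chartDiff c' x).inverse (Pi.single i 1) =
        (chartDiff c x).inverse (jac c' c x (Pi.single i 1)) :=
      congrArg (fun L => L (Pi.single i 1)) (inverse_chartDiff_comp_jac (c := c') hc hx).symm
    have h2 : (fibreCoord c' x Z) (Sum.inr i) =
      Z.2 ((chartDiff c x).inverse (jac c' c x (Pi.single i 1))) := congrArg Z.2 h1
    rw [h2, fibreJac, fibreMatrix, Matrix.fromBlocks_mulVec, Sum.elim_inr, Matrix.zero_mulVec,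
      zero_add]
    have h3 : jac c' c x (Pi.single i 1) =
        ∑ j, jacMatrix c' c x j i • (Pi.single j 1 : Fin m → ℝ) := by
      have := pi_eq_sum_univ' (jac c' c x (Pi.single i 1))
      rw [this]
      refine Finset.sum_congr rfl fun j _ => ?_
      simp [jacMatrix, LinearMap.toMatrix'_apply]
    rw [h3, map_sum, map_sum]
    refine Finset.sum_congr rfl fun j _ => ?_
    rw [map_smul, map_smul]
    rfl

theorem fibreVec_change (hc : c ∈ smoothCharts m M) (hc' : c' ∈ smoothCharts m M)
    (hx : x ∈ c.source) (hx' : x ∈ c'.source) (w : VVec m) :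
    fibreVec c' x ((fibreJac c c' x).mulVec w) = fibreVec c x w := by
  conv_lhs => rw [← fibreCoord_fibreVec hc hx w]
  rw [← fibreCoord_change (c' := c') hc hx, fibreVec_fibreCoord hc' hx']

/-- `fibreVec` as a linear map. -/
def fibreVecLin (c : OpenPartialHomeomorph M (Fin m → ℝ)) (x : M) :
    VVec m →ₗ[ℝ] BigFiber (m := m) x where
  toFun := fibreVec c x
  map_add' v w := by
    refine Prod.ext ?_ ?_
    · exact (chartDiff c x).inverse.map_add (fun i => v (Sum.inl i)) (fun i => w (Sum.inl i))
    · refine ContinuousLinearMap.ext fun y => ?_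
      simp [fibreVec, add_mul, Finset.sum_add_distrib]
  map_smul' r v := by
    refine Prod.ext ?_ ?_
    · exact (chartDiff c x).inverse.map_smul r (fun i => v (Sum.inl i))
    · refine ContinuousLinearMap.ext fun y => ?_
      simp [fibreVec, Finset.mul_sum, mul_assoc]

theorem dotProduct_comps (g : ∀ p : BigTan m M, LinearMap.BilinForm ℝ (BigFiber (m := m) p.proj))
    (c : OpenPartialHomeomorph M (Fin m → ℝ)) (x : M) (u v w : VVec m) :
    v ⬝ᵥ (comps g c x u).mulVec w = g ⟨x, fibreVec c x u⟩ (fibreVec c x v) (fibreVec c x w) := by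
  have hexp (v : VVec m) : fibreVec c x v = ∑ q, v q • fibreVec c x (unitVec q) := by
    have h1 : v = ∑ q, v q • (unitVec q : VVec m) := by simpa [unitVec] using pi_eq_sum_univ' v
    have h2 := congrArg (fibreVecLin c x) h1
    rw [map_sum] at h2
    simp only [map_smul] at h2
    exact h2
  rw [hexp v, hexp w]
  simp only [map_sum, map_smul, LinearMap.sum_apply, LinearMap.smul_apply, smul_eq_mul, dotProduct,
    Matrix.mulVec, Finset.mul_sum, comps, Matrix.of_apply]
  rw [Finset.sum_comm]
  refine Finset.sum_congr rfl fun q _ => Finset.sum_congr rfl fun s _ => ?_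
  ring

theorem fibreVec_inr (c : OpenPartialHomeomorph M (Fin m → ℝ)) (x : M) (v : Fin m → ℝ) :
    fibreVec c x (Sum.elim 0 v) = (0, (fibreVec c x (Sum.elim 0 v)).2) :=
  Prod.ext ((chartDiff c x).inverse.map_zero) rfl

/-- A null vector of the full matrix gives a vertical vector in the radical of the metric, and a
null vector of the lower right block gives a covector orthogonal to all of `V₂`. Both must vanish by
the non degeneracy conditions. -/
theorem comps_isRegular (F : DoubleField m M) (hc : c ∈ smoothCharts m M) (hx : x ∈ c.source) :
    IsRegular (comps F.metric c x) where
  smooth q s := by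
    have h1 : ContDiff ℝ ∞ fun u : VVec m => (c x, u) := contDiff_prodMk_right _
    have h2 := (F.smooth_metric c hc q s).comp_contDiff h1 fun u => ⟨c.map_source hx, trivial⟩
    simpa only [Function.comp_def, c.left_inv hx] using h2
  det_ne u h0 := by
    obtain ⟨v, hv, hv0⟩ := Matrix.exists_mulVec_eq_zero_iff.2 h0
    refine hv ?_
    have h1 : fibreVec c x v = 0 := by
      refine (F.nondegenerate ⟨x, fibreVec c x u⟩).2 _ fun Z => ?_
      have := dotProduct_comps F.metric c x u (fibreCoord c x Z) v
      rw [hv0, dotProduct_zero, fibreVec_fibreCoord hc hx] at this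
      exact this.symm
    have h2 := fibreCoord_fibreVec hc hx v
    rw [h1] at h2
    rw [← h2]
    funext q
    rcases q with i | i <;> simp [fibreCoord]
  det_block_ne u h0 := by
    obtain ⟨v, hv, hv0⟩ := Matrix.exists_mulVec_eq_zero_iff.2 h0
    refine hv ?_
    have h1 : (fibreVec c x (Sum.elim 0 v)).2 = 0 := by
      refine F.strong ⟨x, fibreVec c x u⟩ _ fun β => ?_
      rw [F.symm]
      have h2 := dotProduct_comps F.metric c x u (fibreCoord c x (0, β)) (Sum.elim 0 v)
      have h3 : fibreCoord c x (0, β) =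
          Sum.elim (0 : Fin m → ℝ) (fun i => β ((chartDiff c x).inverse (Pi.single i 1))) := by
        funext q
        rcases q with i | i <;> simp [fibreCoord]
      rw [fibreVec_fibreCoord hc hx, fibreVec_inr] at h2
      refine h2.symm.trans ?_
      rw [h3, ← Matrix.fromBlocks_toBlocks (comps F.metric c x u), Matrix.fromBlocks_mulVec,
        Sum.elim_comp_inl, Sum.elim_comp_inr, hv0, sumElim_dotProduct_sumElim]
      simp
    have h2 := fibreCoord_fibreVec hc hx (Sum.elim 0 v)
    rw [fibreVec_inr, h1] at h2
    funext i
    have h3 := congrFun h2 (Sum.inr i)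
    simpa [fibreCoord] using h3.symm

theorem frameChange (F : DoubleField m M) (hc : c ∈ smoothCharts m M)
    (hc' : c' ∈ smoothCharts m M) (hx : x ∈ c.source) (hx' : x ∈ c'.source) :
    FrameChange (comps F.metric c x) (comps F.metric c' x) (jacMatrix c c' x)
      (jacMatrix c' c x).transpose where
  regular := comps_isRegular F hc hx
  regular' := comps_isRegular F hc' hx'
  transpose_mul := by rw [Matrix.transpose_transpose, jacMatrix_mul hc' hc hx' hx]
  metric_eq u := by
    have h1 (v w : VVec m) : v ⬝ᵥ (comps F.metric c x u).mulVec w = v ⬝ᵥ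
        ((fibreJac c c' x).transpose * comps F.metric c' x ((fibreJac c c' x).mulVec u) *
          fibreJac c c' x).mulVec w := by
      rw [← Matrix.mulVec_mulVec, ← Matrix.mulVec_mulVec,
        Matrix.dotProduct_mulVec v (fibreJac c c' x).transpose,
        Matrix.vecMul_transpose, dotProduct_comps, dotProduct_comps]
      rw [fibreVec_change hc hc' hx hx' v, fibreVec_change hc hc' hx hx' w]
      exact congrArg (fun V : BigFiber (m := m) x =>
        F.metric ⟨x, V⟩ (fibreVec c x v) (fibreVec c x w)) (fibreVec_change hc hc' hx hx' u).symm
    refine Matrix.ext fun q s => ?_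
    have h2 := h1 (Pi.single q 1) (Pi.single s 1)
    simpa using h2

/-! ### The scalar curvature and `det σ` under a change of chart. -/

namespace DoubleField

variable (F : DoubleField m M)

theorem scalar_eq_deformedScalar_unitVec (hc : c ∈ smoothCharts m M) {p : BigTan m M}
    (hp : p.proj ∈ c.source)
    (b : Module.Basis (VIdx m) ℝ (BigFiber (m := m) p.proj)) :
    F.scalar c p b =
      deformedScalar (comps F.metric c p.proj) unitVec (fibreCoord c p.proj p.snd) := by
  refine (comps_isRegular F hc hp).deformedScalar_eq_basis _ ?_
  -- A vanishing combination of the rows of components would be a linear dependence among the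
  -- vectors of `b`.
  by_contra h
  rw [isUnit_iff_ne_zero, not_not, ← Matrix.exists_vecMul_eq_zero_iff] at h
  obtain ⟨v, hv, hv0⟩ := h
  refine hv ?_
  have h1 : ∑ q, v q • b q = 0 := by
    have h2 : ∑ q, v q • fibreCoord c p.proj (b q) = 0 := by
      rw [← hv0]
      funext s
      simp [Matrix.vecMul, dotProduct, Finset.sum_apply]
    have h3 := congrArg (fibreVecLin c p.proj) h2
    rw [map_sum, map_zero] at h3
    rw [← h3]
    refine Finset.sum_congr rfl fun q _ => ?_
    rw [map_smul]
    congr 1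
    exact (fibreVec_fibreCoord hc hp (b q)).symm
  funext q
  exact Fintype.linearIndependent_iff.1 b.linearIndependent v h1 q

theorem natScalar_eq_deformedScalar (hc : c ∈ smoothCharts m M) {p : BigTan m M}
    (hp : p.proj ∈ c.source) : F.natScalar c p =
      deformedScalar (comps F.metric c p.proj) unitVec (fibreCoord c p.proj p.snd) := by
  rw [natScalar, scalar]
  congr 1
  funext q
  rw [fibreCoord_fibreVec hc hp]

/-- Naturality carries the unit basis of `c` to the columns of `T`, not to the unit basis of `c'`;
independence of the basis closes the gap. -/
theorem deformedScalar_unitVec_congr (hc : c ∈ smoothCharts m M) (hc' : c' ∈ smoothCharts m M)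
    {p : BigTan m M} (hp : p.proj ∈ c.source) (hp' : p.proj ∈ c'.source) :
    deformedScalar (comps F.metric c' p.proj) unitVec (fibreCoord c' p.proj p.snd) =
      deformedScalar (comps F.metric c p.proj) unitVec (fibreCoord c p.proj p.snd) := by
  have h := frameChange F hc hc' hp hp'
  rw [fibreCoord_change (c' := c') hc hp, ← h.deformedScalar_eq unitVec]
  refine ((comps_isRegular F hc' hp').deformedScalar_eq_basis _ ?_).symm
  have h1 : Matrix.of (fun q => (fibreJac c c' p.proj).mulVec (unitVec q)) =
      (fibreJac c c' p.proj).transpose := by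
    ext q s
    simp [unitVec]
  rw [h1, Matrix.det_transpose]
  exact h.isUnit_det_fibreMatrix

theorem scalar_congr (hc : c ∈ smoothCharts m M) (hc' : c' ∈ smoothCharts m M)
    {p : BigTan m M} (hp : p.proj ∈ c.source) (hp' : p.proj ∈ c'.source)
    (b b' : Module.Basis (VIdx m) ℝ (BigFiber (m := m) p.proj)) :
    F.scalar c p b = F.scalar c' p b' := by
  rw [F.scalar_eq_deformedScalar_unitVec hc hp, F.scalar_eq_deformedScalar_unitVec hc' hp',
    F.deformedScalar_unitVec_congr hc hc' hp hp']

theorem natScalar_congr (hc : c ∈ smoothCharts m M) (hc' : c' ∈ smoothCharts m M)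
    {p : BigTan m M} (hp : p.proj ∈ c.source) (hp' : p.proj ∈ c'.source) :
    F.natScalar c p = F.natScalar c' p := by
  rw [F.natScalar_eq_deformedScalar hc hp, F.natScalar_eq_deformedScalar hc' hp',
    F.deformedScalar_unitVec_congr hc hc' hp hp']

theorem detSigma_ne_zero (hc : c ∈ smoothCharts m M) {p : BigTan m M} (hp : p.proj ∈ c.source) :
    F.detSigma c p ≠ 0 := (comps_isRegular F hc hp).det_sigma_ne _

/-- From `σ = Jᵀ σ' J`, the determinants of `σ` and `σ'` differ by the square of `det J`. -/
theorem sqrt_detSigma_change (hc : c ∈ smoothCharts m M) (hc' : c' ∈ smoothCharts m M)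
    {p : BigTan m M} (hp : p.proj ∈ c.source) (hp' : p.proj ∈ c'.source) :
    √|F.detSigma c p| = |(jac c c' p.proj).det| * √|F.detSigma c' p| := by
  have h := (frameChange F hc hc' hp hp').sigma_rel (fibreCoord c p.proj p.snd)
  rw [← fibreCoord_change (c' := c') hc hp] at h
  rw [detSigma, detSigma, h, Matrix.det_mul, Matrix.det_mul, Matrix.det_transpose, det_jacMatrix,
    mul_right_comm, abs_mul, Real.sqrt_mul (abs_nonneg _), abs_mul,
    Real.sqrt_mul_self (abs_nonneg _)]

end DoubleField

end Components

section Volume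

variable {m : ℕ} {M : Type*} [TopologicalSpace M] [ChartedSpace (Fin m → ℝ) M]
  [IsManifold 𝓘(ℝ, Fin m → ℝ) ∞ M]
  {c c' : OpenPartialHomeomorph M (Fin m → ℝ)}

/-! ### Change of natural coordinates and the volume form -/

/-- The change of natural coordinates from those of `c` to those of `c'`. -/
def transition (c c' : OpenPartialHomeomorph M (Fin m → ℝ)) (a : (Fin m → ℝ) × VVec m) :
    (Fin m → ℝ) × VVec m := natChart c' (natParam c a)

theorem transition_hasFDerivAt (hc : c ∈ smoothCharts m M) (hc' : c' ∈ smoothCharts m M)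
    {a : (Fin m → ℝ) × VVec m} (ha : a.1 ∈ c.target) (ha' : c.symm a.1 ∈ c'.source) :
    HasFDerivAt (transition c c') ((natDiff c' (natParam c a)).comp
      (mfderiv 𝓘(ℝ, (Fin m → ℝ) × VVec m) (BigModel m) (natParam c) a) :
        (Fin m → ℝ) × VVec m →L[ℝ] (Fin m → ℝ) × VVec m) a := by
  have h1 := (mdifferentiableAt_natParam hc ha).hasMFDerivAt
  have h2 := (mdifferentiableAt_natChart hc' (p := natParam c a) ha').hasMFDerivAt
  exact (h2.comp a h1).hasFDerivAt

theorem mdifferentiableAt_proj (p : BigTan m M) :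
    MDifferentiableAt (BigModel m) 𝓘(ℝ, Fin m → ℝ) (fun q : BigTan m M => q.proj) p :=
  ((contMDiff_proj (IB := 𝓘(ℝ, Fin m → ℝ)) (n := ∞)
    ((TangentSpace 𝓘(ℝ, Fin m → ℝ) : M → Type _) ×ᵇ
      fun x : M => TangentSpace 𝓘(ℝ, Fin m → ℝ) x →L[ℝ] Bundle.Trivial M ℝ x)) p).mdifferentiableAt
    (by simp)

theorem natDiff_fst (hc : c ∈ smoothCharts m M) {p : BigTan m M} (hp : p.proj ∈ c.source)
    (v : TangentSpace (BigModel m) p) :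
    (natDiff c p v).1 = chartDiff c p.proj
      (mfderiv (BigModel m) 𝓘(ℝ, Fin m → ℝ) (fun q : BigTan m M => q.proj) p v) := by
  have h1 := (mdifferentiableAt_natChart hc hp).hasMFDerivAt
  have h2 : HasMFDerivAt 𝓘(ℝ, (Fin m → ℝ) × VVec m) 𝓘(ℝ, Fin m → ℝ) Prod.fst (natChart c p)
    (ContinuousLinearMap.fst ℝ (Fin m → ℝ) (VVec m)) := hasFDerivAt_fst.hasMFDerivAt
  have h3 := ((mdifferentiable_of_mem_smoothCharts hc).mdifferentiableAt hp).hasMFDerivAt.comp p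
    (mdifferentiableAt_proj p).hasMFDerivAt
  have h4 := hasMFDerivAt_unique (h2.comp p h1) h3
  exact congrArg (fun L => L v) h4

theorem mem_vertical_iff (hc : c ∈ smoothCharts m M) {p : BigTan m M} (hp : p.proj ∈ c.source)
    (v : TangentSpace (BigModel m) p) : v ∈ vertical p ↔ (natDiff c p v).1 = 0 := by
  rw [natDiff_fst hc hp]
  refine ⟨fun h => ?_, fun h => ?_⟩
  · have h' : mfderiv (BigModel m) 𝓘(ℝ, Fin m → ℝ) (fun q : BigTan m M => q.proj) p v = 0 := h
    rw [h']
    exact map_zero _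
  · have h' := (chartDiff_isInvertible hc hp).injective (h.trans (map_zero _).symm)
    exact h'

theorem natDiff_fst_change (hc : c ∈ smoothCharts m M) (hc' : c' ∈ smoothCharts m M)
    {p : BigTan m M} (hp : p.proj ∈ c.source) (hp' : p.proj ∈ c'.source)
    (v : TangentSpace (BigModel m) p) :
    (natDiff c' p v).1 = jac c c' p.proj (natDiff c p v).1 := by
  rw [natDiff_fst hc hp, natDiff_fst hc' hp', ← jac_comp_chartDiff (c' := c') hc hp]
  rfl

theorem natDiff_change (hc : c ∈ smoothCharts m M) (hc' : c' ∈ smoothCharts m M)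
    {p : BigTan m M} (hp : p.proj ∈ c.source) (hp' : p.proj ∈ c'.source)
    (v : TangentSpace (BigModel m) p) :
    natDiff c' p v = fderiv ℝ (transition c c') (natChart c p) (natDiff c p v) := by
  have ha' : c.symm (natChart c p).1 ∈ c'.source := by
    change c.symm (c p.proj) ∈ c'.source
    rwa [c.left_inv hp]
  have h1 := (transition_hasFDerivAt hc hc' (c.map_source hp) ha').differentiableAt.hasFDerivAt
  have h2 := h1.hasMFDerivAt.comp p (mdifferentiableAt_natChart hc hp).hasMFDerivAt
  have h3 : natChart c' =ᶠ[nhds p] transition c c' ∘ natChart c := by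
    filter_upwards [(isOpen_proj_preimage c.open_source).mem_nhds hp] with q hq
    rw [Function.comp, transition, natParam_natChart hc hq]
  have h4 := h2.congr_of_eventuallyEq h3
  exact congrArg (fun L => L v) h4.mfderiv

theorem natChart_natParam_change (hc : c ∈ smoothCharts m M) {a : (Fin m → ℝ) × VVec m}
    (ha : a.1 ∈ c.target) : transition c c' a =
      (c' (c.symm a.1), (fibreJac c c' (c.symm a.1)).mulVec a.2) := by
  refine Prod.ext rfl ?_
  change fibreCoord c' (c.symm a.1) (fibreVec c (c.symm a.1) a.2) = _
  rw [fibreCoord_change (c' := c') hc (c.map_target ha), fibreCoord_fibreVec hc (c.map_target ha)]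

/-- With the base point held fixed, the transition map is linear in the fibre coordinates. -/
theorem fderiv_transition_vertical (hc : c ∈ smoothCharts m M) (hc' : c' ∈ smoothCharts m M)
    {a : (Fin m → ℝ) × VVec m} (ha : a.1 ∈ c.target) (ha' : c.symm a.1 ∈ c'.source) (w : VVec m) :
    fderiv ℝ (transition c c') a (0, w) = (0, (fibreJac c c' (c.symm a.1)).mulVec w) := by
  have h1 := (transition_hasFDerivAt hc hc' ha ha').differentiableAt.hasFDerivAt
  have h2 : HasFDerivAt (fun u : VVec m => (a.1, u)) (ContinuousLinearMap.inr ℝ (Fin m → ℝ) (VVec m))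
    a.2 := hasFDerivAt_prodMk_right a.1 a.2
  have h3 := h1.comp a.2 h2
  have h4 : transition c c' ∘ (fun u : VVec m => (a.1, u)) = fun u : VVec m =>
      (c' (c.symm a.1), (fibreJac c c' (c.symm a.1)).mulVecLin.toContinuousLinearMap u) :=
    funext fun u => natChart_natParam_change hc (a := (a.1, u)) ha
  have h5 := (hasFDerivAt_const (c' (c.symm a.1)) a.2).prodMk
    ((fibreJac c c' (c.symm a.1)).mulVecLin.toContinuousLinearMap.hasFDerivAt (x := a.2))
  rw [h4] at h3
  exact congrArg (fun L => L w) (h3.unique h5)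

theorem fderiv_transition_fst (hc : c ∈ smoothCharts m M) (hc' : c' ∈ smoothCharts m M)
    {a : (Fin m → ℝ) × VVec m} (ha : a.1 ∈ c.target) (ha' : c.symm a.1 ∈ c'.source)
    (d : (Fin m → ℝ) × VVec m) :
    (fderiv ℝ (transition c c') a d).1 = jac c c' (c.symm a.1) d.1 := by
  have h1 := (transition_hasFDerivAt hc hc' ha ha').differentiableAt.hasFDerivAt.fst
  have h2 : DifferentiableAt ℝ (c' ∘ c.symm) a.1 := by
    have := ((mdifferentiable_of_mem_smoothCharts hc').mdifferentiableAt ha').comp a.1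
      ((mdifferentiable_of_mem_smoothCharts hc).mdifferentiableAt_symm ha)
    exact this.differentiableAt
  have h3 := h2.hasFDerivAt.comp a hasFDerivAt_fst
  have h4 := h1.unique h3
  rw [jac_eq_fderiv hc hc' (c.map_target ha) ha', c.right_inv ha]
  exact congrArg (fun L => L d) h4

/-- The new base coordinates do not depend on the fibre coordinates, so the matrix is block
triangular. The block with derivatives of `fibreJac` along the base does not affect the determinant,
and `fibreJac` itself has determinant 1. -/
theorem det_fderiv_transition (hc : c ∈ smoothCharts m M) (hc' : c' ∈ smoothCharts m M)
    {a : (Fin m → ℝ) × VVec m} (ha : a.1 ∈ c.target) (ha' : c.symm a.1 ∈ c'.source) :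
    (fderiv ℝ (transition c c') a).det = (jac c c' (c.symm a.1)).det := by
  set x := c.symm a.1
  set B := (Pi.basisFun ℝ (Fin m)).prod (Pi.basisFun ℝ (VIdx m)) with hB
  set L := (fderiv ℝ (transition c c') a).toLinearMap
  have h1 (i : Fin m) : B (Sum.inl i) = (Pi.single i 1, 0) := by
    simp [hB, Module.Basis.prod_apply]
  have h2 (q : VIdx m) : B (Sum.inr q) = (0, Pi.single q 1) := by
    simp [hB, Module.Basis.prod_apply]
  have h3 : LinearMap.toMatrix B B L = Matrix.fromBlocks (jacMatrix c c' x) 0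
      (LinearMap.toMatrix B B L).toBlocks₂₁ (fibreJac c c' x) := by
    refine Matrix.ext fun i j => ?_
    rcases i with i | q <;> rcases j with j | s
    · rw [LinearMap.toMatrix_apply, h1, Matrix.fromBlocks_apply₁₁, jacMatrix,
        LinearMap.toMatrix'_apply]
      exact congrFun (fderiv_transition_fst hc hc' ha ha' _) i
    · rw [LinearMap.toMatrix_apply, h2, Matrix.fromBlocks_apply₁₂]
      have := congrFun (fderiv_transition_fst hc hc' ha ha' (0, Pi.single s 1)) i
      rw [map_zero] at this
      exact this
    · rfl
    · rw [LinearMap.toMatrix_apply, h2, Matrix.fromBlocks_apply₂₂]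
      have := congrFun (congrArg Prod.snd
        (fderiv_transition_vertical hc hc' ha ha' (Pi.single s 1))) q
      rw [Matrix.mulVec_single_one] at this
      exact this
  rw [← det_jacMatrix, ContinuousLinearMap.det, ← LinearMap.det_toMatrix B, h3,
    Matrix.det_fromBlocks_zero₁₂, det_fibreJac hc hc' (c.map_target ha) ha', mul_one]

/-! ### The cobasis, the volume form and the coordinate integrand. -/

namespace DoubleField

variable (F : DoubleField m M)

theorem cobasis_inl (c : OpenPartialHomeomorph M (Fin m → ℝ)) (p : BigTan m M)
    (v : TangentSpace (BigModel m) p) (i : Fin m) :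
    F.cobasis c p v (Sum.inl i) = (natDiff c p v).1 i := rfl

theorem cobasis_inr (c : OpenPartialHomeomorph M (Fin m → ℝ)) (p : BigTan m M)
    (v : TangentSpace (BigModel m) p) (q : VIdx m) :
    F.cobasis c p v (Sum.inr q) =
      (natDiff c p (Submodule.projectionOnto _ _ (F.isCompl p) v : TangentSpace (BigModel m) p)).2 q :=
  rfl

/-- `θ` and `κ` see a vector only through its vertical projection, on which the differential of the
transition map acts by `fibreJac`. The mixed block, present for `dy` and `dz`, therefore drops out.
-/
theorem cobasis_change (hc : c ∈ smoothCharts m M) (hc' : c' ∈ smoothCharts m M)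
    {p : BigTan m M} (hp : p.proj ∈ c.source) (hp' : p.proj ∈ c'.source)
    (v : TangentSpace (BigModel m) p) :
    F.cobasis c' p v = (Matrix.fromBlocks (jacMatrix c c' p.proj) 0 0 (fibreJac c c' p.proj)).mulVec
      (F.cobasis c p v) := by
  set w := F.cobasis c p v with hw
  have hl (i : Fin m) : (Matrix.fromBlocks (jacMatrix c c' p.proj) 0 0
      (fibreJac c c' p.proj)).mulVec w (Sum.inl i) =
      (jacMatrix c c' p.proj).mulVec (w ∘ Sum.inl) i := by
    rw [Matrix.fromBlocks_mulVec, Sum.elim_inl, Matrix.zero_mulVec, add_zero]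
  have hr (q : VIdx m) : (Matrix.fromBlocks (jacMatrix c c' p.proj) 0 0
      (fibreJac c c' p.proj)).mulVec w (Sum.inr q) =
      (fibreJac c c' p.proj).mulVec (w ∘ Sum.inr) q := by
    rw [Matrix.fromBlocks_mulVec, Sum.elim_inr, Matrix.zero_mulVec, zero_add]
  funext q
  rcases q with i | q
  · rw [cobasis_inl, natDiff_fst_change hc hc' hp hp', hl, jacMatrix_mulVec]
    rfl
  · have hx : c.symm (natChart c p).1 = p.proj := c.left_inv hp
    have h1 : (natDiff c p (Submodule.projectionOnto _ _ (F.isCompl p) v :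
      TangentSpace (BigModel m) p)).1 = 0 := (mem_vertical_iff hc hp _).1 (Subtype.prop _)
    have h2 := fderiv_transition_vertical hc hc' (a := natChart c p) (c.map_source hp)
      (by rwa [hx]) (natDiff c p (Submodule.projectionOnto _ _ (F.isCompl p) v :
        TangentSpace (BigModel m) p)).2
    rw [← h1, Prod.mk.eta, ← natDiff_change hc hc' hp hp', hx] at h2
    rw [cobasis_inr, hr, h2]
    rfl

theorem volForm_apply (c : OpenPartialHomeomorph M (Fin m → ℝ)) (p : BigTan m M)
    (v : Fin m ⊕ VIdx m → TangentSpace (BigModel m) p) :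
    F.volForm c p v =
      √|F.detSigma c p| * (Matrix.of fun i => F.cobasis c p (v i)).det := rfl

/-- The cobasis contributes `det J` and the density `|det J|`; positivity identifies them. -/
theorem volForm_congr (hc : c ∈ smoothCharts m M) (hc' : c' ∈ smoothCharts m M)
    {p : BigTan m M} (hp : p.proj ∈ c.source) (hp' : p.proj ∈ c'.source)
    (hpos : 0 < (jac c c' p.proj).det) : F.volForm c p = F.volForm c' p := by
  refine AlternatingMap.ext fun v => ?_
  have h1 : (Matrix.of fun i => F.cobasis c' p (v i)) = (Matrix.of fun i => F.cobasis c p (v i)) *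
      (Matrix.fromBlocks (jacMatrix c c' p.proj) 0 0 (fibreJac c c' p.proj)).transpose := by
    ext i j
    rw [Matrix.of_apply, F.cobasis_change hc hc' hp hp', Matrix.mul_apply, Matrix.mulVec]
    exact dotProduct_comm _ _
  rw [volForm_apply, volForm_apply, h1, Matrix.det_mul, Matrix.det_transpose,
    Matrix.det_fromBlocks_zero₂₁, det_fibreJac hc hc' hp hp', det_jacMatrix,
    F.sqrt_detSigma_change hc hc' hp hp', abs_of_pos hpos]
  ring

theorem natDiff_natFrame (hc : c ∈ smoothCharts m M) {a : (Fin m → ℝ) × VVec m}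
    (ha : a.1 ∈ c.target) (d : (Fin m → ℝ) × VVec m) :
    natDiff c (natParam c a)
      (mfderiv 𝓘(ℝ, (Fin m → ℝ) × VVec m) (BigModel m) (natParam c) a d) = d := by
  have h1 := transition_hasFDerivAt hc hc ha (c.map_target ha)
  have h2 : transition c c =ᶠ[nhds a] id := by
    filter_upwards [(c.open_target.preimage continuous_fst).mem_nhds ha] with b hb
    exact natChart_natParam hc hb
  exact congrArg (fun L => L d) (h1.unique ((hasFDerivAt_id a).congr_of_eventuallyEq h2))

/-- The projection along the horizontal bundle fixes the vertical frame vectors, and `dx` kills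
them. The cobasis matrix is thus block triangular with unit diagonal blocks, the horizontal bundle
entering only off the diagonal. -/
theorem volForm_natFrame (hc : c ∈ smoothCharts m M) {a : (Fin m → ℝ) × VVec m}
    (ha : a.1 ∈ c.target) :
    F.volForm c (natParam c a) (natFrame c a) = √|F.detSigma c (natParam c a)| := by
  have hp : (natParam c a).proj ∈ c.source := c.map_target ha
  set R := Matrix.of fun i => F.cobasis c (natParam c a) (natFrame c a i)
  have h : R = Matrix.fromBlocks 1 R.toBlocks₁₂ 0 1 := by
    refine Matrix.ext fun i j => ?_
    have hv (q : VIdx m) : natDiff c (natParam c a) (natFrame c a (Sum.inr q)) = (0, unitVec q) :=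
      natDiff_natFrame hc ha _
    rcases i with i | q <;> rcases j with j | s
    · change (natDiff c (natParam c a) (natFrame c a (Sum.inl i))).1 j = _
      have : natDiff c (natParam c a) (natFrame c a (Sum.inl i)) = (Pi.single i 1, 0) :=
        natDiff_natFrame hc ha _
      rw [this, Matrix.fromBlocks_apply₁₁]
      simp [Matrix.one_apply, Pi.single_apply, eq_comm]
    · rfl
    · change (natDiff c (natParam c a) (natFrame c a (Sum.inr q))).1 j = _
      rw [hv]
      rfl
    · change F.cobasis c (natParam c a) (natFrame c a (Sum.inr q)) (Sum.inr s) = _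
      have hmem : natFrame c a (Sum.inr q) ∈ vertical (natParam c a) := by
        rw [mem_vertical_iff hc hp, hv]
      have hproj := Submodule.projectionOnto_apply_left (F.isCompl (natParam c a)) ⟨_, hmem⟩
      rw [cobasis_inr, hproj, hv, Matrix.fromBlocks_apply₂₂]
      simp [unitVec, Matrix.one_apply, Pi.single_apply, eq_comm]
  rw [volForm_apply]
  change _ * R.det = _
  rw [h, Matrix.det_fromBlocks_zero₂₁]
  simp

theorem volForm_ne_zero (hc : c ∈ smoothCharts m M) {p : BigTan m M} (hp : p.proj ∈ c.source) :
    F.volForm c p ≠ 0 := by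
  have key {a : (Fin m → ℝ) × VVec m} (ha : a.1 ∈ c.target) : F.volForm c (natParam c a) ≠ 0 := by
    intro h
    have h1 := F.volForm_natFrame hc ha
    rw [h, AlternatingMap.zero_apply] at h1
    exact (Real.sqrt_pos.2 (abs_pos.2 (F.detSigma_ne_zero hc (c.map_target ha)))).ne h1
  have := key (a := natChart c p) (c.map_source hp)
  rwa [natParam_natChart hc hp] at this

theorem integrand_eq (φ : BigTan m M → ℝ) (hc : c ∈ smoothCharts m M)
    {a : (Fin m → ℝ) × VVec m} (ha : a.1 ∈ c.target) :
    F.integrand φ c a = Real.exp (-2 * φ (natParam c a)) * F.natScalar c (natParam c a)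
      * √|F.detSigma c (natParam c a)| := by
  rw [integrand, F.volForm_natFrame hc ha]

theorem natParam_transition (hc' : c' ∈ smoothCharts m M) {a : (Fin m → ℝ) × VVec m}
    (ha' : c.symm a.1 ∈ c'.source) : natParam c' (transition c c' a) = natParam c a :=
  natParam_natChart hc' (p := natParam c a) ha'

/-- The exponential and the curvature are functions on the total space, and `√|det σ|` supplies
exactly the Jacobian factor of the transition map. Only absolute values occur, so the orientation
plays no role here. -/
theorem integrand_change (φ : BigTan m M → ℝ) (hc : c ∈ smoothCharts m M)
    (hc' : c' ∈ smoothCharts m M) {a : (Fin m → ℝ) × VVec m} (ha : a.1 ∈ c.target)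
    (ha' : c.symm a.1 ∈ c'.source) :
    F.integrand φ c a =
      |(fderiv ℝ (transition c c') a).det| * F.integrand φ c' (transition c c' a) := by
  have hp : (natParam c a).proj ∈ c.source := c.map_target ha
  have hp' : (natParam c a).proj ∈ c'.source := ha'
  have ht : (transition c c' a).1 ∈ c'.target := c'.map_source ha'
  rw [F.integrand_eq φ hc ha, F.integrand_eq φ hc' ht, natParam_transition hc' ha',
    F.natScalar_congr hc hc' hp hp', F.sqrt_detSigma_change hc hc' hp hp',
    det_fderiv_transition hc hc' ha ha']
  simp only [natParam]
  ring

end DoubleField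

end Volume

section Integration

/-! ### Independence of the decomposition -/

/-- Two families of functions that have equal integrals on the pieces of a common refinement of two
families of sets have equal total integrals. -/
theorem summable_integral_refinement {E : Type*} [MeasurableSpace E] {μ : Measure E}
    {f f' : ℕ → E → ℝ} {s t : ℕ → ℕ → Set E}
    (hs : ∀ n k, MeasurableSet (s n k)) (ht : ∀ n k, MeasurableSet (t n k))
    (hsd : ∀ n, Pairwise (Function.onFun Disjoint (s n)))
    (htd : ∀ k, Pairwise (Function.onFun Disjoint fun n => t n k))
    (hint : ∀ n k, IntegrableOn (f n) (s n k) μ → IntegrableOn (f' k) (t n k) μ)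
    (heq : ∀ n k, ∫ a in s n k, f n a ∂μ = ∫ a in t n k, f' k a ∂μ)
    (heq' : ∀ n k, ∫ a in s n k, |f n a| ∂μ = ∫ a in t n k, |f' k a| ∂μ)
    (h1 : ∀ n, IntegrableOn (f n) (⋃ k, s n k) μ)
    (h2 : Summable fun n => ∫ a in ⋃ k, s n k, |f n a| ∂μ) :
    ((∀ k, IntegrableOn (f' k) (⋃ n, t n k) μ) ∧
      Summable fun k => ∫ a in ⋃ n, t n k, |f' k a| ∂μ) ∧
    ∑' k, ∫ a in ⋃ n, t n k, f' k a ∂μ = ∑' n, ∫ a in ⋃ k, s n k, f n a ∂μ := by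
  have hA (n : ℕ) := hasSum_integral_iUnion (hs n) (hsd n) (h1 n).abs
  -- The absolute integrals over the pieces of the refinement form a nonnegative double series whose
  -- row sums are the given summable integrals. It may be summed by columns instead, which yields
  -- finiteness for the other family.
  have hS : Summable fun x : ℕ × ℕ => ∫ a in s x.1 x.2, |f x.1 a| ∂μ := by
    refine (summable_prod_of_nonneg fun x => integral_nonneg fun a => abs_nonneg _).2
      ⟨fun n => (hA n).summable, ?_⟩
    simpa only [(hA _).tsum_eq] using h2
  have hS' : Summable fun x : ℕ × ℕ => ∫ a in t x.2 x.1, |f' x.1 a| ∂μ := by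
    have := (Equiv.prodComm ℕ ℕ).summable_iff.2 hS
    simpa only [Function.comp_def, Equiv.prodComm_apply, Prod.fst_swap, Prod.snd_swap, heq']
      using this
  obtain ⟨h3, h4⟩ := (summable_prod_of_nonneg fun x => integral_nonneg fun a => abs_nonneg _).1 hS'
  have hI (n k : ℕ) : IntegrableOn (f' k) (t n k) μ :=
    hint n k ((h1 n).mono_set (Set.subset_iUnion _ k))
  have h5 (k : ℕ) : IntegrableOn (f' k) (⋃ n, t n k) μ :=
    integrableOn_iUnion_of_summable_integral_norm (fun n => hI n k)
      (by simpa only [Real.norm_eq_abs] using h3 k)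
  have hA' (k : ℕ) := hasSum_integral_iUnion (fun n => ht n k) (htd k) (h5 k).abs
  refine ⟨⟨h5, by simpa only [(hA' _).tsum_eq] using h4⟩, ?_⟩
  -- Domination by the absolute integrals permits the exchange of the two sums of signed integrals.
  have hT : Summable (Function.uncurry fun n k => ∫ a in s n k, f n a ∂μ) :=
    Summable.of_norm_bounded hS fun x => norm_integral_le_integral_norm _
  have e1 (n : ℕ) : ∫ a in ⋃ k, s n k, f n a ∂μ = ∑' k, ∫ a in s n k, f n a ∂μ :=
    (hasSum_integral_iUnion (hs n) (hsd n) (h1 n)).tsum_eq.symm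
  have e2 (k : ℕ) : ∫ a in ⋃ n, t n k, f' k a ∂μ = ∑' n, ∫ a in s n k, f n a ∂μ := by
    rw [← (hasSum_integral_iUnion (fun n => ht n k) (htd k) (h5 k)).tsum_eq]
    simp only [heq]
  simp only [e1, e2]
  exact hT.tsum_comm

variable {m : ℕ} {M : Type*} [TopologicalSpace M] [ChartedSpace (Fin m → ℝ) M]
  [IsManifold 𝓘(ℝ, Fin m → ℝ) ∞ M]
  {c c' : OpenPartialHomeomorph M (Fin m → ℝ)}

theorem injOn_natChart (hc : c ∈ smoothCharts m M) :
    Set.InjOn (natChart c) {p : BigTan m M | p.proj ∈ c.source} := fun p hp q hq h => by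
  rw [← natParam_natChart hc hp, h, natParam_natChart hc hq]

theorem natChart_image_eq (hc : c ∈ smoothCharts m M) {P : Set (BigTan m M)}
    (hP : ∀ p ∈ P, p.proj ∈ c.source) :
    natChart c '' P = {a | a.1 ∈ c.target ∧ natParam c a ∈ P} := by
  ext a
  constructor
  · rintro ⟨p, hp, rfl⟩
    refine ⟨c.map_source (hP p hp), ?_⟩
    rwa [natParam_natChart hc (hP p hp)]
  · rintro ⟨ha, ha'⟩
    exact ⟨_, ha', natChart_natParam hc ha⟩

/-- The image is the part of an open set that the map `natParam c`, continuous there, sends into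
`P`. -/
theorem measurableSet_natChart_image (hc : c ∈ smoothCharts m M) {P : Set (BigTan m M)}
    (hPm : MeasurableSet[borel (BigTan m M)] P) (hP : ∀ p ∈ P, p.proj ∈ c.source) :
    MeasurableSet (natChart c '' P) := by
  borelize (BigTan m M)
  set S : Set ((Fin m → ℝ) × VVec m) := {a | a.1 ∈ c.target}
  have hS : MeasurableSet S := (c.open_target.preimage continuous_fst).measurableSet
  have hcont : ContinuousOn (natParam c) S := fun a ha =>
    (contMDiffAt_natParam hc ha).continuousAt.continuousWithinAt
  have h1 : MeasurableSet (S.domRestrict (natParam c) ⁻¹' P) :=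
    (continuousOn_iff_continuous_domRestrict.1 hcont).measurable hPm
  have h2 := hS.subtype_image h1
  rw [natChart_image_eq hc hP]
  convert h2 using 1
  ext a
  constructor
  · rintro ⟨ha, ha'⟩
    exact ⟨⟨a, ha⟩, ha', rfl⟩
  · rintro ⟨⟨b, hb⟩, hb', rfl⟩
    exact ⟨hb, hb'⟩

theorem disjoint_natChart_image (hc : c ∈ smoothCharts m M) {P Q : Set (BigTan m M)}
    (hP : ∀ p ∈ P, p.proj ∈ c.source) (hQ : ∀ p ∈ Q, p.proj ∈ c.source) (h : Disjoint P Q) :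
    Disjoint (natChart c '' P) (natChart c '' Q) := by
  rw [Set.disjoint_left]
  rintro _ ⟨p, hp, rfl⟩ ⟨q, hq, hqp⟩
  rw [injOn_natChart hc (hQ q hq) (hP p hp) hqp] at hq
  exact Set.disjoint_left.1 h hp hq

namespace DoubleField

variable (F : DoubleField m M) (φ : BigTan m M → ℝ)

theorem natChart_image_transition (hc : c ∈ smoothCharts m M) {P : Set (BigTan m M)}
    (hP : ∀ p ∈ P, p.proj ∈ c.source) :
    natChart c' '' P = transition c c' '' (natChart c '' P) := by
  rw [Set.image_image]
  refine Set.image_congr fun p hp => ?_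
  rw [transition, natParam_natChart hc (hP p hp)]

/-- The transition map is injective and differentiable on the image of `P`, and `integrand_change`
supplies its Jacobian. The statement for absolute values serves the summability of the pieces. -/
theorem integrand_change_of_variables (hc : c ∈ smoothCharts m M) (hc' : c' ∈ smoothCharts m M)
    {P : Set (BigTan m M)} (hPm : MeasurableSet[borel (BigTan m M)] P)
    (hP : ∀ p ∈ P, p.proj ∈ c.source) (hP' : ∀ p ∈ P, p.proj ∈ c'.source) :
    (IntegrableOn (F.integrand φ c) (natChart c '' P) →
      IntegrableOn (F.integrand φ c') (natChart c' '' P)) ∧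
    (∫ a in natChart c '' P, F.integrand φ c a = ∫ a in natChart c' '' P, F.integrand φ c' a) ∧
    (∫ a in natChart c '' P, |F.integrand φ c a| =
      ∫ a in natChart c' '' P, |F.integrand φ c' a|) := by
  have : (volume : Measure ((Fin m → ℝ) × VVec m)).IsAddHaarMeasure :=
    Measure.prod.instIsAddHaarMeasure volume volume
  have hm := measurableSet_natChart_image hc hPm hP
  have hmem : ∀ a ∈ natChart c '' P, a.1 ∈ c.target ∧ c.symm a.1 ∈ c'.source := by
    rintro _ ⟨p, hp, rfl⟩
    refine ⟨c.map_source (hP p hp), ?_⟩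
    change c.symm (c p.proj) ∈ _
    rw [c.left_inv (hP p hp)]
    exact hP' p hp
  have hd : ∀ a ∈ natChart c '' P, HasFDerivWithinAt (transition c c')
      (fderiv ℝ (transition c c') a) (natChart c '' P) a := fun a ha =>
    (transition_hasFDerivAt hc hc' (hmem a ha).1
      (hmem a ha).2).differentiableAt.hasFDerivAt.hasFDerivWithinAt
  have hinj : Set.InjOn (transition c c') (natChart c '' P) := by
    rintro _ ⟨p, hp, rfl⟩ _ ⟨q, hq, rfl⟩ h
    rw [transition, transition, natParam_natChart hc (hP p hp),
      natParam_natChart hc (hP q hq)] at h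
    rw [injOn_natChart hc' (hP' p hp) (hP' q hq) h]
  have hEq : Set.EqOn (F.integrand φ c) (fun a => |(fderiv ℝ (transition c c') a).det| •
      F.integrand φ c' (transition c c' a)) (natChart c '' P) := fun a ha =>
    F.integrand_change φ hc hc' (hmem a ha).1 (hmem a ha).2
  rw [natChart_image_transition (c' := c') hc hP]
  refine ⟨fun h => ?_, ?_, ?_⟩
  · rw [integrableOn_image_iff_integrableOn_abs_det_fderiv_smul volume hm hd hinj]
    exact h.congr_fun hEq hm
  · rw [integral_image_eq_integral_abs_det_fderiv_smul volume hm hd hinj]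
    exact setIntegral_congr_fun hm hEq
  · rw [integral_image_eq_integral_abs_det_fderiv_smul volume hm hd hinj]
    refine setIntegral_congr_fun hm fun a ha => ?_
    have := congrArg abs (hEq ha)
    simpa only [smul_eq_mul, abs_mul, abs_abs] using this

variable {O : Orientation m M}

/-- The intersections of the pieces refine both decompositions, and each intersection lies in the
domains of both charts, where the integrals agree by change of variables. -/
theorem action_congr (d d' : Decomposition O) (h : F.FiniteAction φ d) :
    F.FiniteAction φ d' ∧ F.action φ d' = F.action φ d := by
  borelize (BigTan m M)
  have hc (n : ℕ) := O.subset (d.chart_mem n)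
  have hc' (n : ℕ) := O.subset (d'.chart_mem n)
  set P : ℕ → ℕ → Set (BigTan m M) := fun n k => d.piece n ∩ d'.piece k with hPdef
  have hm (n k : ℕ) : MeasurableSet (P n k) := (d.measurable n).inter (d'.measurable k)
  have hP (n k : ℕ) : ∀ p ∈ P n k, p.proj ∈ (d.chart n).source := fun p hp =>
    d.piece_subset n p hp.1
  have hP' (n k : ℕ) : ∀ p ∈ P n k, p.proj ∈ (d'.chart k).source := fun p hp =>
    d'.piece_subset k p hp.2
  have hU (n : ℕ) : natChart (d.chart n) '' d.piece n = ⋃ k, natChart (d.chart n) '' P n k := by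
    rw [← Set.image_iUnion, ← Set.inter_iUnion, d'.iUnion, Set.inter_univ]
  have hU' (k : ℕ) : natChart (d'.chart k) '' d'.piece k =
      ⋃ n, natChart (d'.chart k) '' P n k := by
    rw [← Set.image_iUnion, ← Set.iUnion_inter, d.iUnion, Set.univ_inter]
  have hcv (n k : ℕ) := F.integrand_change_of_variables φ (hc n) (hc' k) (hm n k) (hP n k) (hP' n k)
  have key := summable_integral_refinement (μ := volume)
    (f := fun n => F.integrand φ (d.chart n)) (f' := fun k => F.integrand φ (d'.chart k))
    (s := fun n k => natChart (d.chart n) '' P n k) (t := fun n k => natChart (d'.chart k) '' P n k)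
    (fun n k => measurableSet_natChart_image (hc n) (hm n k) (hP n k))
    (fun n k => measurableSet_natChart_image (hc' k) (hm n k) (hP' n k))
    (fun n k l hkl => disjoint_natChart_image (hc n) (hP n k) (hP n l)
      ((d'.disjoint hkl).mono Set.inter_subset_right Set.inter_subset_right))
    (fun k n l hnl => disjoint_natChart_image (hc' k) (hP' n k) (hP' l k)
      ((d.disjoint hnl).mono Set.inter_subset_left Set.inter_subset_left))
    (fun n k => (hcv n k).1) (fun n k => (hcv n k).2.1) (fun n k => (hcv n k).2.2)
  simp only [← hU, ← hU'] at key
  exact key h.1 h.2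

end DoubleField

theorem exists_decomposition [Nonempty M] [SecondCountableTopology M] (O : Orientation m M) :
    Nonempty (Decomposition O) := by
  borelize (BigTan m M)
  choose c hcO hc using O.cover
  obtain ⟨t, ht, hU⟩ := TopologicalSpace.countable_cover_nhds
    fun x => (c x).open_source.mem_nhds (hc x)
  -- `M` is non-empty, hence so is the countable index set of the cover, and it can be enumerated by
  -- `ℕ`, possibly with repetitions; `disjointed` turns repeated domains into empty pieces.
  have hne : t.Nonempty := by
    by_contra h
    rw [Set.not_nonempty_iff_eq_empty] at h
    subst h
    simp only [Set.biUnion_empty] at hU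
    exact Set.empty_ne_univ hU
  obtain ⟨e, rfl⟩ := ht.exists_eq_range hne
  set U : ℕ → Set (BigTan m M) := fun n => {p | p.proj ∈ (c (e n)).source}
  refine ⟨⟨fun n => c (e n), fun n => hcO _, disjointed U, fun n => ?_, fun n p hp => ?_,
    disjoint_disjointed U, ?_⟩⟩
  · exact MeasurableSet.disjointed
      (fun n => (isOpen_proj_preimage (c (e n)).open_source).measurableSet) n
  · exact disjointed_subset U n hp
  · rw [iUnion_disjointed]
    refine Set.eq_univ_of_forall fun p => ?_
    have : p.proj ∈ ⋃ x ∈ Set.range e, (c x).source := hU ▸ Set.mem_univ _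
    simpa [U] using this

end Integration

section Diffeomorphism

/-! ### Invariance under diffeomorphisms -/

variable {m : ℕ} {M : Type*} [TopologicalSpace M] [ChartedSpace (Fin m → ℝ) M]
  [IsManifold 𝓘(ℝ, Fin m → ℝ) ∞ M]
  {N : Type*} [TopologicalSpace N] [ChartedSpace (Fin m → ℝ) N] [IsManifold 𝓘(ℝ, Fin m → ℝ) ∞ N]
  (f : M ≃ₘ^∞⟮𝓘(ℝ, Fin m → ℝ), 𝓘(ℝ, Fin m → ℝ)⟯ N)
  {c : OpenPartialHomeomorph N (Fin m → ℝ)}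

/-- The chart `c ∘ f`. -/
abbrev pullChart (c : OpenPartialHomeomorph N (Fin m → ℝ)) : OpenPartialHomeomorph M (Fin m → ℝ) :=
  f.toHomeomorph.toOpenPartialHomeomorph.trans c

theorem mem_pullChart_source {x : M} : x ∈ (pullChart f c).source ↔ f x ∈ c.source := by
  simp

theorem mem_pullChart_target {a : Fin m → ℝ} : a ∈ (pullChart f c).target ↔ a ∈ c.target := by
  simp

theorem chartDiff_pullChart (hc : c ∈ smoothCharts m N) {x : M} (hx : f x ∈ c.source) :
    chartDiff (pullChart f c) x = (chartDiff c (f x)).comp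
      (mfderiv 𝓘(ℝ, Fin m → ℝ) 𝓘(ℝ, Fin m → ℝ) f x) :=
  mfderiv_comp x ((mdifferentiable_of_mem_smoothCharts hc).mdifferentiableAt hx)
    (f.mdifferentiable (by simp) x)

theorem mfderiv_isInvertible (x : M) :
    (mfderiv 𝓘(ℝ, Fin m → ℝ) 𝓘(ℝ, Fin m → ℝ) f x).IsInvertible :=
  ⟨f.mfderivToContinuousLinearEquiv (by simp) x, rfl⟩

/-- In the charts `c ∘ f` and `c` the lift is the identity on components, since the differential of
`f` cancels against its inverse. -/
theorem liftFibre_fibreVec (hc : c ∈ smoothCharts m N) {x : M} (hx : f x ∈ c.source)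
    (w : VVec m) : liftFibre f x (fibreVec (pullChart f c) x w) = fibreVec c (f x) w := by
  have hf := mfderiv_isInvertible f x
  refine Prod.ext ?_ ?_
  · change mfderiv 𝓘(ℝ, Fin m → ℝ) 𝓘(ℝ, Fin m → ℝ) f x
      ((chartDiff (pullChart f c) x).inverse _) = (chartDiff c (f x)).inverse _
    rw [chartDiff_pullChart f hc hx, hf.inverse_comp_apply_of_right, hf.self_apply_inverse]
  · refine ContinuousLinearMap.ext fun y => ?_
    change (∑ i, w (Sum.inr i) • ContinuousLinearMap.proj (R := ℝ) (φ := fun _ : Fin m => ℝ) i)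
      (chartDiff (pullChart f c) x ((mfderiv 𝓘(ℝ, Fin m → ℝ) 𝓘(ℝ, Fin m → ℝ) f x).inverse y)) =
      (∑ i, w (Sum.inr i) • ContinuousLinearMap.proj (R := ℝ) (φ := fun _ : Fin m => ℝ) i)
        (chartDiff c (f x) y)
    rw [chartDiff_pullChart f hc hx, ContinuousLinearMap.comp_apply, hf.self_apply_inverse]

theorem fibreCoord_liftFibre (hc : c ∈ smoothCharts m N)
    (hfc : pullChart f c ∈ smoothCharts m M) {x : M} (hx : f x ∈ c.source)
    (Z : BigFiber (m := m) x) :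
    fibreCoord c (f x) (liftFibre f x Z) = fibreCoord (pullChart f c) x Z := by
  have hx' : x ∈ (pullChart f c).source := (mem_pullChart_source f).2 hx
  conv_lhs => rw [← fibreVec_fibreCoord hfc hx' Z]
  rw [liftFibre_fibreVec f hc hx, fibreCoord_fibreVec hc hx]

theorem natChart_lift (hc : c ∈ smoothCharts m N) (hfc : pullChart f c ∈ smoothCharts m M)
    {p : BigTan m M} (hp : f p.proj ∈ c.source) :
    natChart c (lift f p) = natChart (pullChart f c) p :=
  Prod.ext rfl (fibreCoord_liftFibre f hc hfc hp p.snd)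

theorem lift_natParam (hc : c ∈ smoothCharts m N) (hfc : pullChart f c ∈ smoothCharts m M)
    {a : (Fin m → ℝ) × VVec m} (ha : a.1 ∈ c.target) :
    lift f (natParam (pullChart f c) a) = natParam c a := by
  have hp : f (natParam (pullChart f c) a).proj ∈ c.source := by
    change f (f.symm (c.symm a.1)) ∈ c.source
    rw [f.apply_symm_apply]
    exact c.map_target ha
  have h1 := natChart_lift f hc hfc hp
  rw [natChart_natParam hfc ((mem_pullChart_target f).2 ha)] at h1
  exact (natParam_natChart hc (p := lift f (natParam (pullChart f c) a)) hp).symm.trans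
    (congrArg (natParam c) h1)

/-- Locally the lift is `natParam c` after `natChart (c ∘ f)`. Continuity is what makes the
preimages of Borel pieces Borel. -/
theorem continuous_lift [Nonempty M] (hcov : ∀ x : N, ∃ c ∈ smoothCharts m N,
    x ∈ c.source ∧ pullChart f c ∈ smoothCharts m M) : Continuous (lift (m := m) f) := by
  refine continuous_iff_continuousAt.2 fun p => ?_
  obtain ⟨c, hc, hp, hfc⟩ := hcov (f p.proj)
  have hp' : p.proj ∈ (pullChart f c).source := (mem_pullChart_source f).2 hp
  have h1 : ContinuousAt (fun q => natParam c (natChart (pullChart f c) q)) p :=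
    ContinuousAt.comp (contMDiffAt_natParam hc
      ((mem_pullChart_target f).1 ((pullChart f c).map_source hp'))).continuousAt
      (contMDiffAt_natChart hfc hp').continuousAt
  refine h1.congr ?_
  filter_upwards [(isOpen_proj_preimage (pullChart f c).open_source).mem_nhds hp'] with q hq
  have hq' := (mem_pullChart_source f).1 hq
  rw [← natChart_lift f hc hfc hq']
  exact natParam_natChart hc (p := lift f q) hq'

variable {f} {F : DoubleField m M} {F' : DoubleField m N}

theorem IsPullback.comps_eq (h : IsPullback f F F') (hc : c ∈ smoothCharts m N) {x : M}
    (hx : f x ∈ c.source) : comps F.metric (pullChart f c) x = comps F'.metric c (f x) := by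
  funext u
  refine Matrix.ext fun q s => ?_
  have h1 := h.metric ⟨x, fibreVec (pullChart f c) x u⟩
    (fibreVec (pullChart f c) x (unitVec q)) (fibreVec (pullChart f c) x (unitVec s))
  refine h1.trans ?_
  change F'.metric ⟨f x, liftFibre f x (fibreVec (pullChart f c) x u)⟩
    (liftFibre f x (fibreVec (pullChart f c) x (unitVec q)))
    (liftFibre f x (fibreVec (pullChart f c) x (unitVec s))) = _
  rw [liftFibre_fibreVec f hc hx (unitVec q), liftFibre_fibreVec f hc hx (unitVec s)]
  exact congrArg (fun V : BigFiber (m := m) (f x) =>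
    F'.metric ⟨f x, V⟩ (fibreVec c (f x) (unitVec q)) (fibreVec c (f x) (unitVec s)))
    (liftFibre_fibreVec f hc hx u)

theorem IsPullback.natScalar_eq (h : IsPullback f F F') (hc : c ∈ smoothCharts m N)
    (hfc : pullChart f c ∈ smoothCharts m M) {p : BigTan m M} (hp : f p.proj ∈ c.source) :
    F.natScalar (pullChart f c) p = F'.natScalar c (lift f p) := by
  rw [F.natScalar_eq_deformedScalar hfc ((mem_pullChart_source f).2 hp),
    F'.natScalar_eq_deformedScalar hc (p := lift f p) hp, h.comps_eq hc hp,
    ← fibreCoord_liftFibre f hc hfc hp]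
  rfl

theorem IsPullback.detSigma_eq (h : IsPullback f F F') (hc : c ∈ smoothCharts m N)
    (hfc : pullChart f c ∈ smoothCharts m M) {p : BigTan m M} (hp : f p.proj ∈ c.source) :
    F.detSigma (pullChart f c) p = F'.detSigma c (lift f p) := by
  rw [DoubleField.detSigma, h.comps_eq hc hp, ← fibreCoord_liftFibre f hc hfc hp]
  rfl

/-- On the natural frame the volume form reduces to `√|det σ|`, so the coefficient depends only on
the density and on the components of the metric, which agree in the charts `c ∘ f` and `c`. -/
theorem IsPullback.integrand_eq (h : IsPullback f F F') {φ : BigTan m M → ℝ}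
    {φ' : BigTan m N → ℝ} (hφ : ∀ p, φ p = φ' (lift f p)) (hc : c ∈ smoothCharts m N)
    (hfc : pullChart f c ∈ smoothCharts m M) {a : (Fin m → ℝ) × VVec m} (ha : a.1 ∈ c.target) :
    F.integrand φ (pullChart f c) a = F'.integrand φ' c a := by
  have hp : f (natParam (pullChart f c) a).proj ∈ c.source :=
    (mem_pullChart_source f).1 ((pullChart f c).map_target ((mem_pullChart_target f).2 ha))
  rw [F.integrand_eq φ hfc ((mem_pullChart_target f).2 ha), F'.integrand_eq φ' hc ha,
    h.natScalar_eq hc hfc hp, h.detSigma_eq hc hfc hp, hφ, lift_natParam f hc hfc ha]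

variable {O : Orientation m M} {O' : Orientation m N}

theorem PreservesOrientation.pullChart_mem (hf : PreservesOrientation f O O')
    (hc : c ∈ O'.charts) : pullChart f c ∈ smoothCharts m M := O.subset (hf c hc)

/-- The pullback of a decomposition by the lift of a diffeomorphism. -/
def Decomposition.pullback [Nonempty M] (hf : PreservesOrientation f O O') (d : Decomposition O') :
    Decomposition O where
  chart n := pullChart f (d.chart n)
  chart_mem n := hf _ (d.chart_mem n)
  piece n := lift f ⁻¹' d.piece n
  measurable n := by
    borelize (BigTan m M) (BigTan m N)
    refine (continuous_lift f fun x => ?_).measurable (d.measurable n)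
    obtain ⟨c, hc, hx⟩ := O'.cover x
    exact ⟨c, O'.subset hc, hx, hf.pullChart_mem hc⟩
  piece_subset n p hp := (mem_pullChart_source f).2 (d.piece_subset n _ hp)
  disjoint n k hnk := (d.disjoint hnk).preimage _
  iUnion := by rw [← Set.preimage_iUnion, d.iUnion, Set.preimage_univ]

theorem Decomposition.image_pullback [Nonempty M] (hf : PreservesOrientation f O O')
    (d : Decomposition O') (n : ℕ) :
    natChart ((d.pullback hf).chart n) '' (d.pullback hf).piece n =
      natChart (d.chart n) '' d.piece n := by
  have hc := O'.subset (d.chart_mem n)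
  have hfc := hf.pullChart_mem (d.chart_mem n)
  rw [natChart_image_eq hc (d.piece_subset n),
    natChart_image_eq (O.subset ((d.pullback hf).chart_mem n)) ((d.pullback hf).piece_subset n)]
  ext a
  refine and_congr_right_iff.2 ?_ |>.trans (and_congr_left_iff.2 fun _ => mem_pullChart_target f)
  intro ha
  change lift f (natParam (pullChart f (d.chart n)) a) ∈ d.piece n ↔ _
  rw [lift_natParam f hc hfc ((mem_pullChart_target f).1 ha)]

/-- Corresponding pieces have the same image in coordinate space and carry the same integrand, so
the series agree term by term. -/
theorem IsPullback.action_eq [Nonempty M] (h : IsPullback f F F') {φ : BigTan m M → ℝ}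
    {φ' : BigTan m N → ℝ} (hφ : ∀ p, φ p = φ' (lift f p)) (hf : PreservesOrientation f O O')
    (d : Decomposition O') :
    (F.FiniteAction φ (d.pullback hf) → F'.FiniteAction φ' d) ∧
      F'.action φ' d = F.action φ (d.pullback hf) := by
  have hEq (n : ℕ) : Set.EqOn (F.integrand φ ((d.pullback hf).chart n))
      (F'.integrand φ' (d.chart n)) (natChart (d.chart n) '' d.piece n) := by
    rintro _ ⟨p, hp, rfl⟩
    exact h.integrand_eq hφ (O'.subset (d.chart_mem n)) (hf.pullChart_mem (d.chart_mem n))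
      ((d.chart n).map_source (d.piece_subset n p hp))
  have hm (n : ℕ) := measurableSet_natChart_image (O'.subset (d.chart_mem n)) (d.measurable n)
    (d.piece_subset n)
  have e1 (n : ℕ) := setIntegral_congr_fun (μ := volume) (hm n) (hEq n)
  have e2 (n : ℕ) := setIntegral_congr_fun (μ := volume) (hm n)
    fun a ha => congrArg abs (hEq n ha)
  rw [DoubleField.FiniteAction, DoubleField.FiniteAction, DoubleField.action, DoubleField.action]
  simp only [Decomposition.image_pullback, e1, and_true]
  refine fun ⟨h1, h2⟩ => ⟨fun n => (h1 n).congr_fun (hEq n) (hm n), ?_⟩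
  simpa only [e2] using h2

end Diffeomorphism

end BigTangent

end

theorem proposition5p8 {m : ℕ} {M : Type*} [Nonempty M] [TopologicalSpace M] [T2Space M]
    [SecondCountableTopology M] [ChartedSpace (Fin m → ℝ) M] [IsManifold 𝓘(ℝ, Fin m → ℝ) ∞ M]
    (O : BigTangent.Orientation m M) (F : BigTangent.DoubleField m M)
    (φ : BigTangent.BigTan m M → ℝ) (hφ : ContMDiff (BigTangent.BigModel m) 𝓘(ℝ, ℝ) ∞ φ) :
    -- the scalar curvature depends neither on the chart nor on the basis of the vertical space
    (∀ c ∈ BigTangent.smoothCharts m M, ∀ c' ∈ BigTangent.smoothCharts m M,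
      ∀ p : BigTangent.BigTan m M, p.proj ∈ c.source → p.proj ∈ c'.source →
        ∀ b b' : Module.Basis (BigTangent.VIdx m) ℝ (BigTangent.BigFiber (m := m) p.proj),
          F.scalar c p b = F.scalar c' p b') ∧
    -- the volume form does not depend on the positive chart, and has no zeros
    (∀ c ∈ O.charts, ∀ c' ∈ O.charts, ∀ p : BigTangent.BigTan m M,
      p.proj ∈ c.source → p.proj ∈ c'.source →
        F.volForm c p = F.volForm c' p ∧ F.volForm c p ≠ 0) ∧
    -- the integral can be computed, and neither its finiteness nor its value depends on choices
    Nonempty (BigTangent.Decomposition O) ∧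
    (∀ d d' : BigTangent.Decomposition O, F.FiniteAction φ d →
      F.FiniteAction φ d' ∧ F.action φ d' = F.action φ d) ∧
    -- invariance under orientation preserving diffeomorphisms
    (∀ (f : M ≃ₘ^∞⟮𝓘(ℝ, Fin m → ℝ), 𝓘(ℝ, Fin m → ℝ)⟯ M), BigTangent.PreservesOrientation f O O →
      ∀ (F' : BigTangent.DoubleField m M) (φ' : BigTangent.BigTan m M → ℝ),
        BigTangent.IsPullback f F F' → (∀ p, φ p = φ' (BigTangent.lift f p)) →
          ∀ d d' : BigTangent.Decomposition O, F.FiniteAction φ d →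
            F'.FiniteAction φ' d' ∧ F'.action φ' d' = F.action φ d) := by
  refine ⟨fun c hc c' hc' p hp hp' b b' => F.scalar_congr hc hc' hp hp' b b',
    fun c hc c' hc' p hp hp' => ⟨?_, F.volForm_ne_zero (O.subset hc) hp⟩,
    BigTangent.exists_decomposition O, fun d d' h => F.action_congr φ d d' h,
    fun f hf F' φ' hF hφ' d d' h => ?_⟩
  · refine F.volForm_congr (O.subset hc) (O.subset hc') hp hp' ?_
    rw [BigTangent.jac_eq_fderiv (O.subset hc) (O.subset hc') hp hp']
    exact O.jacobian_pos c hc c' hc' _ ⟨hp, hp'⟩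
  -- The decompositions `d` and `d'` are unrelated: the action of `F` is first moved from `d` to the
  -- pullback of `d'`, where it can be compared with that of `F'`.
  · obtain ⟨h1, h2⟩ := F.action_congr φ d (d'.pullback hf) h
    obtain ⟨h3, h4⟩ := hF.action_eq hφ' hf d'
    exact ⟨h3 h1, h4.trans h2⟩
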